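/- Let $M$ be a smooth manifold and let $\pi:E\to M$ be a smooth oriented real vector bundle of rank $2$ with a smooth fibre metric $g$; let $\theta$ be the associated volume form on the fibres. Let $\nabla$ be a smooth linear connection in $E$, $\hat H\subset TE$ its horizontal distribution, and $\omega_v:T_vE\to E_{\pi(v)}$ its connection form, that is, the projection onto the vertical space along $\hat H$, where the vertical space at $v$ is identified with the fibre. Let $Q=P(E)$ be the projectivization of $E$, $\pi:Q\to M$ its projection, $j:E\setminus 0\to Q$, $v\mapsto[v]$, and let $H=dj(\hat H)$ be the horizontal distribution of the connection induced in $Q$. On $E\setminus 0$ consider the $1$-form $$\hat\alpha_v(X)=\frac{1}{2g(v,v)}\,\theta(v,\omega(X)).$$ There is a $1$-form $\bar\alpha$ on $\mathbb{R}P^1$ whose pull-back to $\mathbb{R}^2\setminus 0$ under $y\mapsto[y]$ is $\frac12\,\frac{-y^2dy^1+y^1dy^2}{(y^1)^2+(y^2)^2}$; it is closed and its class generates $H^1(\mathbb{R}P^1;\mathbb{R})$ (it is nonzero and spans this space). Moreover: 1. There is a smooth $1$-form $\alpha\in\Omega^1(Q)$ with $j^*\alpha=\hat\alpha$. 2. $\alpha|_H=0$.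 3. The restriction of $\alpha$ to every fibre $Q_x=P(E_x)$ is closed and represents the class $[\bar\alpha]$, when $Q_x$ is identified with $\mathbb{R}P^1$ through any orientation-preserving linear isomorphism $\mathbb{R}^2\to E_x$. 4. If $\nabla$ is compatible with $g$, then $d\alpha=\frac12\pi^*\Omega$, where $\Omega$ is the curvature $2$-form on $M$, $\Omega(X,Y)=g(R(X,Y)e_1,e_2)$ for any positively oriented orthonormal basis $(e_1,e_2)$ of the fibre, $R(X,Y)=[\nabla_X,\nabla_Y]-\nabla_{[X,Y]}$. -/

import Mathlib

open Bundle Manifold Set Module Topology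
open scoped ContDiff Topology LinearAlgebra.Projectivization

noncomputable section

set_option linter.unusedSectionVars false

/-! ### The projection from nonzero vectors to lines -/

/-- The model plane `ℝ²`. -/
abbrev Plane : Type := EuclideanSpace ℝ (Fin 2)

/-- The real projective line `ℝP¹`. -/
abbrev RP1 : Type := ℙ ℝ Plane

section Line

variable {W : Type*} [AddCommGroup W] [Module ℝ W]

/-- The line `[w]` spanned by a nonzero vector `w` (an arbitrary line if `w = 0`). -/
def lineOf [Nontrivial W] (w : W) : ℙ ℝ W :=
  open Classical in
  if hw : w ≠ 0 then Projectivization.mk ℝ w hw else Classical.arbitrary _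

theorem lineOf_of_ne [Nontrivial W] {w : W} (hw : w ≠ 0) :
    lineOf w = Projectivization.mk ℝ w hw := by
  simp [lineOf, hw]

/-- For a linear map `A : W → ℝ²`, the affine coordinate `[w] ↦ (A w)_{1-i} / (A w)_i`. -/
def lineCoord (A : W →ₗ[ℝ] Plane) (i : Fin 2) : ℙ ℝ W → ℝ :=
  Projectivization.lift (fun w => A w.1 (1 - i) / A w.1 i) (by
    rintro ⟨a, ha⟩ ⟨b, hb⟩ t h
    have ht : t ≠ 0 := by rintro rfl; simp at h; exact ha h
    simp only at h
    subst h
    simp [mul_div_mul_left _ _ ht])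

/-- The domain `{[w] | (A w)_i ≠ 0}` of the affine coordinate. -/
def lineDomain (A : W →ₗ[ℝ] Plane) (i : Fin 2) : Set (ℙ ℝ W) :=
  {L | Projectivization.lift (fun w => A w.1 i ≠ 0) (by
    rintro ⟨a, ha⟩ ⟨b, hb⟩ t h
    have ht : t ≠ 0 := by rintro rfl; simp at h; exact ha h
    simp only at h
    subst h
    simp [ht]) L}

theorem lineCoord_lineOf [Nontrivial W] (A : W →ₗ[ℝ] Plane) (i : Fin 2) {w : W} (hw : w ≠ 0) :
    lineCoord A i (lineOf w) = A w (1 - i) / A w i := by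
  rw [lineOf_of_ne hw]; rfl

theorem lineOf_mem_lineDomain [Nontrivial W] (A : W →ₗ[ℝ] Plane) (i : Fin 2) {w : W}
    (hw : w ≠ 0) : lineOf w ∈ lineDomain A i ↔ A w i ≠ 0 := by
  rw [lineOf_of_ne hw]; rfl

theorem exists_lineOf [Nontrivial W] (L : ℙ ℝ W) : ∃ w : W, w ≠ 0 ∧ lineOf w = L := by
  induction L with
  | h w hw => exact ⟨w, hw, lineOf_of_ne hw⟩

theorem lineOf_smul [Nontrivial W] {c : ℝ} (hc : c ≠ 0) {w : W} (hw : w ≠ 0) :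
    lineOf (c • w) = lineOf w := by
  rw [lineOf_of_ne hw, lineOf_of_ne (smul_ne_zero hc hw), Projectivization.mk_eq_mk_iff']
  exact ⟨c, rfl⟩

/-- The vector of `ℝ²` with `i`-th coordinate `1` and other coordinate `t`. -/
def affinePoint (i : Fin 2) (t : ℝ) : Plane :=
  EuclideanSpace.single i 1 + t • EuclideanSpace.single (1 - i) 1

@[simp] theorem affinePoint_self (i : Fin 2) (t : ℝ) : affinePoint i t i = 1 := by
  fin_cases i <;> simp [affinePoint]

@[simp] theorem affinePoint_other (i : Fin 2) (t : ℝ) : affinePoint i t (1 - i) = t := by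
  fin_cases i <;> simp [affinePoint]

theorem affinePoint_ne_zero (i : Fin 2) (t : ℝ) : affinePoint i t ≠ 0 := fun h => by
  have := affinePoint_self i t
  simp [h] at this

theorem affinePoint_div {i : Fin 2} {y : Plane} (hy : y i ≠ 0) :
    affinePoint i (y (1 - i) / y i) = (y i)⁻¹ • y := by
  ext k
  fin_cases i <;> fin_cases k <;> simp_all [affinePoint, div_eq_inv_mul]

theorem contDiff_affinePoint (i : Fin 2) : ContDiff ℝ ∞ (affinePoint i) := by
  unfold affinePoint; fun_prop

end Line

/-! ### The projective line as a smooth manifold -/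

/-- Quotient topology of `ℝ² ∖ 0`. -/
instance : TopologicalSpace RP1 :=
  inferInstanceAs (TopologicalSpace (Quotient (projectivizationSetoid ℝ Plane)))

theorem isQuotientMap_RP1 :
    IsQuotientMap (fun y : {y : Plane // y ≠ 0} => (lineOf y.1 : RP1)) := by
  have : (fun y : {y : Plane // y ≠ 0} => (lineOf y.1 : RP1)) = Projectivization.mk' ℝ := by
    funext y
    exact lineOf_of_ne y.2
  rw [this]
  exact isQuotientMap_quotient_mk'

theorem continuousOn_lineOf_RP1 : ContinuousOn (lineOf : Plane → RP1) {y | y ≠ 0} := by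
  rw [continuousOn_iff_continuous_domRestrict]
  exact isQuotientMap_RP1.continuous

/-- The affine chart `[y] ↦ y_{1-i} / y_i` of `ℝP¹`. -/
def RP1.chart (i : Fin 2) : OpenPartialHomeomorph RP1 ℝ where
  toFun := lineCoord LinearMap.id i
  invFun t := lineOf (affinePoint i t)
  source := lineDomain LinearMap.id i
  target := univ
  map_source' _ _ := mem_univ _
  map_target' t _ := by
    rw [lineOf_mem_lineDomain _ _ (affinePoint_ne_zero i t)]; simp
  left_inv' L hL := by
    obtain ⟨w, hw, rfl⟩ := exists_lineOf L
    rw [lineOf_mem_lineDomain _ _ hw] at hL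
    rw [lineCoord_lineOf _ _ hw]
    simp only [LinearMap.id_apply] at *
    rw [affinePoint_div hL, lineOf_smul (inv_ne_zero hL) hw]
  right_inv' t _ := by
    rw [lineCoord_lineOf _ _ (affinePoint_ne_zero i t)]; simp
  open_source := by
    rw [← isQuotientMap_RP1.isOpen_preimage]
    have : (fun y : {y : Plane // y ≠ 0} => (lineOf y.1 : RP1)) ⁻¹'
        lineDomain LinearMap.id i = {y | y.1 i ≠ 0} := by
      ext y; exact lineOf_mem_lineDomain _ _ y.2
    rw [this]
    exact isOpen_ne_fun (by fun_prop) continuous_const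
  open_target := isOpen_univ
  continuousOn_toFun := by
    have ho : IsOpen (lineDomain (LinearMap.id : Plane →ₗ[ℝ] Plane) i) := by
      rw [← isQuotientMap_RP1.isOpen_preimage]
      have : (fun y : {y : Plane // y ≠ 0} => (lineOf y.1 : RP1)) ⁻¹'
          lineDomain LinearMap.id i = {y | y.1 i ≠ 0} := by
        ext y; exact lineOf_mem_lineDomain _ _ y.2
      rw [this]
      exact isOpen_ne_fun (by fun_prop) continuous_const
    rw [isQuotientMap_RP1.continuousOn_isOpen_iff ho]
    have : ContinuousOn (fun y : {y : Plane // y ≠ 0} => y.1 (1 - i) / y.1 i)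
        {y | y.1 i ≠ 0} :=
      ContinuousOn.div (by fun_prop) (by fun_prop) (fun y hy => hy)
    refine (this.mono ?_).congr ?_
    · intro y hy; exact (lineOf_mem_lineDomain _ _ y.2).1 hy
    · intro y hy; exact lineCoord_lineOf _ _ y.2
  continuousOn_invFun := by
    refine continuousOn_lineOf_RP1.comp (contDiff_affinePoint i).continuous.continuousOn ?_
    intro t _
    exact affinePoint_ne_zero i t

theorem exists_coord_ne {y : Plane} (hy : y ≠ 0) : ∃ i, y i ≠ 0 := by
  by_contra! h
  exact hy (by ext i; simpa using h i)

theorem exists_mem_lineDomain {W : Type*} [AddCommGroup W] [Module ℝ W] [Nontrivial W]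
    (A : W →ₗ[ℝ] Plane) (hA : Function.Injective A) (L : ℙ ℝ W) :
    ∃ i, L ∈ lineDomain A i := by
  obtain ⟨w, hw, rfl⟩ := exists_lineOf L
  obtain ⟨i, hi⟩ := exists_coord_ne (y := A w) (by simpa [map_eq_zero_iff A hA] using hw)
  exact ⟨i, (lineOf_mem_lineDomain _ _ hw).2 hi⟩

instance : ChartedSpace ℝ RP1 where
  atlas := range RP1.chart
  chartAt L := RP1.chart (exists_mem_lineDomain LinearMap.id Function.injective_id L).choose
  mem_chart_source L := (exists_mem_lineDomain LinearMap.id Function.injective_id L).choose_spec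
  chart_mem_atlas _ := mem_range_self _

instance : IsManifold 𝓘(ℝ, ℝ) ∞ RP1 := by
  refine isManifold_of_contDiffOn _ _ _ ?_
  rintro _ _ ⟨i, rfl⟩ ⟨j, rfl⟩
  have : ContDiffOn ℝ ∞ (fun t => affinePoint i t (1 - j) / affinePoint i t j)
      {t | affinePoint i t j ≠ 0} := by
    have h := contDiff_affinePoint i
    refine ContDiffOn.div ?_ ?_ (fun t ht => ht) <;>
    · refine ContDiff.contDiffOn ?_
      fun_prop
  refine (this.mono ?_).congr ?_
  · intro t ht
    simp only [mfld_simps] at ht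
    exact (lineOf_mem_lineDomain _ _ (affinePoint_ne_zero i t)).1 ht.2
  · intro t ht
    exact lineCoord_lineOf _ _ (affinePoint_ne_zero i t)

/-! ### The projectivization of a rank two vector bundle -/

section Projectivization

variable {EM : Type*} [NormedAddCommGroup EM] [NormedSpace ℝ EM]
  {M : Type*} [TopologicalSpace M]
  {V : M → Type*} [TopologicalSpace (TotalSpace Plane V)]
  [∀ x, NormedAddCommGroup (V x)] [∀ x, InnerProductSpace ℝ (V x)]
  [FiberBundle Plane V] [VectorBundle ℝ Plane V]

theorem finrank_fiber (V : M → Type*) [TopologicalSpace (TotalSpace Plane V)]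
    [∀ x, NormedAddCommGroup (V x)] [∀ x, InnerProductSpace ℝ (V x)]
    [FiberBundle Plane V] [VectorBundle ℝ Plane V] (x : M) : finrank ℝ (V x) = 2 := by
  rw [(VectorBundle.continuousLinearEquivAt ℝ Plane V x).toLinearEquiv.finrank_eq]
  simp

theorem nontrivial_fiber (V : M → Type*) [TopologicalSpace (TotalSpace Plane V)]
    [∀ x, NormedAddCommGroup (V x)] [∀ x, InnerProductSpace ℝ (V x)]
    [FiberBundle Plane V] [VectorBundle ℝ Plane V] (x : M) : Nontrivial (V x) :=
  Module.nontrivial_of_finrank_pos (R := ℝ) (by rw [finrank_fiber V x]; norm_num)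

/-- The total space of the projectivization `P(V)`: a point `proj` of `M` and a line in the fibre of
`V` over it. -/
structure ProjBundle {M : Type*} (V : M → Type*) [∀ x, NormedAddCommGroup (V x)]
    [∀ x, InnerProductSpace ℝ (V x)] where
  /-- The bundle projection `P(V) → M`. -/
  proj : M
  /-- The line. -/
  line : ℙ ℝ (V proj)

/-- The canonical projection `j : V ∖ 0 → P(V)`, `v ↦ [v]` (arbitrary on the zero section). -/
def toProj (v : TotalSpace Plane V) : ProjBundle V :=
  haveI := nontrivial_fiber V v.proj
  ⟨v.proj, lineOf v.2⟩

/-- The quotient topology of `V ∖ 0`. -/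
instance : TopologicalSpace (ProjBundle V) :=
  .coinduced (fun v : {v : TotalSpace Plane V // v.2 ≠ 0} => toProj v.1) inferInstance

theorem exists_toProj (q : ProjBundle V) : ∃ v : TotalSpace Plane V, v.2 ≠ 0 ∧ toProj v = q := by
  obtain ⟨x, L⟩ := q
  have := nontrivial_fiber V x
  obtain ⟨w, hw, rfl⟩ := exists_lineOf L
  exact ⟨⟨x, w⟩, hw, rfl⟩

theorem isQuotientMap_toProj :
    IsQuotientMap (fun v : {v : TotalSpace Plane V // v.2 ≠ 0} => toProj v.1) :=
  ⟨⟨rfl⟩, fun q => by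
    obtain ⟨v, hv, rfl⟩ := exists_toProj q
    exact ⟨⟨v, hv⟩, rfl⟩⟩

theorem continuousOn_toProj :
    ContinuousOn (toProj : TotalSpace Plane V → ProjBundle V) {v | v.2 ≠ 0} := by
  rw [continuousOn_iff_continuous_domRestrict]
  exact isQuotientMap_toProj.continuous

theorem toProj_smul {x : M} {c : ℝ} (hc : c ≠ 0) {w : V x} (hw : w ≠ 0) :
    toProj (⟨x, c • w⟩ : TotalSpace Plane V) = toProj ⟨x, w⟩ := by
  have := nontrivial_fiber V x
  simp only [toProj, lineOf_smul hc hw]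

/-- The chart domain of `P(V)` over a chart `φ` of `M` and a trivialization `e` of `V`. -/
def projChartSource (φ : OpenPartialHomeomorph M EM) (e : Trivialization Plane (π Plane V))
    [MemTrivializationAtlas e] (i : Fin 2) : Set (ProjBundle V) :=
  {q | q.proj ∈ φ.source ∧ q.proj ∈ e.baseSet ∧ q.line ∈ lineDomain (e.linearMapAt ℝ q.proj) i}

variable (φ : OpenPartialHomeomorph M EM) (e : Trivialization Plane (π Plane V))
    [MemTrivializationAtlas e] (i : Fin 2)

theorem toProj_mem_projChartSource {v : TotalSpace Plane V} (hv : v.2 ≠ 0) :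
    toProj v ∈ projChartSource φ e i ↔
      v.proj ∈ φ.source ∧ v.proj ∈ e.baseSet ∧ (e v).2 i ≠ 0 := by
  have := nontrivial_fiber V v.proj
  simp only [projChartSource, toProj, mem_ofPred_eq]
  rw [lineOf_mem_lineDomain _ _ hv]
  refine and_congr_right fun _ => and_congr_right fun h => ?_
  rw [e.linearMapAt_apply, if_pos h]

theorem lineCoord_toProj {v : TotalSpace Plane V} (hv : v.2 ≠ 0) (h : v.proj ∈ e.baseSet) :
    lineCoord (e.linearMapAt ℝ (toProj v).proj) i (toProj v).line = (e v).2 (1 - i) / (e v).2 i := by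
  have := nontrivial_fiber V v.proj
  refine (lineCoord_lineOf (e.linearMapAt ℝ v.proj) i hv).trans ?_
  rw [e.linearMapAt_apply, if_pos h]

theorem isOpen_projChartLift :
    IsOpen {v : TotalSpace Plane V | v.proj ∈ φ.source ∧ v.proj ∈ e.baseSet ∧ (e v).2 i ≠ 0} := by
  have h1 : IsOpen {v : TotalSpace Plane V | v.proj ∈ φ.source} :=
    φ.open_source.preimage (FiberBundle.continuous_proj Plane V)
  have hc : ContinuousOn (fun v => (e v).2 i) e.source := by
    have := e.continuousOn
    fun_prop
  have h2 := hc.isOpen_inter_preimage e.open_source (isOpen_ne (x := (0 : ℝ)))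
  convert h1.inter h2 using 1
  ext v
  simp [e.mem_source]

theorem isOpen_projChartSource : IsOpen (projChartSource φ e i) := by
  rw [← isQuotientMap_toProj.isOpen_preimage]
  convert (isOpen_projChartLift φ e i).preimage continuous_subtype_val using 1
  ext v
  exact toProj_mem_projChartSource φ e i v.2

theorem trivialization_symm_ne_zero {x : M} (hx : x ∈ e.baseSet) {y : Plane} (hy : y ≠ 0) :
    (e.toOpenPartialHomeomorph.symm (x, y)).2 ≠ 0 := by
  intro h
  have h1 := e.apply_symm_apply' (x := y) hx
  have h2 : (e.toOpenPartialHomeomorph.symm (x, y)).proj = x := e.proj_symm_apply' hx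
  set v := e.toOpenPartialHomeomorph.symm (x, y)
  have h3 : e.linearMapAt ℝ v.proj v.2 = y := by
    rw [e.linearMapAt_apply, if_pos (by rwa [h2])]
    exact congrArg Prod.snd h1
  rw [h, map_zero] at h3
  exact hy h3.symm

/-- The chart `[v] ↦ (φ x, y_{1-i} / y_i)` of `P(V)`, where `v ∈ V x` has coordinates `y ∈ ℝ²` in
the trivialization `e`. -/
def projChart : OpenPartialHomeomorph (ProjBundle V) (EM × ℝ) where
  toFun q := (φ q.proj, lineCoord (e.linearMapAt ℝ q.proj) i q.line)
  invFun p := toProj (e.toOpenPartialHomeomorph.symm (φ.symm p.1, affinePoint i p.2))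
  source := projChartSource φ e i
  target := {p | p.1 ∈ φ.target ∧ φ.symm p.1 ∈ e.baseSet}
  map_source' q hq := ⟨φ.map_source hq.1, by simpa [φ.left_inv hq.1] using hq.2.1⟩
  map_target' p hp := by
    have hne := trivialization_symm_ne_zero e hp.2 (affinePoint_ne_zero i p.2)
    rw [toProj_mem_projChartSource φ e i hne, e.proj_symm_apply' hp.2]
    refine ⟨φ.map_target hp.1, hp.2, ?_⟩
    rw [e.apply_symm_apply' hp.2]
    simp
  left_inv' q hq := by
    obtain ⟨v, hv, rfl⟩ := exists_toProj q
    obtain ⟨h1, h2, h3⟩ := (toProj_mem_projChartSource φ e i hv).1 hq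
    rw [lineCoord_toProj e i hv h2, affinePoint_div h3]
    have : φ.symm (φ (toProj v).proj) = v.proj := φ.left_inv h1
    simp only [this]
    have h4 : (e.toOpenPartialHomeomorph.symm (v.proj, ((e v).2 i)⁻¹ • (e v).2)) =
        ⟨v.proj, ((e v).2 i)⁻¹ • v.2⟩ := by
      have hl := (e.linear ℝ h2).map_smul ((e v).2 i)⁻¹ v.2
      have hs : (⟨v.proj, ((e v).2 i)⁻¹ • v.2⟩ : TotalSpace Plane V) ∈ e.source :=
        e.mem_source.2 h2
      rw [← e.symm_apply_mk_proj hs]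
      congr 2
      exact hl.symm
    rw [h4, toProj_smul (inv_ne_zero h3) hv]
  right_inv' p hp := by
    have hne := trivialization_symm_ne_zero e hp.2 (affinePoint_ne_zero i p.2)
    have hpr := e.proj_symm_apply' (x := affinePoint i p.2) hp.2
    refine Prod.ext ?_ ?_
    · have : (toProj (e.toOpenPartialHomeomorph.symm (φ.symm p.1, affinePoint i p.2))).proj =
        φ.symm p.1 := hpr
      simp only [this]
      exact φ.right_inv hp.1
    · simp only
      rw [lineCoord_toProj e i hne (by rw [hpr]; exact hp.2), e.apply_symm_apply' hp.2]
      simp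
  open_source := isOpen_projChartSource φ e i
  open_target := by
    have := φ.continuousOn_symm.isOpen_inter_preimage φ.open_target e.open_baseSet
    exact this.preimage continuous_fst
  continuousOn_toFun := by
    rw [isQuotientMap_toProj.continuousOn_isOpen_iff (isOpen_projChartSource φ e i)]
    have hc : ContinuousOn (fun v => (φ v.proj, (e v).2 (1 - i) / (e v).2 i))
        {v : TotalSpace Plane V | v.proj ∈ φ.source ∧ v.proj ∈ e.baseSet ∧ (e v).2 i ≠ 0} := by
      have he : ContinuousOn e
          {v : TotalSpace Plane V | v.proj ∈ φ.source ∧ v.proj ∈ e.baseSet ∧ (e v).2 i ≠ 0} :=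
        e.continuousOn.mono fun v hv => e.mem_source.2 hv.2.1
      refine ContinuousOn.prodMk ?_ ?_
      · exact φ.continuousOn.comp (FiberBundle.continuous_proj Plane V).continuousOn
          fun v hv => hv.1
      · exact ContinuousOn.div (by fun_prop) (by fun_prop) fun v hv => hv.2.2
    refine ContinuousOn.congr (hc.comp continuous_subtype_val.continuousOn ?_) ?_
    · intro v hv
      exact (toProj_mem_projChartSource φ e i v.2).1 hv
    · intro v hv
      have h := (toProj_mem_projChartSource φ e i v.2).1 hv
      exact Prod.ext rfl (lineCoord_toProj e i v.2 h.2.1)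
  continuousOn_invFun := by
    refine continuousOn_toProj.comp (e.toOpenPartialHomeomorph.continuousOn_symm.comp
      (ContinuousOn.prodMk ?_ ?_) ?_) ?_
    · exact φ.continuousOn_symm.comp continuous_fst.continuousOn fun p hp => hp.1
    · exact ((contDiff_affinePoint i).continuous.comp continuous_snd).continuousOn
    · intro p hp
      exact e.mem_target.2 hp.2
    · intro p hp
      exact trivialization_symm_ne_zero e hp.2 (affinePoint_ne_zero i p.2)

variable [ChartedSpace EM M]

theorem exists_mem_projChartSource (q : ProjBundle V) : ∃ i,
    q ∈ projChartSource (chartAt EM q.proj) (trivializationAt Plane V q.proj) i := by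
  have := nontrivial_fiber V q.proj
  have hb := FiberBundle.mem_baseSet_trivializationAt' (F := Plane) (E := V) q.proj
  obtain ⟨i, hi⟩ := exists_mem_lineDomain
    ((trivializationAt Plane V q.proj).linearMapAt ℝ q.proj) (by
      rw [(trivializationAt Plane V q.proj).coe_linearMapAt_of_mem hb]
      exact ((trivializationAt Plane V q.proj).linearEquivAt ℝ q.proj hb).injective) q.line
  exact ⟨i, mem_chart_source EM q.proj, hb, hi⟩

/-- The smooth structure of `P(V)`: affine fibre coordinates in the local trivializations. -/
instance : ChartedSpace (EM × ℝ) (ProjBundle V) where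
  atlas := {c | ∃ (x : M) (i : Fin 2),
    c = projChart (chartAt EM x) (trivializationAt Plane V x) i}
  chartAt q := projChart (chartAt EM q.proj) (trivializationAt Plane V q.proj)
    (exists_mem_projChartSource q).choose
  mem_chart_source q := (exists_mem_projChartSource q).choose_spec
  chart_mem_atlas q := ⟨q.proj, _, rfl⟩

instance [IsManifold 𝓘(ℝ, EM) ∞ M] [ContMDiffVectorBundle ∞ Plane V 𝓘(ℝ, EM)] :
    IsManifold 𝓘(ℝ, EM × ℝ) ∞ (ProjBundle V) := by
  refine isManifold_of_contDiffOn _ _ _ ?_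
  rintro _ _ ⟨x, i, rfl⟩ ⟨x', i', rfl⟩
  set φ := chartAt EM x
  set φ' := chartAt EM x'
  set e := trivializationAt Plane V x
  set e' := trivializationAt Plane V x'
  -- the lift of the inverse chart to the bundle of nonzero vectors
  let s : EM × ℝ → TotalSpace Plane V := fun p =>
    e.toOpenPartialHomeomorph.symm (φ.symm p.1, affinePoint i p.2)
  let D : Set (EM × ℝ) := {p | (p.1 ∈ φ.target ∧ φ.symm p.1 ∈ e.baseSet) ∧
    (s p).proj ∈ φ'.source ∧ (s p).proj ∈ e'.baseSet ∧ (e' (s p)).2 i' ≠ 0}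
  have hs : ContMDiffOn 𝓘(ℝ, EM × ℝ) (𝓘(ℝ, EM).prod 𝓘(ℝ, Plane)) ∞ s D := by
    refine (e.contMDiffOn_symm (n := ∞) (IB := 𝓘(ℝ, EM))).comp (t := e.target)
      (ContMDiffOn.prodMk ?_ ?_) ?_
    · exact (contMDiffOn_chart_symm (I := 𝓘(ℝ, EM)) (n := ∞) (x := x)).comp
        contDiff_fst.contMDiff.contMDiffOn fun p hp => hp.1.1
    · exact ((contDiff_affinePoint i).comp contDiff_snd).contMDiff.contMDiffOn
    · exact fun p hp => e.mem_target.2 hp.1.2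
  have h1 : ContMDiffOn 𝓘(ℝ, EM × ℝ) 𝓘(ℝ, EM) ∞ (fun p => φ' (s p).proj) D := by
    refine (contMDiffOn_chart (I := 𝓘(ℝ, EM)) (n := ∞) (x := x')).comp
      ((contMDiff_proj V).comp_contMDiffOn hs) fun p hp => hp.2.1
  have h2 : ContMDiffOn 𝓘(ℝ, EM × ℝ) 𝓘(ℝ, Plane) ∞ (fun p => (e' (s p)).2) D := by
    refine ContMDiffOn.comp (t := univ) contMDiff_snd.contMDiffOn
      ((e'.contMDiffOn (n := ∞) (IB := 𝓘(ℝ, EM))).comp hs ?_) (fun _ _ => mem_univ _)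
    exact fun p hp => e'.mem_source.2 hp.2.2.1
  rw [contMDiffOn_iff_contDiffOn] at h1 h2
  have h3 (k : Fin 2) : ContDiffOn ℝ ∞ (fun p => (e' (s p)).2 k) D :=
    (contDiff_euclidean.1 contDiff_id k).comp_contDiffOn h2
  have key : ContDiffOn ℝ ∞
      (fun p => (φ' (s p).proj, (e' (s p)).2 (1 - i') / (e' (s p)).2 i')) D :=
    h1.prodMk ((h3 _).div (h3 _) fun p hp => hp.2.2.2)
  have hmem : ∀ p ∈ ((projChart φ e i).symm ≫ₕ projChart φ' e' i').source, p ∈ D := by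
    intro p hp
    rw [OpenPartialHomeomorph.trans_source] at hp
    have hp1 : p.1 ∈ φ.target ∧ φ.symm p.1 ∈ e.baseSet := hp.1
    have hne := trivialization_symm_ne_zero e hp1.2 (affinePoint_ne_zero i p.2)
    exact ⟨hp1, (toProj_mem_projChartSource φ' e' i' hne).1 hp.2⟩
  refine (key.mono ?_).congr ?_
  · intro p hp
    simp only [mfld_simps] at hp
    exact hmem p (by simpa only [mfld_simps] using hp)
  · intro p hp
    have hD : p ∈ D := hmem p (by simpa only [mfld_simps] using hp)
    have hne := trivialization_symm_ne_zero e hD.1.2 (affinePoint_ne_zero i p.2)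
    exact Prod.ext rfl (lineCoord_toProj e' i' hne hD.2.2.1)

end Projectivization

/-! ### One-forms, exterior derivative, first de Rham cohomology -/

section Forms

variable (E : Type*) [NormedAddCommGroup E] [NormedSpace ℝ E]
  (N : Type*) [TopologicalSpace N] [ChartedSpace E N] [IsManifold 𝓘(ℝ, E) ∞ N]

/-- `Ω¹(N)`: smooth sections of the cotangent bundle of `N`. -/
abbrev OneForm : Type _ :=
  ContMDiffSection 𝓘(ℝ, E) (E →L[ℝ] ℝ) ∞
    (fun q : N => TangentSpace 𝓘(ℝ, E) q →L[ℝ] Bundle.Trivial N ℝ q)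

variable {E N}

/-- The coordinate expression of a 1-form in the preferred chart `φ` at `q`, that is, its pull-back
under `φ⁻¹`. -/
def OneForm.inChart (α : OneForm E N) (q : N) (y : E) : E →L[ℝ] ℝ :=
  (α ((chartAt E q).symm y) : E →L[ℝ] ℝ).comp
    (mfderiv 𝓘(ℝ, E) 𝓘(ℝ, E) (chartAt E q).symm y : E →L[ℝ] E)

/-- The exterior derivative `dα(X, Y) = X (α Y) - Y (α X) - α [X, Y]`, computed on the coordinate
vector fields of the preferred chart at `q`. -/
def OneForm.d (α : OneForm E N) (q : N) (X Y : TangentSpace 𝓘(ℝ, E) q) : ℝ :=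
  let D : E →L[ℝ] E →L[ℝ] ℝ := fderiv ℝ (α.inChart q) (chartAt E q q)
  D X Y - D Y X

theorem OneForm.contDiffOn_inChart [FiniteDimensional ℝ E] (α : OneForm E N) (q : N) :
    ContDiffOn ℝ ∞ (α.inChart q) (chartAt E q).target := by
  rw [contDiffOn_clm_apply]
  intro w
  have hφ := contMDiffOn_chart_symm (I := 𝓘(ℝ, E)) (n := ∞) (x := q)
  have ho := (chartAt E q).open_target
  have h1 : ContMDiffOn 𝓘(ℝ, E) (𝓘(ℝ, E).prod 𝓘(ℝ, E)) ∞
      (fun y : E => (⟨(chartAt E q).symm y, mfderiv 𝓘(ℝ, E) 𝓘(ℝ, E) (chartAt E q).symm y w⟩ :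
        TangentBundle 𝓘(ℝ, E) N)) (chartAt E q).target := by
    have h := hφ.contMDiffOn_tangentMapWithin (m := ∞) (by simp) ho.uniqueMDiffOn
    have hw : ContMDiff 𝓘(ℝ, E) 𝓘(ℝ, E).tangent ∞
        (fun y : E => (⟨y, w⟩ : TangentBundle 𝓘(ℝ, E) E)) :=
      contMDiff_vectorSpace_iff_contDiff.2 contDiff_const
    refine (h.comp hw.contMDiffOn fun y hy => hy).congr fun y hy => ?_
    simp [tangentMapWithin, mfderivWithin_of_isOpen ho hy]
  have h2 : ContMDiffOn 𝓘(ℝ, E) (𝓘(ℝ, E).prod 𝓘(ℝ, E →L[ℝ] ℝ)) ∞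
      (fun y : E => TotalSpace.mk' (E →L[ℝ] ℝ)
        (E := fun q : N => TangentSpace 𝓘(ℝ, E) q →L[ℝ] Bundle.Trivial N ℝ q)
        ((chartAt E q).symm y) (α ((chartAt E q).symm y))) (chartAt E q).target :=
    α.contMDiff.comp_contMDiffOn hφ
  have h3 := h2.clm_bundle_apply (F₂ := ℝ) h1
  intro y hy
  have h4 := (contMDiffWithinAt_totalSpace.1 (h3 y hy)).2
  exact contMDiffWithinAt_iff_contDiffWithinAt.1 h4

theorem OneForm.differentiableAt_inChart [FiniteDimensional ℝ E] (α : OneForm E N) (q : N) :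
    DifferentiableAt ℝ (α.inChart q) (chartAt E q q) :=
  ((α.contDiffOn_inChart q).contDiffAt ((chartAt E q).open_target.mem_nhds
    (mem_chart_target E q))).differentiableAt (by simp)

variable (E N) in
/-- The closed 1-forms. -/
def closedForms [FiniteDimensional ℝ E] : Submodule ℝ (OneForm E N) where
  carrier := {α | ∀ q X Y, α.d q X Y = 0}
  zero_mem' q X Y := by
    have : (0 : OneForm E N).inChart q = fun _ => 0 := by
      funext y
      exact ContinuousLinearMap.zero_comp _
    simp only [OneForm.d, this, fderiv_fun_const]
    exact sub_self (0 : ℝ)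
  add_mem' {α β} hα hβ q X Y := by
    have : (α + β).inChart q = α.inChart q + β.inChart q := by
      funext y
      exact ContinuousLinearMap.add_comp _ _ _
    calc (α + β).d q X Y = α.d q X Y + β.d q X Y := by
          simp only [OneForm.d]
          rw [this, fderiv_add (α.differentiableAt_inChart q) (β.differentiableAt_inChart q)]
          exact add_sub_add_comm _ _ _ _
      _ = 0 := by rw [hα, hβ, add_zero]
  smul_mem' c α hα q X Y := by
    have : (c • α).inChart q = c • α.inChart q := by
      funext y
      exact ContinuousLinearMap.smul_comp _ _ _
    calc (c • α).d q X Y = c * α.d q X Y := by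
          simp only [OneForm.d]
          rw [this, fderiv_const_smul (α.differentiableAt_inChart q)]
          exact (mul_sub _ _ _).symm
      _ = 0 := by rw [hα, mul_zero]

variable (E N) in
/-- The exact 1-forms `df`, for `f` a smooth function. -/
def exactForms : Submodule ℝ (OneForm E N) where
  carrier := {α | ∃ f : N → ℝ, ContMDiff 𝓘(ℝ, E) 𝓘(ℝ, ℝ) ∞ f ∧
    ∀ q (X : TangentSpace 𝓘(ℝ, E) q), α q X = mvfderiv 𝓘(ℝ, E) f q X}
  zero_mem' := ⟨fun _ => 0, contMDiff_const, fun q X => by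
    rw [mvfderiv_const]; rfl⟩
  add_mem' := by
    rintro α β ⟨f, hf, hα⟩ ⟨g, hg, hβ⟩
    refine ⟨f + g, hf.add hg, fun q X => ?_⟩
    rw [mvfderiv_add ((hf q).mdifferentiableAt (by simp)) ((hg q).mdifferentiableAt (by simp)),
      add_apply, ← hα, ← hβ]
    rfl
  smul_mem' := by
    rintro c α ⟨f, hf, hα⟩
    refine ⟨c • f, (contMDiff_const (c := c) :
      ContMDiff 𝓘(ℝ, E) 𝓘(ℝ, ℝ) ∞ fun _ : N => c).smul hf, fun q X => ?_⟩
    have h := ((hf q).mdifferentiableAt (by simp)).hasMFDerivAt.const_smul c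
    have h' : mvfderiv 𝓘(ℝ, E) (c • f) q = c • mvfderiv 𝓘(ℝ, E) f q := h.mfderiv
    rw [h', smul_apply, ← hα]
    rfl

variable (E N) in
/-- The first de Rham cohomology `H¹(N)`: closed forms modulo exact forms. -/
abbrev DeRhamH1 [FiniteDimensional ℝ E] : Type _ :=
  closedForms E N ⧸ (exactForms E N).submoduleOf (closedForms E N)

/-- The cohomology class of a closed form. -/
def OneForm.cohomClass [FiniteDimensional ℝ E] (α : OneForm E N) (hα : α ∈ closedForms E N) :
    DeRhamH1 E N :=
  Submodule.Quotient.mk ⟨α, hα⟩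

end Forms

/-! ### Connections in a rank two bundle -/

section Connection

variable {EM : Type*} [NormedAddCommGroup EM] [NormedSpace ℝ EM]
  {M : Type*} [TopologicalSpace M] [ChartedSpace EM M]
  {V : M → Type*} [TopologicalSpace (TotalSpace Plane V)]
  [∀ x, NormedAddCommGroup (V x)] [∀ x, InnerProductSpace ℝ (V x)]
  [FiberBundle Plane V] [VectorBundle ℝ Plane V]

/-- The orientations `o x` of the fibres form an orientation of the bundle: near every point there
is a smooth positively oriented frame. -/
def IsBundleOrientation (EM : Type*) [NormedAddCommGroup EM] [NormedSpace ℝ EM]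
    [ChartedSpace EM M] (o : ∀ x, Orientation ℝ (V x) (Fin 2)) : Prop :=
  ∀ x₀ : M, ∃ U ∈ 𝓝 x₀, ∃ b : ∀ x, Basis (Fin 2) ℝ (V x),
    (∀ i, ContMDiffOn 𝓘(ℝ, EM) (𝓘(ℝ, EM).prod 𝓘(ℝ, Plane)) ∞
      (fun x => (⟨x, b x i⟩ : TotalSpace Plane V)) U) ∧
    ∀ x ∈ U, (b x).orientation = o x

/-- The volume form `θ` of the metric and the orientation. -/
def areaForm (o : ∀ x, Orientation ℝ (V x) (Fin 2)) (x : M) (v w : V x) : ℝ :=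
  haveI : Fact (finrank ℝ (V x) = 2) := ⟨finrank_fiber V x⟩
  (o x).areaForm v w

/-- The connection form `ω_v : T_v V → V_{π v}`, with the vertical space at `v` identified with the
fibre. In a local trivialization, with `s` the section through `v` that is constant in it, it is
`ω_v(X) = X^{vert} + ∇_{dπ X} s`, where `X^{vert}` is the fibre component of `X`. The two theorems
below characterize it: it is the identity on vertical vectors, and `ω (dσ u) = ∇_u σ` for every
section `σ`, so that its kernel consists of the velocities of parallel sections. -/
def connectionForm (cov : CovariantDerivative 𝓘(ℝ, EM) Plane V) (v : TotalSpace Plane V) :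
    TangentSpace (𝓘(ℝ, EM).prod 𝓘(ℝ, Plane)) v →L[ℝ] V v.proj :=
  ((trivializationAt Plane V v.proj).symmL ℝ v.proj).comp
      (mvfderiv (𝓘(ℝ, EM).prod 𝓘(ℝ, Plane))
        (fun w : TotalSpace Plane V => (trivializationAt Plane V v.proj w).2) v) +
    (cov (FiberBundle.extend Plane v.2) v.proj).comp
      (mfderiv (𝓘(ℝ, EM).prod 𝓘(ℝ, Plane)) 𝓘(ℝ, EM) (π Plane V) v)

theorem mdifferentiableAt_trivialization [ContMDiffVectorBundle 1 Plane V 𝓘(ℝ, EM)]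
    (v : TotalSpace Plane V) :
    MDifferentiableAt (𝓘(ℝ, EM).prod 𝓘(ℝ, Plane)) 𝓘(ℝ, Plane)
      (fun w : TotalSpace Plane V => (trivializationAt Plane V v.proj w).2) v := by
  have hv : v ∈ (trivializationAt Plane V v.proj).source :=
    (trivializationAt Plane V v.proj).mem_source.2
      (FiberBundle.mem_baseSet_trivializationAt' v.proj)
  have h := ((trivializationAt Plane V v.proj).contMDiffOn (n := 1) (IB := 𝓘(ℝ, EM))).contMDiffAt
    ((trivializationAt Plane V v.proj).open_source.mem_nhds hv)
  exact ((contMDiff_snd (n := 1)).contMDiffAt.comp v h).mdifferentiableAt (by simp)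

/-- The connection form is the identity on vertical vectors. -/
theorem connectionForm_vertical [ContMDiffVectorBundle 1 Plane V 𝓘(ℝ, EM)]
    (cov : CovariantDerivative 𝓘(ℝ, EM) Plane V) {x : M} (v w : V x) :
    connectionForm cov ⟨x, v⟩
      (mfderiv 𝓘(ℝ, V x) (𝓘(ℝ, EM).prod 𝓘(ℝ, Plane))
        (fun u : V x => (⟨x, u⟩ : TotalSpace Plane V)) v w) = w := by
  set e := trivializationAt Plane V x with he
  have hx : x ∈ e.baseSet := FiberBundle.mem_baseSet_trivializationAt' x
  have hlin : HasFDerivAt (fun u : V x => (e ⟨x, u⟩).2) (e.continuousLinearMapAt ℝ x) v := by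
    refine (e.continuousLinearMapAt ℝ x).hasFDerivAt.congr_of_eventuallyEq (.of_forall fun u => ?_)
    simp [e.coe_linearMapAt_of_mem hx]
  have hm : MDifferentiableAt 𝓘(ℝ, V x) (𝓘(ℝ, EM).prod 𝓘(ℝ, Plane))
      (fun u : V x => (⟨x, u⟩ : TotalSpace Plane V)) v := by
    rw [mdifferentiableAt_totalSpace]
    exact ⟨mdifferentiableAt_const, hlin.differentiableAt.mdifferentiableAt⟩
  have h1 := (mdifferentiableAt_trivialization (EM := EM) (⟨x, v⟩ : TotalSpace Plane V)).hasMFDerivAt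
  have c1 := h1.comp v hm.hasMFDerivAt
  have c2 := (mdifferentiableAt_proj (IB := 𝓘(ℝ, EM)) V
    (p := (⟨x, v⟩ : TotalSpace Plane V))).hasMFDerivAt.comp v hm.hasMFDerivAt
  have e1 := hasMFDerivAt_unique c1 hlin.hasMFDerivAt
  have e2 := hasMFDerivAt_unique c2 (hasMFDerivAt_const x v)
  have f1 : mvfderiv (𝓘(ℝ, EM).prod 𝓘(ℝ, Plane)) (fun w : TotalSpace Plane V => (e w).2) ⟨x, v⟩
      (mfderiv 𝓘(ℝ, V x) (𝓘(ℝ, EM).prod 𝓘(ℝ, Plane))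
        (fun u : V x => (⟨x, u⟩ : TotalSpace Plane V)) v w) = e.continuousLinearMapAt ℝ x w :=
    congrArg (fun A : V x →L[ℝ] Plane => A w) e1
  have f2 : mfderiv (𝓘(ℝ, EM).prod 𝓘(ℝ, Plane)) 𝓘(ℝ, EM) (π Plane V) ⟨x, v⟩
      (mfderiv 𝓘(ℝ, V x) (𝓘(ℝ, EM).prod 𝓘(ℝ, Plane))
        (fun u : V x => (⟨x, u⟩ : TotalSpace Plane V)) v w) = 0 :=
    congrArg (fun A : V x →L[ℝ] EM => A w) e2
  rw [connectionForm, add_apply, ContinuousLinearMap.comp_apply, ContinuousLinearMap.comp_apply,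
    f1, f2, map_zero, add_zero]
  exact Trivialization.symmL_continuousLinearMapAt (R := ℝ) e hx w

/-- On the velocity of a section, the connection form is the covariant derivative. -/
theorem connectionForm_section [ContMDiffVectorBundle 1 Plane V 𝓘(ℝ, EM)]
    (cov : CovariantDerivative 𝓘(ℝ, EM) Plane V) {σ : ∀ x, V x} {x : M}
    (hσ : MDifferentiableAt 𝓘(ℝ, EM) (𝓘(ℝ, EM).prod 𝓘(ℝ, Plane))
      (fun y => (⟨y, σ y⟩ : TotalSpace Plane V)) x) (u : TangentSpace 𝓘(ℝ, EM) x) :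
    connectionForm cov ⟨x, σ x⟩
      (mfderiv 𝓘(ℝ, EM) (𝓘(ℝ, EM).prod 𝓘(ℝ, Plane))
        (fun y => (⟨y, σ y⟩ : TotalSpace Plane V)) x u) = cov σ x u := by
  set e := trivializationAt Plane V x with he
  have hx : x ∈ e.baseSet := FiberBundle.mem_baseSet_trivializationAt' x
  have hU : ∀ᶠ y in 𝓝 x, y ∈ e.baseSet := e.open_baseSet.mem_nhds hx
  have hsnd {τ : ∀ x, V x} (hτ : MDifferentiableAt 𝓘(ℝ, EM) (𝓘(ℝ, EM).prod 𝓘(ℝ, Plane))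
      (fun y => (⟨y, τ y⟩ : TotalSpace Plane V)) x) :
      MDifferentiableAt 𝓘(ℝ, EM) 𝓘(ℝ, Plane) (fun y => (e ⟨y, τ y⟩).2) x :=
    (mdifferentiableAt_section (IB := 𝓘(ℝ, EM)) τ).1 hτ
  -- the difference with the flat connection of the trivialization is tensorial
  let Φ : (∀ x, V x) → V x := fun τ => cov τ x u -
    e.symmL ℝ x (mvfderiv 𝓘(ℝ, EM) (fun y => (e ⟨y, τ y⟩).2) x u)
  have hΦ : TensorialAt 𝓘(ℝ, EM) Plane Φ x := by
    constructor
    · intro f τ hf hτ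
      have h1 := cov.isCovariantDerivativeOnUniv.leibniz hτ hf
      have h2 : (fun y => (e ⟨y, (f • τ) y⟩).2) =ᶠ[𝓝 x] f • fun y => (e ⟨y, τ y⟩).2 := by
        filter_upwards [hU] with y hy
        exact (e.linear ℝ hy).map_smul (f y) (τ y)
      have h3 : mvfderiv 𝓘(ℝ, EM) (fun y => (e ⟨y, (f • τ) y⟩).2) x =
          mvfderiv 𝓘(ℝ, EM) (f • fun y => (e ⟨y, τ y⟩).2) x := by
        simp only [mvfderiv]; exact congrArg _ h2.mfderiv_eq
      have h4 : e.symmL ℝ x (e ⟨x, τ x⟩).2 = τ x := by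
        have := Trivialization.symmL_continuousLinearMapAt (R := ℝ) e hx (τ x)
        rwa [Trivialization.continuousLinearMapAt_apply (R := ℝ), e.coe_linearMapAt_of_mem hx] at this
      simp only [Φ]
      rw [h1, h3, mvfderiv_smul hf (hsnd hτ)]
      simp only [add_apply, smul_apply, ContinuousLinearMap.smulRight_apply, map_add, map_smul, h4]
      module
    · intro τ τ' hτ hτ'
      have h1 := cov.isCovariantDerivativeOnUniv.add hτ hτ'
      have h2 : (fun y => (e ⟨y, (τ + τ') y⟩).2) =ᶠ[𝓝 x]
          (fun y => (e ⟨y, τ y⟩).2) + fun y => (e ⟨y, τ' y⟩).2 := by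
        filter_upwards [hU] with y hy
        exact (e.linear ℝ hy).map_add (τ y) (τ' y)
      have h3 : mvfderiv 𝓘(ℝ, EM) (fun y => (e ⟨y, (τ + τ') y⟩).2) x =
          mvfderiv 𝓘(ℝ, EM) ((fun y => (e ⟨y, τ y⟩).2) + fun y => (e ⟨y, τ' y⟩).2) x := by
        simp only [mvfderiv]; exact congrArg _ h2.mfderiv_eq
      simp only [Φ]
      rw [h1, h3, mvfderiv_add (hsnd hτ) (hsnd hτ')]
      simp only [add_apply, map_add]
      module
  have hext := hΦ.pointwise hσ (FiberBundle.mdifferentiableAt_extend 𝓘(ℝ, EM) Plane (σ x)) (by simp)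
  have hconst : mvfderiv 𝓘(ℝ, EM)
      (fun y => (e ⟨y, FiberBundle.extend Plane (σ x) y⟩).2) x = 0 := by
    have h2 : (fun y => (e ⟨y, FiberBundle.extend Plane (σ x) y⟩).2) =ᶠ[𝓝 x]
        fun _ => (e ⟨x, σ x⟩).2 := by
      filter_upwards [hU] with y hy
      have h := e.apply_mk_symm hy (e ⟨x, σ x⟩).2
      exact (congrArg Prod.snd h :)
    rw [← mvfderiv_const (I := 𝓘(ℝ, EM)) (M := M) (x := x) (e ⟨x, σ x⟩).2]
    simp only [mvfderiv]; exact congrArg _ h2.mfderiv_eq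
  simp only [Φ, hconst, zero_apply, map_zero, sub_zero] at hext
  have h1 := (mdifferentiableAt_trivialization (EM := EM)
    (⟨x, σ x⟩ : TotalSpace Plane V)).hasMFDerivAt
  have c1 := h1.comp x hσ.hasMFDerivAt
  have c2 := (mdifferentiableAt_proj (IB := 𝓘(ℝ, EM)) V
    (p := (⟨x, σ x⟩ : TotalSpace Plane V))).hasMFDerivAt.comp x hσ.hasMFDerivAt
  have e1 := hasMFDerivAt_unique c1 (hsnd hσ).hasMFDerivAt
  have e2 := hasMFDerivAt_unique c2 (hasMFDerivAt_id x)
  have f1 : mvfderiv (𝓘(ℝ, EM).prod 𝓘(ℝ, Plane)) (fun w : TotalSpace Plane V => (e w).2)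
      ⟨x, σ x⟩ (mfderiv 𝓘(ℝ, EM) (𝓘(ℝ, EM).prod 𝓘(ℝ, Plane))
        (fun y => (⟨y, σ y⟩ : TotalSpace Plane V)) x u) =
      mvfderiv 𝓘(ℝ, EM) (fun y => (e ⟨y, σ y⟩).2) x u :=
    congrArg (fun A : TangentSpace 𝓘(ℝ, EM) x →L[ℝ] Plane => A u) e1
  have f2 : mfderiv (𝓘(ℝ, EM).prod 𝓘(ℝ, Plane)) 𝓘(ℝ, EM) (π Plane V) ⟨x, σ x⟩
      (mfderiv 𝓘(ℝ, EM) (𝓘(ℝ, EM).prod 𝓘(ℝ, Plane))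
        (fun y => (⟨y, σ y⟩ : TotalSpace Plane V)) x u) = u :=
    congrArg (fun A : TangentSpace 𝓘(ℝ, EM) x →L[ℝ] EM => A u) e2
  rw [connectionForm, add_apply, ContinuousLinearMap.comp_apply, ContinuousLinearMap.comp_apply,
    f1, f2]
  rw [sub_eq_iff_eq_add] at hext
  rw [hext, add_comm]

/-- The horizontal distribution of the connection on `V`: the kernel of the connection form. -/
def IsHorizontal (cov : CovariantDerivative 𝓘(ℝ, EM) Plane V) (v : TotalSpace Plane V)
    (X : TangentSpace (𝓘(ℝ, EM).prod 𝓘(ℝ, Plane)) v) : Prop :=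
  connectionForm cov v X = 0

/-- The horizontal distribution of the induced connection on `P(V)`: the image of the horizontal
distribution on `V ∖ 0` under the differential of `j : V ∖ 0 → P(V)`. -/
def projHorizontal (cov : CovariantDerivative 𝓘(ℝ, EM) Plane V) :
    Set (TangentBundle 𝓘(ℝ, EM × ℝ) (ProjBundle V)) :=
  {Y | ∃ v : TotalSpace Plane V, v.2 ≠ 0 ∧ ∃ X, IsHorizontal cov v X ∧
    Y = ⟨toProj v, mfderiv (𝓘(ℝ, EM).prod 𝓘(ℝ, Plane)) 𝓘(ℝ, EM × ℝ) toProj v X⟩}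

/-- The form `α̂_v(X) = θ(v, ω(X)) / (2 g(v, v))` on `V ∖ 0`. -/
def alphaHat (cov : CovariantDerivative 𝓘(ℝ, EM) Plane V) (o : ∀ x, Orientation ℝ (V x) (Fin 2))
    (v : TotalSpace Plane V) (X : TangentSpace (𝓘(ℝ, EM).prod 𝓘(ℝ, Plane)) v) : ℝ :=
  1 / (2 * inner ℝ v.2 v.2) * areaForm o v.proj v.2 (connectionForm cov v X)

/-- The curvature `R(X, Y) σ = ∇_X ∇_Y σ - ∇_Y ∇_X σ - ∇_{[X, Y]} σ` on vector fields and
sections. -/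
def curvature (cov : CovariantDerivative 𝓘(ℝ, EM) Plane V)
    (X Y : ∀ x : M, TangentSpace 𝓘(ℝ, EM) x) (σ : ∀ x, V x) (x : M) : V x :=
  cov (fun y => cov σ y (Y y)) x (X x) - cov (fun y => cov σ y (X y)) x (Y x) -
    cov σ x (VectorField.mlieBracket 𝓘(ℝ, EM) X Y x)

variable [IsManifold 𝓘(ℝ, EM) ∞ M]

/-- The curvature tensor at a point, computed on extensions of the arguments. -/
def curvatureAt (cov : CovariantDerivative 𝓘(ℝ, EM) Plane V) (x : M)
    (X Y : TangentSpace 𝓘(ℝ, EM) x) (v : V x) : V x :=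
  curvature cov (FiberBundle.extend EM X) (FiberBundle.extend EM Y) (FiberBundle.extend Plane v) x

/-- The curvature form `Ω(X, Y) = g(R(X, Y) e₁, e₂)`, the component `R²₁` of the curvature in a
positively oriented orthonormal basis `(e₁, e₂)`. -/
def curvatureForm (cov : CovariantDerivative 𝓘(ℝ, EM) Plane V)
    (o : ∀ x, Orientation ℝ (V x) (Fin 2)) (x : M) (X Y : TangentSpace 𝓘(ℝ, EM) x) : ℝ :=
  let e := (o x).finOrthonormalBasis (by norm_num) (finrank_fiber V x)
  inner ℝ (curvatureAt cov x X Y (e 0)) (e 1)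

/-- The parametrization `ℝP¹ → P(V)` of the fibre over `x` by a linear isomorphism
`ψ : ℝ² → V x`. -/
def fiberParam {x : M} (ψ : Plane ≃ₗ[ℝ] V x) (L : RP1) : ProjBundle V :=
  ⟨x, Projectivization.map ψ.toLinearMap ψ.injective L⟩

end Connection

end

/-! Over an open set of M carrying a positively oriented orthonormal frame E₀, E₁, write v = aE₀ +
bE₁, z = b/a and A_kl = ⟨E_k, ∇E_l⟩. The components of ω are da + aA₀₀ + bA₀₁ and db + aA₁₀ + bA₁₁
(`fiberCoord_connectionForm`). Dividing the numerator and denominator of α̂ by a² turns it into (dz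
+ A₁₀ + zA₁₁ − zA₀₀ − z²A₀₁) / (2(1 + z²)), which involves only the affine coordinate z of P(E) and
forms on M. This is `inducedForm`; it pulls back to α̂ by `inducedForm_mfderiv_toProj`. Since dj is
surjective (`mfderiv_toProj_surjective`), a covector on P(E) is determined by its pull-back, so the
expressions from different frames agree (`eq_inducedForm`) and glue to a smooth form α. Every line
is covered, because the frame may be replaced by (E₁, −E₀). That α vanishes on H is immediate, as ω
vanishes on Ĥ.

On vertical vectors ω is the identity, so ∇ drops out on a fibre. In linear coordinates y the
restriction is k(y₀dy₁ − y₁dy₀)/(2N(y)), where N is the squared norm and k the area of the image of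
the unit square. The Cholesky factor of the Gram matrix gives N = |T|² with T(y) = ay₀ + by₁ + i dy₁
and ad = k, so the restriction is ½ d arg T, while ᾱ is ½ d arg(y₀ + iy₁). The product of T with the
conjugate of y₀ + iy₁ avoids the nonpositive real axis and is multiplied by c² when y is multiplied
by c. Its principal argument is therefore a smooth function on ℝP¹, and the two forms differ by an
exact one (`sub_mem_exactForms_of_triangular`). A form on ℝP¹ is exact exactly when its integral
over the angles from 0 to π vanishes (`OneForm.mem_exactForms_RP1_iff`); for ᾱ this integral is π/2,
so its class generates.

If ∇ is metric, the matrix A is skew and the local expression collapses to ½(d arctan z + π^*A₁₀),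
whence dα = ½π^*dA₁₀ (`d_eq_connectionCoeff_d`). Finally dA₁₀ = Ω, with no quadratic term because
infinitesimal rotations of the plane commute (`curvatureForm_eq_connectionCoeff_d`). -/

set_option linter.unusedSectionVars false

noncomputable section

/-! ### Fields of covectors in charts. -/

section Cotangent

variable {E : Type*} [NormedAddCommGroup E] [NormedSpace ℝ E]
  {N : Type*} [TopologicalSpace N] [ChartedSpace E N] [IsManifold 𝓘(ℝ, E) ∞ N]

theorem mdifferentiableAt_chartAt_symm (q : N) {y : E} (hy : y ∈ (chartAt E q).target) :
    MDifferentiableAt 𝓘(ℝ, E) 𝓘(ℝ, E) (chartAt E q).symm y :=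
  ((contMDiffOn_chart_symm (I := 𝓘(ℝ, E)) (n := ∞) (x := q)).contMDiffAt
    ((chartAt E q).open_target.mem_nhds hy)).mdifferentiableAt (by simp)

theorem mdifferentiableAt_chartAt (q : N) {p : N} (hp : p ∈ (chartAt E q).source) :
    MDifferentiableAt 𝓘(ℝ, E) 𝓘(ℝ, E) (chartAt E q) p :=
  ((contMDiffOn_chart (I := 𝓘(ℝ, E)) (n := ∞) (x := q)).contMDiffAt
    ((chartAt E q).open_source.mem_nhds hp)).mdifferentiableAt (by simp)

/-- The differential of the inverse of the preferred chart at its base point is the identity. -/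
theorem mfderiv_chartAt_symm_self (q : N) :
    mfderiv 𝓘(ℝ, E) 𝓘(ℝ, E) (chartAt E q).symm (chartAt E q q) = ContinuousLinearMap.id ℝ E := by
  have : IsManifold 𝓘(ℝ, E) 1 N := IsManifold.of_le (n := ∞) (by simp)
  have h := mfderivWithin_range_extChartAt_symm (I := 𝓘(ℝ, E)) (x := q)
  simp only [mfld_simps] at h
  exact h

theorem mfderiv_chartAt_self (q : N) :
    mfderiv 𝓘(ℝ, E) 𝓘(ℝ, E) (chartAt E q) q = ContinuousLinearMap.id ℝ E := by
  have : IsManifold 𝓘(ℝ, E) 1 N := IsManifold.of_le (n := ∞) (by simp)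
  have h := mfderiv_extChartAt_self (I := 𝓘(ℝ, E)) (x := q)
  simp only [mfld_simps] at h
  exact h

/-- The coordinate expression of a field of covectors in the preferred chart at `q`. -/
def covectorInChart (L : ∀ q : N, TangentSpace 𝓘(ℝ, E) q →L[ℝ] ℝ) (q : N) (y : E) : E →L[ℝ] ℝ :=
  (L ((chartAt E q).symm y) : E →L[ℝ] ℝ).comp
    (mfderiv 𝓘(ℝ, E) 𝓘(ℝ, E) (chartAt E q).symm y : E →L[ℝ] E)

/-- A field of covectors is smooth at a point if its coordinate expression there is. -/
theorem contMDiffAt_covector_of_inChart (L : ∀ q : N, TangentSpace 𝓘(ℝ, E) q →L[ℝ] ℝ) (q : N)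
    (h : ContDiffAt ℝ ∞ (covectorInChart L q) (chartAt E q q)) :
    ContMDiffAt 𝓘(ℝ, E) (𝓘(ℝ, E).prod 𝓘(ℝ, E →L[ℝ] ℝ)) ∞
      (fun p : N => TotalSpace.mk' (E →L[ℝ] ℝ)
        (E := fun q : N => TangentSpace 𝓘(ℝ, E) q →L[ℝ] Bundle.Trivial N ℝ q) p (L p)) q := by
  have : IsManifold 𝓘(ℝ, E) 1 N := IsManifold.of_le (n := ∞) (by simp)
  rw [contMDiffAt_hom_bundle]
  refine ⟨contMDiffAt_id, ?_⟩
  have h1 : ContMDiffAt 𝓘(ℝ, E) 𝓘(ℝ, E →L[ℝ] ℝ) ∞ (fun p => covectorInChart L q (chartAt E q p)) q :=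
    h.contMDiffAt.comp q ((contMDiffOn_chart (I := 𝓘(ℝ, E)) (n := ∞) (x := q)).contMDiffAt
      ((chartAt E q).open_source.mem_nhds (mem_chart_source E q)))
  -- Near `q` the trivialization of the cotangent bundle is composition with the differential of the
  -- inverse chart, so the local representative is `covectorInChart`.
  refine h1.congr_of_eventuallyEq ?_
  filter_upwards [(chartAt E q).open_source.mem_nhds (mem_chart_source E q)] with p hp
  have h2 := TangentBundle.symmL_trivializationAt (I := 𝓘(ℝ, E)) (x₀ := q) (x := p) hp
  rw [ContinuousLinearMap.inCoordinates, h2]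
  simp only [mfld_simps, covectorInChart]
  have h3 : ∀ p', p' = p → (L p : E →L[ℝ] ℝ) = L p' := by rintro _ rfl; rfl
  have h4 := h3 _ ((chartAt E q).left_inv hp)
  ext w
  simp only [Bundle.Trivial.fiberBundle_trivializationAt',
    Bundle.Trivial.continuousLinearMapAt_trivialization, ContinuousLinearMap.id_comp]
  exact congrArg (fun A : E →L[ℝ] ℝ =>
    A ((mfderiv 𝓘(ℝ, E) 𝓘(ℝ, E) (chartAt E q).symm (chartAt E q p) : E →L[ℝ] E) w)) h4

/-- The 1-form with a given field of covectors whose coordinate expressions are smooth. -/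
def OneForm.ofInChart (L : ∀ q : N, TangentSpace 𝓘(ℝ, E) q →L[ℝ] ℝ)
    (h : ∀ q, ContDiffAt ℝ ∞ (covectorInChart L q) (chartAt E q q)) : OneForm E N :=
  ⟨fun q => L q, fun q => contMDiffAt_covector_of_inChart L q (h q)⟩

end Cotangent

/-! ### Descent of 1-forms from the punctured plane to the projective line. -/

section RP1

theorem RP1.exists_chartAt_eq (L : RP1) : ∃ i, chartAt ℝ L = RP1.chart i := ⟨_, rfl⟩

theorem RP1.chart_lineOf (i : Fin 2) {y : Plane} (hy : y ≠ 0) :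
    RP1.chart i (lineOf y) = y (1 - i) / y i :=
  lineCoord_lineOf LinearMap.id i hy

theorem RP1.lineOf_mem_chart_source (i : Fin 2) {y : Plane} (hy : y ≠ 0) :
    lineOf y ∈ (RP1.chart i).source ↔ y i ≠ 0 :=
  lineOf_mem_lineDomain LinearMap.id i hy

theorem RP1.chartAt_coord_ne {y : Plane} (hy : y ≠ 0) {i : Fin 2}
    (hi : chartAt ℝ (lineOf y : RP1) = RP1.chart i) : y i ≠ 0 := by
  rw [← RP1.lineOf_mem_chart_source i hy, ← hi]
  exact mem_chart_source ℝ _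

theorem contMDiffAt_lineOf_RP1 {y : Plane} (hy : y ≠ 0) :
    ContMDiffAt 𝓘(ℝ, Plane) 𝓘(ℝ, ℝ) ∞ (lineOf : Plane → RP1) y := by
  rw [contMDiffAt_iff_target]
  obtain ⟨i, hi⟩ := RP1.exists_chartAt_eq (lineOf y)
  have hyi := RP1.chartAt_coord_ne hy hi
  have hne : {y : Plane | y ≠ 0} ∈ 𝓝 y := isOpen_ne.mem_nhds hy
  refine ⟨continuousOn_lineOf_RP1.continuousAt hne, ?_⟩
  have h : ContDiffAt ℝ ∞ (fun y : Plane => y (1 - i) / y i) y := by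
    refine ContDiffAt.div ?_ ?_ hyi <;> fun_prop
  refine h.contMDiffAt.congr_of_eventuallyEq ?_
  filter_upwards [hne] with z hz
  simp only [mfld_simps, hi]
  exact RP1.chart_lineOf i hz

theorem mdifferentiableAt_lineOf_RP1 {y : Plane} (hy : y ≠ 0) :
    MDifferentiableAt 𝓘(ℝ, Plane) 𝓘(ℝ, ℝ) (lineOf : Plane → RP1) y :=
  (contMDiffAt_lineOf_RP1 hy).mdifferentiableAt (by simp)

/-- The differential of `y ↦ [y]` in the preferred chart. -/
theorem mfderiv_lineOf_RP1 {y : Plane} (hy : y ≠ 0) {i : Fin 2}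
    (hi : chartAt ℝ (lineOf y : RP1) = RP1.chart i) (w : Plane) :
    (mfderiv 𝓘(ℝ, Plane) 𝓘(ℝ, ℝ) (lineOf : Plane → RP1) y : Plane →L[ℝ] ℝ) w =
      (w (1 - i) * y i - y (1 - i) * w i) / y i ^ 2 := by
  have hyi := RP1.chartAt_coord_ne hy hi
  have h1 := (mdifferentiableAt_chartAt (lineOf y : RP1) (mem_chart_source ℝ _)).hasMFDerivAt.comp y
    (mdifferentiableAt_lineOf_RP1 hy).hasMFDerivAt
  rw [mfderiv_chartAt_self] at h1
  have hp (k : Fin 2) : HasFDerivAt (fun z : Plane => z k) (EuclideanSpace.proj k : Plane →L[ℝ] ℝ) y :=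
    (EuclideanSpace.proj k : Plane →L[ℝ] ℝ).hasFDerivAt
  have h2 := (hp (1 - i)).mul ((hasDerivAt_inv hyi).comp_hasFDerivAt y (hp i))
  have h3 := h2.hasMFDerivAt.congr_of_eventuallyEq
    (f₁ := (chartAt ℝ (lineOf y : RP1)) ∘ (lineOf : Plane → RP1)) (by
      filter_upwards [isOpen_ne.mem_nhds hy] with z hz
      rw [hi]
      exact (RP1.chart_lineOf i hz).trans (div_eq_mul_inv _ _))
  have h4 := congrArg (fun A : Plane →L[ℝ] ℝ => A w) (hasMFDerivAt_unique h1 h3)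
  refine Eq.trans ?_ (h4.trans ?_)
  · rfl
  · simp
    field_simp
    ring

/-- The inverse chart is `affinePoint i` followed by `lineOf`, so this is the chain rule. It moves
computations in a chart up to the punctured plane. -/
theorem mfderiv_lineOf_affinePoint (L : RP1) (i : Fin 2) (hi : chartAt ℝ L = RP1.chart i)
    (t r : ℝ) :
    (mfderiv 𝓘(ℝ, ℝ) 𝓘(ℝ, ℝ) (chartAt ℝ L).symm t : ℝ →L[ℝ] ℝ) r =
      (mfderiv 𝓘(ℝ, Plane) 𝓘(ℝ, ℝ) (lineOf : Plane → RP1) (affinePoint i t) : Plane →L[ℝ] ℝ)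
        (r • EuclideanSpace.single (1 - i) 1) := by
  have h1 : HasFDerivAt (affinePoint i)
      ((ContinuousLinearMap.id ℝ ℝ).smulRight (EuclideanSpace.single (1 - i) 1 : Plane)) t := by
    unfold affinePoint
    exact ((hasFDerivAt_id t).smul_const _).const_add _
  have h2 := (mdifferentiableAt_lineOf_RP1 (affinePoint_ne_zero i t)).hasMFDerivAt.comp t
    h1.hasMFDerivAt
  have h3 : ((chartAt ℝ L).symm : ℝ → RP1) = lineOf ∘ affinePoint i := by rw [hi]; rfl
  rw [h3, h2.mfderiv]
  rfl

/-- Every tangent vector of `ℝP¹` comes from a tangent vector of `ℝ² ∖ 0`. -/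
theorem exists_mfderiv_lineOf_eq {y : Plane} (hy : y ≠ 0) (Y : ℝ) :
    ∃ w : Plane, (mfderiv 𝓘(ℝ, Plane) 𝓘(ℝ, ℝ) (lineOf : Plane → RP1) y : Plane →L[ℝ] ℝ) w = Y := by
  obtain ⟨i, hi⟩ := RP1.exists_chartAt_eq (lineOf y)
  have hyi := RP1.chartAt_coord_ne hy hi
  refine ⟨(Y * y i) • EuclideanSpace.single (1 - i) 1, ?_⟩
  rw [mfderiv_lineOf_RP1 hy hi]
  fin_cases i <;> simp at * <;> field_simp

theorem covectorInChart_RP1 (β : ∀ L : RP1, TangentSpace 𝓘(ℝ, ℝ) L →L[ℝ] ℝ) (L : RP1) {i : Fin 2}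
    (hi : chartAt ℝ L = RP1.chart i) (t r : ℝ) :
    covectorInChart β L t r = β (lineOf (affinePoint i t))
      (mfderiv 𝓘(ℝ, Plane) 𝓘(ℝ, ℝ) (lineOf : Plane → RP1) (affinePoint i t)
        (r • EuclideanSpace.single (1 - i) 1)) := by
  have h : ∀ L' : RP1, L' = lineOf (affinePoint i t) → ∀ r : ℝ, (β L' : ℝ →L[ℝ] ℝ) r =
      (β (lineOf (affinePoint i t)) : ℝ →L[ℝ] ℝ) r := by rintro _ rfl r; rfl
  refine (h _ (by rw [hi]; rfl) _).trans ?_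
  exact congrArg (β (lineOf (affinePoint i t)) : ℝ →L[ℝ] ℝ) (mfderiv_lineOf_affinePoint L i hi t r)

/-- A 1-form on `ℝ² ∖ 0` which is invariant under scaling and vanishes on radial vectors descends to
`ℝP¹`. -/
theorem exists_oneForm_RP1 (η : Plane → Plane →L[ℝ] ℝ) (hη : ContDiffOn ℝ ∞ η {y | y ≠ 0})
    (hs : ∀ c : ℝ, c ≠ 0 → ∀ y : Plane, y ≠ 0 → ∀ w, η (c • y) (c • w) = η y w)
    (hr : ∀ y : Plane, y ≠ 0 → η y y = 0) :
    ∃ β : OneForm ℝ RP1, ∀ y : Plane, y ≠ 0 → ∀ w : Plane,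
      β (lineOf y) (mfderiv 𝓘(ℝ, Plane) 𝓘(ℝ, ℝ) lineOf y w) = η y w := by
  choose ι hι using RP1.exists_chartAt_eq
  -- The covector at `L` is `η` at the representative with `i`-th coordinate 1, evaluated on the
  -- direction in which the inverse chart moves.
  let β : ∀ L : RP1, TangentSpace 𝓘(ℝ, ℝ) L →L[ℝ] ℝ := fun L =>
    ((η (affinePoint (ι L) (chartAt ℝ L L))).comp
      ((ContinuousLinearMap.id ℝ ℝ).smulRight (EuclideanSpace.single (1 - ι L) 1 : Plane)) :
      ℝ →L[ℝ] ℝ)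
  have key : ∀ y : Plane, y ≠ 0 → ∀ w : Plane,
      β (lineOf y) (mfderiv 𝓘(ℝ, Plane) 𝓘(ℝ, ℝ) lineOf y w) = η y w := by
    intro y hy w
    set i := ι (lineOf y) with hi_def
    have hi : chartAt ℝ (lineOf y : RP1) = RP1.chart i := hι _
    have hyi := RP1.chartAt_coord_ne hy hi
    have h1 : β (lineOf y) (mfderiv 𝓘(ℝ, Plane) 𝓘(ℝ, ℝ) lineOf y w) =
        η (affinePoint i (chartAt ℝ (lineOf y : RP1) (lineOf y)))
          (((w (1 - i) * y i - y (1 - i) * w i) / y i ^ 2) •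
            (EuclideanSpace.single (1 - i) 1 : Plane)) :=
      congrArg (fun r : ℝ => η (affinePoint i (chartAt ℝ (lineOf y : RP1) (lineOf y)))
        (r • (EuclideanSpace.single (1 - i) 1 : Plane))) (mfderiv_lineOf_RP1 hy hi w)
    rw [h1, hi, RP1.chart_lineOf i hy, affinePoint_div hyi]
    -- Up to the factor `(y i)⁻¹`, the lift used by `β` is `w` with a radial vector removed to kill
    -- its `i`-th coordinate. Both changes are invisible to `η`, by `hs` and `hr`.
    have h2 : (((w (1 - i) * y i - y (1 - i) * w i) / y i ^ 2) •
        EuclideanSpace.single (1 - i) 1 : Plane) = (y i)⁻¹ • (w - (w i / y i) • y) := by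
      ext k
      have hk : k = i ∨ k = 1 - i := by
        clear * -
        generalize i = j
        revert k j
        decide
      have hne : i ≠ 1 - i := by
        clear * -
        generalize i = j
        revert j
        decide
      rcases hk with rfl | rfl
      · simp [hne]
        right
        field_simp
        ring
      · simp
        field_simp
    rw [h2, hs _ (inv_ne_zero hyi) _ hy, map_sub, map_smul, hr y hy]
    simp
  refine ⟨OneForm.ofInChart β fun L => ?_, key⟩
  obtain ⟨i, hi⟩ := RP1.exists_chartAt_eq L
  have h1 : covectorInChart β L = fun t => (η (affinePoint i t)).comp
      ((ContinuousLinearMap.id ℝ ℝ).smulRight (EuclideanSpace.single (1 - i) 1 : Plane)) := by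
    funext t
    ext
    exact (covectorInChart_RP1 β L hi t 1).trans (key _ (affinePoint_ne_zero i t) _)
  rw [h1]
  have h2 : ContDiff ℝ ∞ fun t => η (affinePoint i t) :=
    hη.comp_contDiff (contDiff_affinePoint i) fun t => affinePoint_ne_zero i t
  exact (h2.clm_comp contDiff_const).contDiffAt

/-- On a curve every 1-form is closed. -/
theorem mem_closedForms_of_line {N : Type*} [TopologicalSpace N] [ChartedSpace ℝ N]
    [IsManifold 𝓘(ℝ, ℝ) ∞ N] (β : OneForm ℝ N) : β ∈ closedForms ℝ N := by
  intro q (X : ℝ) (Y : ℝ)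
  -- A bilinear form on a line is symmetric.
  have key : ∀ D : ℝ →L[ℝ] ℝ →L[ℝ] ℝ, D X Y - D Y X = 0 := by
    intro D
    have h (a b : ℝ) : D a b = a * b * D 1 1 := by
      have h1 : D a = a • D 1 := by rw [← map_smul]; simp
      have h2 : D 1 b = b • D 1 1 := by rw [← map_smul]; simp
      rw [h1, smul_apply, h2]
      simp [mul_assoc]
    rw [h, h Y X]
    ring
  exact key _

end RP1

/-! ### The first cohomology of the projective line, by integration over the angle. -/

section RP1Cohomology

/-- The maps `t ↦ lineOf (affinePoint i t)` are the inverses of the charts of the atlas. -/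
theorem RP1.contMDiff_of_affinePoint {f : RP1 → ℝ}
    (h : ∀ i, ContDiff ℝ ∞ fun t => f (lineOf (affinePoint i t))) :
    ContMDiff 𝓘(ℝ, ℝ) 𝓘(ℝ, ℝ) ∞ f := by
  intro L
  obtain ⟨i, hi⟩ := RP1.exists_chartAt_eq L
  have h1 : ContMDiffAt 𝓘(ℝ, ℝ) 𝓘(ℝ, ℝ) ∞
      ((fun t => f (lineOf (affinePoint i t))) ∘ chartAt ℝ L) L :=
    ((h i).contMDiff _).comp L ((contMDiffOn_chart (I := 𝓘(ℝ, ℝ)) (n := ∞) (x := L)).contMDiffAt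
      ((chartAt ℝ L).open_source.mem_nhds (mem_chart_source ℝ L)))
  refine h1.congr_of_eventuallyEq ?_
  filter_upwards [(chartAt ℝ L).open_source.mem_nhds (mem_chart_source ℝ L)] with p hp
  have h2 := (chartAt ℝ L).left_inv hp
  rw [hi] at h2 ⊢
  exact congrArg f h2.symm

/-- The unit vector at angle `t`. -/
def unitVector (t : ℝ) : Plane := !₂[Real.cos t, Real.sin t]

theorem unitVector_ne_zero (t : ℝ) : unitVector t ≠ 0 := by
  intro h
  have h0 : Real.cos t = 0 := by simpa [unitVector] using congrArg (fun v : Plane => v 0) h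
  have h1 : Real.sin t = 0 := by simpa [unitVector] using congrArg (fun v : Plane => v 1) h
  have := Real.sin_sq_add_cos_sq t
  simp [h0, h1] at this

theorem contDiff_unitVector : ContDiff ℝ ∞ unitVector := by
  rw [contDiff_euclidean]
  intro i
  fin_cases i
  · simpa [unitVector] using Real.contDiff_cos
  · simpa [unitVector] using Real.contDiff_sin

theorem hasDerivAt_unitVector (t : ℝ) :
    HasDerivAt unitVector !₂[-Real.sin t, Real.cos t] t := by
  have h := ((Real.hasDerivAt_cos t).smul_const (EuclideanSpace.single 0 1 : Plane)).add
    ((Real.hasDerivAt_sin t).smul_const (EuclideanSpace.single 1 1 : Plane))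
  refine (h.congr_deriv ?_).congr_of_eventuallyEq (.of_forall fun s => ?_)
  · ext i
    fin_cases i <;> simp
  · ext i
    fin_cases i <;> simp [unitVector]

theorem unitVector_add_pi (t : ℝ) : unitVector (t + Real.pi) = (-1 : ℝ) • unitVector t := by
  ext i
  fin_cases i <;> simp [unitVector]

/-- The parametrization of `ℝP¹` by the angle. -/
def RP1.ofAngle (t : ℝ) : RP1 := lineOf (unitVector t)

theorem RP1.ofAngle_add_pi (t : ℝ) : RP1.ofAngle (t + Real.pi) = RP1.ofAngle t := by
  rw [RP1.ofAngle, unitVector_add_pi, lineOf_smul (by norm_num) (unitVector_ne_zero t), RP1.ofAngle]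

/-- The determinant of two proportional unit vectors, the sine of the difference of their angles, is
zero. -/
theorem RP1.ofAngle_eq {s t : ℝ} (h : RP1.ofAngle s = RP1.ofAngle t) :
    ∃ n : ℤ, s = t + n * Real.pi := by
  rw [RP1.ofAngle, RP1.ofAngle, lineOf_of_ne (unitVector_ne_zero s),
    lineOf_of_ne (unitVector_ne_zero t), Projectivization.mk_eq_mk_iff'] at h
  obtain ⟨c, hc⟩ := h
  have h0 : c * Real.cos t = Real.cos s := by
    simpa [unitVector] using congrArg (fun v : Plane => v 0) hc
  have h1 : c * Real.sin t = Real.sin s := by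
    simpa [unitVector] using congrArg (fun v : Plane => v 1) hc
  have h2 : Real.sin (s - t) = 0 := by
    rw [Real.sin_sub, ← h0, ← h1]
    ring
  obtain ⟨n, hn⟩ := Real.sin_eq_zero_iff.1 h2
  exact ⟨n, by linarith⟩

/-- The factor `cos (arctan s)` normalizes the vector (1, s), whose angle is `arctan s`. -/
theorem RP1.lineOf_affinePoint_zero (s : ℝ) :
    lineOf (affinePoint 0 s) = RP1.ofAngle (Real.arctan s) := by
  have hc : Real.cos (Real.arctan s) ≠ 0 := (Real.cos_arctan_pos s).ne'
  rw [RP1.ofAngle, ← lineOf_smul hc (affinePoint_ne_zero 0 s)]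
  congr 1
  ext k
  fin_cases k
  · simp [affinePoint, unitVector]
  · simp [affinePoint, unitVector]
    rw [mul_comm]
    conv_lhs => rw [← Real.tan_arctan s]
    rw [Real.arctan_tan (Real.neg_pi_div_two_lt_arctan s) (Real.arctan_lt_pi_div_two s)]
    exact Real.tan_mul_cos hc

/-- The vector (s, 1) is the mirror image of (1, s) in the diagonal, which replaces the angle by its
complement. -/
theorem RP1.lineOf_affinePoint_one (s : ℝ) :
    lineOf (affinePoint 1 s) = RP1.ofAngle (Real.pi / 2 - Real.arctan s) := by
  have hc : Real.cos (Real.arctan s) ≠ 0 := (Real.cos_arctan_pos s).ne'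
  rw [RP1.ofAngle, ← lineOf_smul hc (affinePoint_ne_zero 1 s)]
  congr 1
  ext k
  fin_cases k
  · simp [affinePoint, unitVector, Real.cos_pi_div_two_sub]
    rw [mul_comm]
    conv_lhs => rw [← Real.tan_arctan s]
    rw [Real.arctan_tan (Real.neg_pi_div_two_lt_arctan s) (Real.arctan_lt_pi_div_two s)]
    exact Real.tan_mul_cos hc
  · simp [affinePoint, unitVector, Real.sin_pi_div_two_sub]

theorem RP1.ofAngle_surjective : Function.Surjective RP1.ofAngle := by
  intro L
  obtain ⟨i, hi⟩ := RP1.exists_chartAt_eq L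
  have h := (chartAt ℝ L).left_inv (mem_chart_source ℝ L)
  rw [hi] at h
  rw [← h]
  change ∃ a, RP1.ofAngle a = lineOf (affinePoint i _)
  fin_cases i
  · exact ⟨_, (RP1.lineOf_affinePoint_zero _).symm⟩
  · exact ⟨_, (RP1.lineOf_affinePoint_one _).symm⟩

/-- A smooth `π`-periodic function of the angle is a smooth function on `ℝP¹`. -/
theorem RP1.exists_contMDiff_of_periodic {F : ℝ → ℝ} (hF : ContDiff ℝ ∞ F)
    (hp : Function.Periodic F Real.pi) :
    ∃ f : RP1 → ℝ, ContMDiff 𝓘(ℝ, ℝ) 𝓘(ℝ, ℝ) ∞ f ∧ ∀ t, f (RP1.ofAngle t) = F t := by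
  choose θ hθ using RP1.ofAngle_surjective
  have key : ∀ t, F (θ (RP1.ofAngle t)) = F t := by
    intro t
    obtain ⟨n, hn⟩ := RP1.ofAngle_eq (hθ (RP1.ofAngle t))
    rw [hn]
    exact hp.int_mul n t
  refine ⟨fun L => F (θ L), RP1.contMDiff_of_affinePoint fun i => ?_, key⟩
  fin_cases i
  · simp only [Fin.zero_eta, RP1.lineOf_affinePoint_zero, key]
    exact hF.comp Real.contDiff_arctan
  · simp only [Fin.mk_one, RP1.lineOf_affinePoint_one, key]
    exact hF.comp (contDiff_const.sub Real.contDiff_arctan)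

theorem RP1.contMDiff_ofAngle : ContMDiff 𝓘(ℝ, ℝ) 𝓘(ℝ, ℝ) ∞ RP1.ofAngle := fun t =>
  (contMDiffAt_lineOf_RP1 (unitVector_ne_zero t)).comp t contDiff_unitVector.contMDiff.contMDiffAt

theorem RP1.mfderiv_ofAngle (t r : ℝ) :
    (mfderiv 𝓘(ℝ, ℝ) 𝓘(ℝ, ℝ) RP1.ofAngle t : ℝ →L[ℝ] ℝ) r =
      (mfderiv 𝓘(ℝ, Plane) 𝓘(ℝ, ℝ) (lineOf : Plane → RP1) (unitVector t) : Plane →L[ℝ] ℝ)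
        (r • !₂[-Real.sin t, Real.cos t]) := by
  have h := (mdifferentiableAt_lineOf_RP1 (unitVector_ne_zero t)).hasMFDerivAt.comp t
    (hasDerivAt_unitVector t).hasFDerivAt.hasMFDerivAt
  have h' : mfderiv 𝓘(ℝ, ℝ) 𝓘(ℝ, ℝ) RP1.ofAngle t = _ := h.mfderiv
  rw [h']
  rfl

theorem ContinuousLinearMap.apply_eq_mul_apply_one (A : ℝ →L[ℝ] ℝ) (r : ℝ) :
    A r = r * A 1 := by
  rw [← smul_eq_mul, ← map_smul, smul_eq_mul, mul_one]

/-- The velocity of the unit circle is never radial: the numerator in the derivative of the slope is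
±(cos² + sin²). Hence a form on ℝP¹ is determined by its angle coefficient. -/
theorem RP1.exists_mfderiv_ofAngle_eq (t Y : ℝ) :
    ∃ r : ℝ, (mfderiv 𝓘(ℝ, ℝ) 𝓘(ℝ, ℝ) RP1.ofAngle t : ℝ →L[ℝ] ℝ) r = Y := by
  obtain ⟨i, hi⟩ := RP1.exists_chartAt_eq (lineOf (unitVector t))
  have hyi := RP1.chartAt_coord_ne (unitVector_ne_zero t) hi
  have hsc := Real.sin_sq_add_cos_sq t
  obtain ⟨A, hA⟩ : ∃ A : ℝ →L[ℝ] ℝ, A = mfderiv 𝓘(ℝ, ℝ) 𝓘(ℝ, ℝ) RP1.ofAngle t := ⟨_, rfl⟩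
  have h1 : A 1 = (((1 : ℝ) • !₂[-Real.sin t, Real.cos t] : Plane) (1 - i) * unitVector t i -
      unitVector t (1 - i) * ((1 : ℝ) • !₂[-Real.sin t, Real.cos t] : Plane) i) /
        unitVector t i ^ 2 := by
    rw [hA]
    exact (RP1.mfderiv_ofAngle t 1).trans (mfderiv_lineOf_RP1 (unitVector_ne_zero t) hi _)
  have h2 : A 1 ≠ 0 := by
    rw [h1]
    refine div_ne_zero ?_ (pow_ne_zero 2 hyi)
    fin_cases i
    · simp [unitVector]
      intro h
      nlinarith
    · simp [unitVector]
      intro h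
      nlinarith
  refine ⟨Y / A 1, ?_⟩
  have h3 : A (Y / A 1) = Y := by
    rw [A.apply_eq_mul_apply_one, div_mul_cancel₀ _ h2]
  exact (congrArg (fun B : ℝ →L[ℝ] ℝ => B (Y / A 1)) hA.symm).trans h3

/-- The coefficient of a 1-form on `ℝP¹` with respect to the angle. -/
def OneForm.angleCoeff (β : OneForm ℝ RP1) (t : ℝ) : ℝ :=
  β (RP1.ofAngle t) (mfderiv 𝓘(ℝ, ℝ) 𝓘(ℝ, ℝ) RP1.ofAngle t (1 : ℝ))

theorem OneForm.contDiff_angleCoeff (β : OneForm ℝ RP1) : ContDiff ℝ ∞ β.angleCoeff := by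
  have h1 : ContMDiff 𝓘(ℝ, ℝ) (𝓘(ℝ, ℝ).prod 𝓘(ℝ, ℝ)) ∞
      (fun t : ℝ => (⟨RP1.ofAngle t, mfderiv 𝓘(ℝ, ℝ) 𝓘(ℝ, ℝ) RP1.ofAngle t (1 : ℝ)⟩ :
        TangentBundle 𝓘(ℝ, ℝ) RP1)) := by
    have h := RP1.contMDiff_ofAngle.contMDiff_tangentMap (m := ∞) (by simp)
    have hw : ContMDiff 𝓘(ℝ, ℝ) 𝓘(ℝ, ℝ).tangent ∞
        (fun y : ℝ => (⟨y, (1 : ℝ)⟩ : TangentBundle 𝓘(ℝ, ℝ) ℝ)) :=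
      contMDiff_vectorSpace_iff_contDiff.2 contDiff_const
    exact (h.comp hw).congr fun t => rfl
  have h2 : ContMDiff 𝓘(ℝ, ℝ) (𝓘(ℝ, ℝ).prod 𝓘(ℝ, ℝ →L[ℝ] ℝ)) ∞
      (fun t : ℝ => TotalSpace.mk' (ℝ →L[ℝ] ℝ)
        (E := fun q : RP1 => TangentSpace 𝓘(ℝ, ℝ) q →L[ℝ] Bundle.Trivial RP1 ℝ q)
        (RP1.ofAngle t) (β (RP1.ofAngle t))) :=
    β.contMDiff.comp RP1.contMDiff_ofAngle
  have h3 := h2.clm_bundle_apply (F₂ := ℝ) h1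
  rw [← contMDiff_iff_contDiff]
  intro t
  exact (contMDiffAt_totalSpace.1 (h3 t)).2

/-- Translation by π does not change `RP1.ofAngle`, so its velocities at `t` and `t + π` agree. -/
theorem OneForm.periodic_angleCoeff (β : OneForm ℝ RP1) :
    Function.Periodic β.angleCoeff Real.pi := by
  intro t
  have h1 : HasMFDerivAt 𝓘(ℝ, ℝ) 𝓘(ℝ, ℝ) (fun s : ℝ => s + Real.pi) t (ContinuousLinearMap.id ℝ ℝ) :=
    ((hasFDerivAt_id t).add_const Real.pi).hasMFDerivAt
  have h2 := ((RP1.contMDiff_ofAngle (t + Real.pi)).mdifferentiableAt (by simp)).hasMFDerivAt.comp t h1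
  have h3 : RP1.ofAngle ∘ (fun s : ℝ => s + Real.pi) = RP1.ofAngle := funext RP1.ofAngle_add_pi
  rw [h3] at h2
  have h4 : (mfderiv 𝓘(ℝ, ℝ) 𝓘(ℝ, ℝ) RP1.ofAngle t : ℝ →L[ℝ] ℝ) =
      (mfderiv 𝓘(ℝ, ℝ) 𝓘(ℝ, ℝ) RP1.ofAngle (t + Real.pi) : ℝ →L[ℝ] ℝ) := h2.mfderiv
  have h5 : ∀ L L' : RP1, L = L' → ∀ r : ℝ, (β L : ℝ →L[ℝ] ℝ) r = (β L' : ℝ →L[ℝ] ℝ) r := by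
    rintro _ _ rfl r; rfl
  refine (h5 _ _ (RP1.ofAngle_add_pi t) _).trans ?_
  exact congrArg (fun A : ℝ →L[ℝ] ℝ => (β (RP1.ofAngle t) : ℝ →L[ℝ] ℝ) (A 1)) h4.symm

theorem OneForm.angleCoeff_of_exact {β : OneForm ℝ RP1} {f : RP1 → ℝ}
    (hf : ContMDiff 𝓘(ℝ, ℝ) 𝓘(ℝ, ℝ) ∞ f)
    (h : ∀ q (X : TangentSpace 𝓘(ℝ, ℝ) q), β q X = mvfderiv 𝓘(ℝ, ℝ) f q X) (t : ℝ) :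
    HasDerivAt (fun s => f (RP1.ofAngle s)) (β.angleCoeff t) t := by
  have h1 := ((hf (RP1.ofAngle t)).mdifferentiableAt (by simp)).hasMFDerivAt.comp t
    ((RP1.contMDiff_ofAngle t).mdifferentiableAt (by simp)).hasMFDerivAt
  have h2 : HasFDerivAt (fun s => f (RP1.ofAngle s)) (_ : ℝ →L[ℝ] ℝ) t :=
    hasMFDerivAt_iff_hasFDerivAt.1 h1
  refine h2.hasDerivAt.congr_deriv ?_
  rw [OneForm.angleCoeff, h]
  rfl

/-- On the line of angles there is always a primitive. It descends to ℝP¹ exactly when it is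
π-periodic, and its increment over a period is the integral. -/
theorem OneForm.mem_exactForms_RP1_iff (β : OneForm ℝ RP1) :
    β ∈ exactForms ℝ RP1 ↔ ∫ t in (0 : ℝ)..Real.pi, β.angleCoeff t = 0 := by
  have hc : Continuous β.angleCoeff := β.contDiff_angleCoeff.continuous
  constructor
  · rintro ⟨f, hf, h⟩
    rw [intervalIntegral.integral_eq_sub_of_hasDerivAt
      (fun t _ => OneForm.angleCoeff_of_exact hf h t) (hc.intervalIntegrable _ _),
      ← RP1.ofAngle_add_pi 0, zero_add, sub_self]
  · intro h0
    set F : ℝ → ℝ := fun t => ∫ s in (0 : ℝ)..t, β.angleCoeff s with hF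
    have hd : ∀ t, HasDerivAt F (β.angleCoeff t) t := fun t =>
      intervalIntegral.integral_hasDerivAt_right (hc.intervalIntegrable _ _)
        hc.aestronglyMeasurable.stronglyMeasurableAtFilter hc.continuousAt
    have hF1 : ContDiff ℝ ∞ F := by
      rw [contDiff_infty_iff_deriv]
      refine ⟨fun t => (hd t).differentiableAt, ?_⟩
      rw [show deriv F = β.angleCoeff from funext fun t => (hd t).deriv]
      exact β.contDiff_angleCoeff
    have hp : Function.Periodic F Real.pi := by
      intro t
      have h1 : F (t + Real.pi) = F t + ∫ s in t..(t + Real.pi), β.angleCoeff s :=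
        (intervalIntegral.integral_add_adjacent_intervals (hc.intervalIntegrable _ _)
          (hc.intervalIntegrable _ _)).symm
      rw [h1, β.periodic_angleCoeff.intervalIntegral_add_eq t 0, zero_add, h0, add_zero]
    obtain ⟨f, hf, hfF⟩ := RP1.exists_contMDiff_of_periodic hF1 hp
    refine ⟨f, hf, ?_⟩
    intro L
    obtain ⟨t, rfl⟩ := RP1.ofAngle_surjective L
    intro (Y : ℝ)
    -- Every tangent vector is a velocity of the angle curve, so it is enough to compare derivatives
    -- along that curve.
    obtain ⟨r, rfl⟩ := RP1.exists_mfderiv_ofAngle_eq t Y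
    have h1 := ((hf (RP1.ofAngle t)).mdifferentiableAt (by simp)).hasMFDerivAt.comp t
      ((RP1.contMDiff_ofAngle t).mdifferentiableAt (by simp)).hasMFDerivAt
    have h2 : HasFDerivAt (f ∘ RP1.ofAngle) (_ : ℝ →L[ℝ] ℝ) t := hasMFDerivAt_iff_hasFDerivAt.1 h1
    have h3 : HasDerivAt (f ∘ RP1.ofAngle) (β.angleCoeff t) t := by
      rw [show f ∘ RP1.ofAngle = F from funext hfF]
      exact hd t
    obtain ⟨A, hA⟩ : ∃ A : ℝ →L[ℝ] ℝ, A = mfderiv 𝓘(ℝ, ℝ) 𝓘(ℝ, ℝ) RP1.ofAngle t := ⟨_, rfl⟩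
    obtain ⟨B, hB⟩ : ∃ B : ℝ →L[ℝ] ℝ, B = β (RP1.ofAngle t) := ⟨_, rfl⟩
    obtain ⟨C, hC⟩ : ∃ C : ℝ →L[ℝ] ℝ, C = mvfderiv 𝓘(ℝ, ℝ) f (RP1.ofAngle t) := ⟨_, rfl⟩
    have h5 : C (A 1) = B (A 1) := by
      rw [hA, hB, hC]
      exact h2.hasDerivAt.unique h3
    have h6 : B (A r) = C (A r) := by
      rw [A.apply_eq_mul_apply_one r, ← smul_eq_mul, map_smul, map_smul, h5]
    rwa [hA, hB, hC] at h6

theorem OneForm.angleCoeff_sub_smul (β γ : OneForm ℝ RP1) (c t : ℝ) :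
    (β - c • γ).angleCoeff t = β.angleCoeff t - c * γ.angleCoeff t := rfl

theorem OneForm.cohomClass_eq_iff {β γ : OneForm ℝ RP1} (hβ : β ∈ closedForms ℝ RP1)
    (hγ : γ ∈ closedForms ℝ RP1) :
    β.cohomClass hβ = γ.cohomClass hγ ↔ β - γ ∈ exactForms ℝ RP1 := by
  rw [OneForm.cohomClass, OneForm.cohomClass, Submodule.Quotient.eq]
  exact Iff.rfl

/-- `H¹(ℝP¹)` is a line, and integration over `ℝP¹` detects its elements. -/
theorem OneForm.cohomClass_generates {β : OneForm ℝ RP1} (hβ : β ∈ closedForms ℝ RP1)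
    (h : ∫ t in (0 : ℝ)..Real.pi, β.angleCoeff t ≠ 0) :
    β.cohomClass hβ ≠ 0 ∧ Submodule.span ℝ {β.cohomClass hβ} = ⊤ := by
  constructor
  · intro h0
    apply h
    rw [← OneForm.mem_exactForms_RP1_iff]
    rw [OneForm.cohomClass, Submodule.Quotient.mk_eq_zero] at h0
    exact h0
  · rw [eq_top_iff]
    rintro x -
    obtain ⟨⟨γ, hγ⟩, rfl⟩ := Submodule.Quotient.mk_surjective _ x
    rw [Submodule.mem_span_singleton]
    -- The quotient of the periods: with this factor the integral of `γ - c • β` vanishes.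
    set c := (∫ t in (0 : ℝ)..Real.pi, γ.angleCoeff t) / ∫ t in (0 : ℝ)..Real.pi, β.angleCoeff t
      with hc
    refine ⟨c, ?_⟩
    have h1 : γ - c • β ∈ exactForms ℝ RP1 := by
      rw [OneForm.mem_exactForms_RP1_iff]
      simp only [OneForm.angleCoeff_sub_smul]
      rw [intervalIntegral.integral_sub (γ.contDiff_angleCoeff.continuous.intervalIntegrable _ _)
        ((β.contDiff_angleCoeff.continuous.intervalIntegrable _ _).const_mul c),
        intervalIntegral.integral_const_mul, hc, div_mul_cancel₀ _ h, sub_self]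
    refine Eq.symm ?_
    rw [OneForm.cohomClass, ← Submodule.Quotient.mk_smul, Submodule.Quotient.eq]
    exact h1

end RP1Cohomology

/-! ### Angular forms of Euclidean metrics on the plane and their common class. -/

section RP1AreaForms

/-- Numerator and denominator are both multiplied by c² when `y` and `w` are scaled by c, and the
numerator vanishes for `w = y`; these are the two conditions for descent. -/
theorem exists_oneForm_RP1_of_quadratic (k : ℝ) {N : Plane → ℝ} (hN : ContDiff ℝ ∞ N)
    (hN0 : ∀ y, y ≠ 0 → N y ≠ 0) (hNs : ∀ (c : ℝ) y, N (c • y) = c ^ 2 * N y) :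
    ∃ β : OneForm ℝ RP1, ∀ y : Plane, y ≠ 0 → ∀ w : Plane,
      β (lineOf y) (mfderiv 𝓘(ℝ, Plane) 𝓘(ℝ, ℝ) lineOf y w) =
        k / (2 * N y) * (y 0 * w 1 - y 1 * w 0) := by
  let pr (i : Fin 2) : Plane →L[ℝ] ℝ := EuclideanSpace.proj i
  have h1 : ContDiffOn ℝ ∞ (fun y => (k / (2 * N y)) • (y 0 • pr 1 - y 1 • pr 0)) {y | y ≠ 0} := by
    refine ContDiffOn.smul (ContDiffOn.div contDiffOn_const (contDiffOn_const.mul hN.contDiffOn) ?_)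
      (ContDiff.contDiffOn ?_)
    · exact fun y hy => mul_ne_zero two_ne_zero (hN0 y hy)
    · fun_prop
  obtain ⟨β, hβ⟩ := exists_oneForm_RP1 _ h1
    (fun c hc y hy w => by
      have := hN0 y hy
      simp [pr, hNs]
      field_simp)
    (fun y _ => by simp [pr, mul_comm])
  refine ⟨β, fun y hy w => (hβ y hy w).trans ?_⟩
  simp [pr]

/-- The coordinate `a y₀ + b y₁ + i d y₁`. -/
def triangularCoord (a b d : ℝ) (y : Plane) : ℂ := ⟨a * y 0 + b * y 1, d * y 1⟩

theorem triangularCoord_ne_zero {a b d : ℝ} (ha : 0 < a) (hd : 0 < d) {y : Plane} (hy : y ≠ 0) :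
    triangularCoord a b d y ≠ 0 := by
  intro h
  have h1 : d * y 1 = 0 := congrArg Complex.im h
  have h0 : a * y 0 + b * y 1 = 0 := congrArg Complex.re h
  have h1' : y 1 = 0 := by simpa [hd.ne'] using h1
  have h0' : y 0 = 0 := by simpa [h1', ha.ne'] using h0
  exact hy (by ext i; fin_cases i <;> simp [h0', h1'])

/-- The quotient of two positively oriented triangular coordinates is never a negative number. -/
theorem triangularCoord_mul_mem_slitPlane {a b d : ℝ} (ha : 0 < a) (hd : 0 < d) {y : Plane}
    (hy : y ≠ 0) :
    triangularCoord a b d y * triangularCoord 1 0 (-1) y ∈ Complex.slitPlane := by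
  rw [Complex.mem_slitPlane_iff]
  by_contra! h
  obtain ⟨h1, h2⟩ := h
  simp [triangularCoord] at h1 h2
  by_cases hy1 : y 1 = 0
  · have hy0 : y 0 ≠ 0 := fun h0 => hy (by ext i; fin_cases i <;> simp [h0, hy1])
    have : 0 < a * (y 0 * y 0) := mul_pos ha (mul_self_pos.2 hy0)
    simp [hy1] at h1
    linarith
  -- The imaginary part is `y 1` times the difference of these two sides. Where it vanishes with `y
  -- 1 ≠ 0`, the real part becomes d(y₀² + y₁²) > 0.
  · have h3 : b * y 1 = (d - a) * y 0 := by
      have : y 1 * (b * y 1 - (d - a) * y 0) = 0 := by linarith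
      rcases mul_eq_zero.1 this with h | h
      · exact absurd h hy1
      · linarith
    rw [h3] at h1
    have h4 : 0 < d * (y 1 * y 1) := mul_pos hd (mul_self_pos.2 hy1)
    have h5 : 0 ≤ d * (y 0 * y 0) := mul_nonneg hd.le (mul_self_nonneg _)
    nlinarith

/-- The form `ad (y₀ dy₁ - y₁ dy₀) / (2 N)` with `N = (a y₀ + b y₁)² + (d y₁)²` does not depend on
`a`, `b`, `d` up to exact forms. -/
theorem sub_mem_exactForms_of_triangular {β γ : OneForm ℝ RP1} {a b d : ℝ} (ha : 0 < a)
    (hd : 0 < d)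
    (hβ : ∀ y : Plane, y ≠ 0 → ∀ w : Plane,
      β (lineOf y) (mfderiv 𝓘(ℝ, Plane) 𝓘(ℝ, ℝ) lineOf y w) =
        a * d / (2 * ((a * y 0 + b * y 1) ^ 2 + (d * y 1) ^ 2)) * (y 0 * w 1 - y 1 * w 0))
    (hγ : ∀ y : Plane, y ≠ 0 → ∀ w : Plane,
      γ (lineOf y) (mfderiv 𝓘(ℝ, Plane) 𝓘(ℝ, ℝ) lineOf y w) =
        1 / (2 * (y 0 ^ 2 + y 1 ^ 2)) * (y 0 * w 1 - y 1 * w 0)) :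
    β - γ ∈ exactForms ℝ RP1 := by
  -- The second factor is the complex conjugate of y₀ + iy₁, so the argument of `P y` measures the
  -- difference of the two angles.
  let P : Plane → ℂ := fun y => triangularCoord a b d y * triangularCoord 1 0 (-1) y
  have hP : ∀ y, y ≠ 0 → P y ∈ Complex.slitPlane := fun y hy =>
    triangularCoord_mul_mem_slitPlane ha hd hy
  choose r hr0 hr using fun L : RP1 => exists_lineOf L
  -- The choice of representative does not matter: another one multiplies `P` by a positive square,
  -- which leaves the argument unchanged.
  let f : RP1 → ℝ := fun L => (Complex.log (P (r L))).im / 2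
  have hf : ∀ y, y ≠ 0 → f (lineOf y) = (Complex.log (P y)).im / 2 := by
    intro y hy
    have h1 := hr (lineOf y)
    rw [lineOf_of_ne hy, lineOf_of_ne (hr0 _), Projectivization.mk_eq_mk_iff'] at h1
    obtain ⟨c, hc⟩ := h1
    have hc0 : c ≠ 0 := by
      rintro rfl
      rw [zero_smul] at hc
      exact hr0 _ hc.symm
    have h2 : P (r (lineOf y)) = ((c * c : ℝ) : ℂ) * P y := by
      rw [lineOf_of_ne hy, ← hc]
      apply Complex.ext <;> simp [P, triangularCoord] <;> ring
    simp only [f, Complex.log_im, h2]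
    rw [Complex.arg_real_mul _ (mul_self_pos.2 hc0)]
  have hPs : ContDiff ℝ ∞ P := by
    have h (a b d : ℝ) : ContDiff ℝ ∞ (triangularCoord a b d) := by
      have : triangularCoord a b d = fun y : Plane =>
          Complex.equivRealProdCLM.symm (a * y 0 + b * y 1, d * y 1) := rfl
      rw [this]
      fun_prop
    exact (h a b d).mul (h _ _ _)
  have hfs : ContMDiff 𝓘(ℝ, ℝ) 𝓘(ℝ, ℝ) ∞ f := by
    refine RP1.contMDiff_of_affinePoint fun i => ?_
    simp only [hf _ (affinePoint_ne_zero i _)]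
    rw [contDiff_iff_contDiffAt]
    intro t
    have h1 : ContDiffAt ℝ ∞ Complex.log (P (affinePoint i t)) :=
      (Complex.contDiffAt_log (hP _ (affinePoint_ne_zero i t))).restrict_scalars ℝ
    have h2 : ContDiffAt ℝ ∞ (fun t => Complex.log (P (affinePoint i t))) t :=

      ContDiffAt.comp (g := Complex.log) (f := fun t => P (affinePoint i t)) t h1
        (hPs.comp (contDiff_affinePoint i)).contDiffAt
    exact (Complex.imCLM.contDiff.contDiffAt.comp t h2).div_const 2
  refine ⟨f, hfs, ?_⟩
  intro L Y
  obtain ⟨y, hy, rfl⟩ := exists_lineOf L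
  obtain ⟨w, rfl⟩ := exists_mfderiv_lineOf_eq hy Y
  have hN : (a * y 0 + b * y 1) ^ 2 + (d * y 1) ^ 2 ≠ 0 := by
    have := Complex.normSq_pos.2 (triangularCoord_ne_zero (b := b) ha hd hy)
    simp only [Complex.normSq_apply, triangularCoord] at this
    nlinarith
  have hN1 : y 0 ^ 2 + y 1 ^ 2 ≠ 0 := by
    have := Complex.normSq_pos.2 (triangularCoord_ne_zero (b := 0) one_pos one_pos hy)
    simp only [Complex.normSq_apply, triangularCoord] at this
    nlinarith
  have h1 : HasDerivAt (fun t : ℝ => y + t • w) w 0 := by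
    simpa using ((hasDerivAt_id (0 : ℝ)).smul_const w).const_add y
  have hy' : (fun t : ℝ => y + t • w) 0 ≠ 0 := by simpa
  have hev : ∀ᶠ t : ℝ in 𝓝 0, y + t • w ≠ 0 :=
    h1.continuousAt.eventually_ne hy'
  have h2 : HasDerivAt (fun t : ℝ => (Complex.log (P (y + t • w))).im / 2)
      (((triangularCoord a b d w * triangularCoord 1 0 (-1) y +
        triangularCoord a b d y * triangularCoord 1 0 (-1) w) / P y).im / 2) 0 := by
    have hT (a b d : ℝ) : HasDerivAt (fun t : ℝ => triangularCoord a b d (y + t • w))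
        (triangularCoord a b d w) 0 := by
      have h (t : ℝ) : triangularCoord a b d (y + t • w) =
          triangularCoord a b d y + t • triangularCoord a b d w := by
        apply Complex.ext <;> simp [triangularCoord] <;> ring
      simp only [h]
      simpa using ((hasDerivAt_id (0 : ℝ)).smul_const (triangularCoord a b d w)).const_add
        (triangularCoord a b d y)
    have h3 := (hT a b d).mul (hT 1 0 (-1))
    have h4 := HasDerivAt.clog_real h3 (by simpa using hP y hy)
    have h5 := (Complex.imCLM.hasFDerivAt.comp_hasDerivAt (0 : ℝ) h4).div_const 2
    refine h5.congr_deriv ?_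
    simp [P]
  have h3 : HasDerivAt (fun t : ℝ => f (lineOf (y + t • w)))
      ((mvfderiv 𝓘(ℝ, ℝ) f (lineOf y) : ℝ →L[ℝ] ℝ)
        ((mfderiv 𝓘(ℝ, Plane) 𝓘(ℝ, ℝ) (lineOf : Plane → RP1) y : Plane →L[ℝ] ℝ) w)) 0 := by
    have hg : HasMFDerivAt 𝓘(ℝ, Plane) 𝓘(ℝ, ℝ) (f ∘ (lineOf : Plane → RP1)) y _ :=
      ((hfs (lineOf y)).mdifferentiableAt (by simp)).hasMFDerivAt.comp y
        (mdifferentiableAt_lineOf_RP1 hy).hasMFDerivAt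
    have hg' := hasMFDerivAt_iff_hasFDerivAt.1 hg
    have h0 : y + (0 : ℝ) • w = y := by simp
    rw [← h0] at hg'
    have := hg'.comp_hasDerivAt (0 : ℝ) h1
    refine this.congr_deriv ?_
    rw [h0]
    rfl
  have h4 := h3.unique (h2.congr_of_eventuallyEq (by
    filter_upwards [hev] with t ht
    exact hf _ ht))
  refine Eq.trans ?_ h4.symm
  refine (congrArg₂ (· - ·) (hβ y hy w) (hγ y hy w)).trans ?_
  have hA := triangularCoord_ne_zero (b := b) ha hd hy
  have hB : triangularCoord 1 0 (-1) y ≠ 0 := by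
    intro h
    have := hP y hy
    simp [P, h] at this
  -- The logarithmic derivative of a product. The imaginary parts of the summands are ad(y₀w₁ −
  -- y₁w₀)/N and −(y₀w₁ − y₁w₀)/(y₀² + y₁²), with N the squared modulus of the first coordinate.
  have h5 : (triangularCoord a b d w * triangularCoord 1 0 (-1) y +
        triangularCoord a b d y * triangularCoord 1 0 (-1) w) / P y =
      triangularCoord a b d w / triangularCoord a b d y +
        triangularCoord 1 0 (-1) w / triangularCoord 1 0 (-1) y := by
    simp only [P]
    field_simp
  rw [h5, Complex.add_im, Complex.div_im, Complex.div_im]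
  simp only [Complex.normSq_apply, triangularCoord]
  have hN' : (a * y 0 + b * y 1) * (a * y 0 + b * y 1) + d * y 1 * (d * y 1) =
      (a * y 0 + b * y 1) ^ 2 + (d * y 1) ^ 2 := by ring
  have hN1' : (1 * y 0 + 0 * y 1) * (1 * y 0 + 0 * y 1) + -1 * y 1 * (-1 * y 1) =
      y 0 ^ 2 + y 1 ^ 2 := by ring
  rw [hN', hN1']
  generalize hD : (a * y 0 + b * y 1) ^ 2 + (d * y 1) ^ 2 = D at hN ⊢
  field_simp
  ring

/-- The generator `ᾱ` of `H¹(ℝP¹)`. -/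
theorem exists_generator_RP1 : ∃ (α : OneForm ℝ RP1) (hα : α ∈ closedForms ℝ RP1),
    (∀ y : Plane, y ≠ 0 → ∀ w : Plane,
      α (lineOf y) (mfderiv 𝓘(ℝ, Plane) 𝓘(ℝ, ℝ) lineOf y w) =
        1 / 2 * (1 / (y 0 ^ 2 + y 1 ^ 2)) * (-y 1 * w 0 + y 0 * w 1)) ∧
    α.cohomClass hα ≠ 0 ∧ Submodule.span ℝ {α.cohomClass hα} = ⊤ := by
  have hN (y : Plane) (hy : y ≠ 0) : y 0 ^ 2 + y 1 ^ 2 ≠ 0 := by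
    have := Complex.normSq_pos.2 (triangularCoord_ne_zero (b := 0) one_pos one_pos hy)
    simp only [Complex.normSq_apply, triangularCoord] at this
    nlinarith
  obtain ⟨α, hα⟩ := exists_oneForm_RP1_of_quadratic 1 (N := fun y => y 0 ^ 2 + y 1 ^ 2)
    (by fun_prop) hN (fun c y => by simp; ring)
  refine ⟨α, mem_closedForms_of_line α, fun y hy w => ?_, OneForm.cohomClass_generates _ ?_⟩
  · rw [hα y hy w]
    have := hN y hy
    field_simp
    ring
  -- On the unit circle y₀w₁ − y₁w₀ equals cos² + sin² for the velocity `w`, so the period is π/2.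
  · have h : ∀ t, α.angleCoeff t = 1 / 2 := by
      intro t
      have h1 : α.angleCoeff t = α (lineOf (unitVector t))
          (mfderiv 𝓘(ℝ, Plane) 𝓘(ℝ, ℝ) lineOf (unitVector t)
            ((1 : ℝ) • !₂[-Real.sin t, Real.cos t] : Plane)) :=
        congrArg (α (lineOf (unitVector t)) : ℝ →L[ℝ] ℝ) (RP1.mfderiv_ofAngle t 1)
      rw [h1, hα _ (unitVector_ne_zero t)]
      have := Real.cos_sq_add_sin_sq t
      simp [unitVector]
      nlinarith
    simp only [h]
    simp [Real.pi_ne_zero]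

end RP1AreaForms

/-! ### Smoothness, local lifts and vertical vectors for V ∖ 0 → P(V). -/

section ProjBundle

variable {EM : Type*} [NormedAddCommGroup EM] [NormedSpace ℝ EM]
  {M : Type*} [TopologicalSpace M] [ChartedSpace EM M]
  {V : M → Type*} [TopologicalSpace (TotalSpace Plane V)]
  [∀ x, NormedAddCommGroup (V x)] [∀ x, InnerProductSpace ℝ (V x)]
  [FiberBundle Plane V] [VectorBundle ℝ Plane V]

theorem ProjBundle.exists_chartAt_eq (q : ProjBundle V) : ∃ i, chartAt (EM × ℝ) q =
    projChart (chartAt EM q.proj) (trivializationAt Plane V q.proj) i := ⟨_, rfl⟩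

variable [IsManifold 𝓘(ℝ, EM) ∞ M] [ContMDiffVectorBundle ∞ Plane V 𝓘(ℝ, EM)]

/-- In the chart of P(V) the map is given by the base coordinates and a quotient of the two fibre
coordinates of a trivialization, with nonvanishing denominator. -/
theorem contMDiffAt_toProj {v : TotalSpace Plane V} (hv : v.2 ≠ 0) :
    ContMDiffAt (𝓘(ℝ, EM).prod 𝓘(ℝ, Plane)) 𝓘(ℝ, EM × ℝ) ∞ toProj v := by
  rw [contMDiffAt_iff_target]
  obtain ⟨i, hi⟩ := ProjBundle.exists_chartAt_eq (EM := EM) (toProj v)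
  set φ := chartAt EM v.proj
  set e := trivializationAt Plane V v.proj
  have hv' : toProj v ∈ projChartSource φ e i := by
    have h := mem_chart_source (EM × ℝ) (toProj v)
    rw [hi] at h
    exact h
  have hmem := (toProj_mem_projChartSource φ e i hv).1 hv'
  have hne : {v : TotalSpace Plane V | v.2 ≠ 0} ∈ 𝓝 v := by
    have ho := isOpen_projChartLift φ e i
    refine Filter.mem_of_superset (ho.mem_nhds hmem) ?_
    intro w hw h0
    have h1 : (e w).2 = 0 := by
      have h2 : e.linearMapAt ℝ w.proj w.2 = (e w).2 := by
        rw [e.linearMapAt_apply, if_pos hw.2.1]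
      rw [← h2, h0, map_zero]
    exact hw.2.2 (by rw [h1]; rfl)
  refine ⟨continuousOn_toProj.continuousAt hne, ?_⟩
  have h1 : ContMDiffAt (𝓘(ℝ, EM).prod 𝓘(ℝ, Plane)) 𝓘(ℝ, EM) ∞ (fun w : TotalSpace Plane V => φ w.proj) v :=
    ContMDiffAt.comp (x := v) (g := φ)
      (f := fun w : TotalSpace Plane V => w.proj)
      ((contMDiffOn_chart (I := 𝓘(ℝ, EM)) (n := ∞)).contMDiffAt
        (φ.open_source.mem_nhds (mem_chart_source EM v.proj)))
      (contMDiff_proj V v)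
  have h2 : ContMDiffAt (𝓘(ℝ, EM).prod 𝓘(ℝ, Plane)) 𝓘(ℝ, Plane) ∞
      (fun w : TotalSpace Plane V => (e w).2) v :=
    (contMDiff_snd (n := ∞)).contMDiffAt.comp v ((e.contMDiffOn (n := ∞) (IB := 𝓘(ℝ, EM))).contMDiffAt
      (e.open_source.mem_nhds (e.mem_source.2 hmem.2.1)))
  have h3 (k : Fin 2) : ContMDiffAt (𝓘(ℝ, EM).prod 𝓘(ℝ, Plane)) 𝓘(ℝ, ℝ) ∞
      (fun w : TotalSpace Plane V => (e w).2 k) v :=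
    ContMDiffAt.comp (x := v) (g := fun y : Plane => y k) (f := fun w => (e w).2)
      (contDiff_euclidean.1 contDiff_id k).contMDiff.contMDiffAt h2
  have h4 : ContMDiffAt (𝓘(ℝ, EM).prod 𝓘(ℝ, Plane)) 𝓘(ℝ, EM × ℝ) ∞
      (fun w : TotalSpace Plane V => (φ w.proj, (e w).2 (1 - i) / (e w).2 i)) v :=
    h1.prodMk_space ((h3 _).div₀ (h3 _) hmem.2.2)
  refine h4.congr_of_eventuallyEq ?_
  filter_upwards [hne, (isOpen_projChartLift φ e i).mem_nhds hmem] with w hw hw'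
  simp only [mfld_simps, hi]
  exact Prod.ext rfl (lineCoord_toProj e i hw hw'.2.1)

theorem mdifferentiableAt_toProj {v : TotalSpace Plane V} (hv : v.2 ≠ 0) :
    MDifferentiableAt (𝓘(ℝ, EM).prod 𝓘(ℝ, Plane)) 𝓘(ℝ, EM × ℝ) toProj v :=
  (contMDiffAt_toProj hv).mdifferentiableAt (by simp)

/-- Local sections of `V ∖ 0 → P(V)` through a given point. -/
theorem exists_contMDiffAt_lift {v : TotalSpace Plane V} (hv : v.2 ≠ 0) :
    ∃ s : ProjBundle V → TotalSpace Plane V,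
      ContMDiffAt 𝓘(ℝ, EM × ℝ) (𝓘(ℝ, EM).prod 𝓘(ℝ, Plane)) ∞ s (toProj v) ∧ s (toProj v) = v ∧
      ∀ᶠ q in 𝓝 (toProj v), (s q).2 ≠ 0 ∧ toProj (s q) = q := by
  obtain ⟨i, hi⟩ := ProjBundle.exists_chartAt_eq (EM := EM) (toProj v)
  set φ := chartAt EM v.proj with hφ
  set e := trivializationAt Plane V v.proj with he
  have hv' : toProj v ∈ (projChart φ e i).source := by
    have h := mem_chart_source (EM × ℝ) (toProj v)
    rw [hi] at h
    exact h
  obtain ⟨hm1, hm2, hm3⟩ := (toProj_mem_projChartSource φ e i hv).1 hv'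
  -- Scaling by the `i`-th coordinate of `v` makes the local section pass through `v` itself and not
  -- just through a multiple of it.
  set c := (e v).2 i with hc
  let S : EM × ℝ → TotalSpace Plane V := fun p =>
    e.toOpenPartialHomeomorph.symm (φ.symm p.1, c • affinePoint i p.2)
  have hS : ContMDiffOn 𝓘(ℝ, EM × ℝ) (𝓘(ℝ, EM).prod 𝓘(ℝ, Plane)) ∞ S (projChart φ e i).target := by
    refine (e.contMDiffOn_symm (n := ∞) (IB := 𝓘(ℝ, EM))).comp (t := e.target)
      (ContMDiffOn.prodMk ?_ ?_) ?_
    · exact (contMDiffOn_chart_symm (I := 𝓘(ℝ, EM)) (n := ∞)).comp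
        contDiff_fst.contMDiff.contMDiffOn fun p hp => hp.1
    · exact (((contDiff_affinePoint i).comp contDiff_snd).const_smul c).contMDiff.contMDiffOn
    · exact fun p hp => e.mem_target.2 hp.2
  have hSs (p : EM × ℝ) (hp : p ∈ (projChart φ e i).target) : (S p).2 ≠ 0 ∧
      toProj (S p) = (projChart φ e i).symm p := by
    have hne := trivialization_symm_ne_zero e hp.2 (smul_ne_zero hm3 (affinePoint_ne_zero i p.2))
    refine ⟨hne, ?_⟩
    have hpr : (S p).proj = φ.symm p.1 := e.proj_symm_apply' hp.2
    have hmem : toProj (S p) ∈ (projChart φ e i).source := by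
      refine (toProj_mem_projChartSource φ e i hne).2 ?_
      rw [hpr]
      refine ⟨φ.map_target hp.1, hp.2, ?_⟩
      rw [e.apply_symm_apply' hp.2]
      simpa using hm3
    rw [← (projChart φ e i).left_inv hmem]
    congr 1
    refine Prod.ext ?_ ?_
    · refine Eq.trans ?_ (φ.right_inv hp.1)
      exact congrArg φ hpr
    · refine (lineCoord_toProj e i hne (by rw [hpr]; exact hp.2)).trans ?_
      rw [e.apply_symm_apply' hp.2]
      simp [hm3]
  have hchart : ContMDiffAt 𝓘(ℝ, EM × ℝ) 𝓘(ℝ, EM × ℝ) ∞ (projChart φ e i) (toProj v) := by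
    have := (contMDiffOn_chart (I := 𝓘(ℝ, EM × ℝ)) (n := ∞) (x := toProj v)).contMDiffAt
      ((chartAt (EM × ℝ) (toProj v)).open_source.mem_nhds (mem_chart_source _ _))
    rw [hi] at this
    exact this
  refine ⟨fun q => S (projChart φ e i q), ?_, ?_, ?_⟩
  · exact ((hS _ ((projChart φ e i).map_source hv')).contMDiffAt
      ((projChart φ e i).open_target.mem_nhds ((projChart φ e i).map_source hv'))).comp _ hchart
  · have h1 : projChart φ e i (toProj v) = (φ v.proj, (e v).2 (1 - i) / (e v).2 i) :=
      Prod.ext rfl (lineCoord_toProj e i hv hm2)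
    change S (projChart φ e i (toProj v)) = v
    rw [h1]
    simp only [S]
    rw [affinePoint_div hm3, smul_smul, mul_inv_cancel₀ hm3, one_smul, φ.left_inv hm1]
    exact e.symm_apply_mk_proj (e.mem_source.2 hm2)
  · filter_upwards [(projChart φ e i).open_source.mem_nhds hv'] with q hq
    obtain ⟨h1, h2⟩ := hSs _ ((projChart φ e i).map_source hq)
    exact ⟨h1, h2.trans ((projChart φ e i).left_inv hq)⟩

/-- A local section differentiates to a right inverse. Surjectivity is what makes a form on P(V)
unique once its pull-back to V ∖ 0 is known. -/
theorem mfderiv_toProj_surjective {v : TotalSpace Plane V} (hv : v.2 ≠ 0) :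
    Function.Surjective
      (mfderiv (𝓘(ℝ, EM).prod 𝓘(ℝ, Plane)) 𝓘(ℝ, EM × ℝ) (toProj : _ → ProjBundle V) v) := by
  obtain ⟨s, hs, hsv, hsq⟩ := exists_contMDiffAt_lift (EM := EM) hv
  have h1 : MDifferentiableAt (𝓘(ℝ, EM).prod 𝓘(ℝ, Plane)) 𝓘(ℝ, EM × ℝ)
      (toProj : _ → ProjBundle V) (s (toProj v)) := by
    rw [hsv]
    exact mdifferentiableAt_toProj hv
  have h2 := h1.hasMFDerivAt.comp _ (hs.mdifferentiableAt (by simp)).hasMFDerivAt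
  have h3 : HasMFDerivAt 𝓘(ℝ, EM × ℝ) 𝓘(ℝ, EM × ℝ) ((toProj : _ → ProjBundle V) ∘ s) (toProj v)
      (ContinuousLinearMap.id ℝ _) :=
    (hasMFDerivAt_id _).congr_of_eventuallyEq (hsq.mono fun q hq => hq.2)
  have h4 := hasMFDerivAt_unique h2 h3
  intro (Y : EM × ℝ)
  obtain ⟨B, hB⟩ : ∃ B : EM × ℝ →L[ℝ] EM × Plane,
    B = mfderiv 𝓘(ℝ, EM × ℝ) (𝓘(ℝ, EM).prod 𝓘(ℝ, Plane)) s (toProj v) := ⟨_, rfl⟩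
  refine ⟨B Y, ?_⟩
  -- The chain rule takes the differential at `s (toProj v)`; this transports it to the equal point
  -- `v`.
  have h5 : ∀ w : TotalSpace Plane V, w = v →
      (mfderiv (𝓘(ℝ, EM).prod 𝓘(ℝ, Plane)) 𝓘(ℝ, EM × ℝ) (toProj : _ → ProjBundle V) w :
        EM × Plane →L[ℝ] EM × ℝ) (B Y) =
      (mfderiv (𝓘(ℝ, EM).prod 𝓘(ℝ, Plane)) 𝓘(ℝ, EM × ℝ) (toProj : _ → ProjBundle V) v :
        EM × Plane →L[ℝ] EM × ℝ) (B Y) := by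
    rintro _ rfl
    rfl
  refine (h5 _ hsv).symm.trans ?_
  rw [hB]
  exact congrArg (fun A : EM × ℝ →L[ℝ] EM × ℝ => A Y) h4

/-- Locally this is the projection of the vector bundle composed with a lift. -/
theorem contMDiff_projBundle_proj :
    ContMDiff 𝓘(ℝ, EM × ℝ) 𝓘(ℝ, EM) ∞ (ProjBundle.proj : ProjBundle V → M) := by
  intro q
  obtain ⟨v, hv, rfl⟩ := exists_toProj q
  obtain ⟨s, hs, hsv, hsq⟩ := exists_contMDiffAt_lift (EM := EM) hv
  have h : ContMDiffAt 𝓘(ℝ, EM × ℝ) 𝓘(ℝ, EM) ∞ (fun q => (s q).proj) (toProj v) :=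
    (contMDiff_proj V (s (toProj v))).comp (toProj v) hs
  refine h.congr_of_eventuallyEq (hsq.mono fun q hq => ?_)
  conv_lhs => rw [← hq.2]
  rfl

theorem hasMFDerivAt_fiber_inclusion {x : M} (v : V x) :
    HasMFDerivAt 𝓘(ℝ, V x) (𝓘(ℝ, EM).prod 𝓘(ℝ, Plane)) (fun u : V x => (⟨x, u⟩ : TotalSpace Plane V)) v
      (mfderiv 𝓘(ℝ, V x) (𝓘(ℝ, EM).prod 𝓘(ℝ, Plane))
        (fun u : V x => (⟨x, u⟩ : TotalSpace Plane V)) v) := by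
  set e := trivializationAt Plane V x with he
  have hx : x ∈ e.baseSet := FiberBundle.mem_baseSet_trivializationAt' x
  have hlin : HasFDerivAt (fun u : V x => (e ⟨x, u⟩).2) (e.continuousLinearMapAt ℝ x) v := by
    refine (e.continuousLinearMapAt ℝ x).hasFDerivAt.congr_of_eventuallyEq (.of_forall fun u => ?_)
    simp [e.coe_linearMapAt_of_mem hx]
  have hm : MDifferentiableAt 𝓘(ℝ, V x) (𝓘(ℝ, EM).prod 𝓘(ℝ, Plane))
      (fun u : V x => (⟨x, u⟩ : TotalSpace Plane V)) v := by
    rw [mdifferentiableAt_totalSpace]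
    exact ⟨mdifferentiableAt_const, hlin.differentiableAt.mdifferentiableAt⟩
  exact hm.hasMFDerivAt

/-- A tangent vector of a vector bundle which projects to zero is tangent to the fibre. -/
theorem exists_mfderiv_fiber_eq {x : M} (v : V x)
    (X : EM × Plane) (hX : (mfderiv (𝓘(ℝ, EM).prod 𝓘(ℝ, Plane)) 𝓘(ℝ, EM) (π Plane V) ⟨x, v⟩ :
      EM × Plane →L[ℝ] EM) X = 0) :
    ∃ w : V x, (mfderiv 𝓘(ℝ, V x) (𝓘(ℝ, EM).prod 𝓘(ℝ, Plane))
        (fun u : V x => (⟨x, u⟩ : TotalSpace Plane V)) v : V x →L[ℝ] EM × Plane) w = X := by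
  set e := trivializationAt Plane V x with he
  have hx : x ∈ e.baseSet := FiberBundle.mem_baseSet_trivializationAt' x
  set p : TotalSpace Plane V := ⟨x, v⟩ with hp
  have hps : p ∈ e.source := e.mem_source.2 hx
  have hlin : HasFDerivAt (fun u : V x => (e ⟨x, u⟩).2) (e.continuousLinearMapAt ℝ x) v := by
    refine (e.continuousLinearMapAt ℝ x).hasFDerivAt.congr_of_eventuallyEq (.of_forall fun u => ?_)
    simp [e.coe_linearMapAt_of_mem hx]
  have hm := hasMFDerivAt_fiber_inclusion (EM := EM) v
  have he1 : MDifferentiableAt (𝓘(ℝ, EM).prod 𝓘(ℝ, Plane)) (𝓘(ℝ, EM).prod 𝓘(ℝ, Plane)) e p :=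
    ((e.contMDiffOn (n := ∞) (IB := 𝓘(ℝ, EM))).contMDiffAt
      (e.open_source.mem_nhds hps)).mdifferentiableAt (by simp)
  have he2 : MDifferentiableAt (𝓘(ℝ, EM).prod 𝓘(ℝ, Plane)) (𝓘(ℝ, EM).prod 𝓘(ℝ, Plane))
      e.toOpenPartialHomeomorph.symm (e p) :=
    ((e.contMDiffOn_symm (n := ∞) (IB := 𝓘(ℝ, EM))).contMDiffAt
      (e.open_target.mem_nhds (e.map_source hps))).mdifferentiableAt (by simp)
  have hid := hasMFDerivAt_unique (he2.hasMFDerivAt.comp p he1.hasMFDerivAt)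
    ((hasMFDerivAt_id p).congr_of_eventuallyEq (e.eventually_left_inverse hps))
  obtain ⟨D, hD⟩ : ∃ D : EM × Plane →L[ℝ] EM × Plane, D = mfderiv (𝓘(ℝ, EM).prod 𝓘(ℝ, Plane))
    (𝓘(ℝ, EM).prod 𝓘(ℝ, Plane)) e p := ⟨_, rfl⟩
  obtain ⟨I, hI⟩ : ∃ I : V x →L[ℝ] EM × Plane, I = mfderiv 𝓘(ℝ, V x) (𝓘(ℝ, EM).prod 𝓘(ℝ, Plane))
        (fun u : V x => (⟨x, u⟩ : TotalSpace Plane V)) v := ⟨_, rfl⟩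
  obtain ⟨Q, hQ⟩ : ∃ Q : EM × Plane →L[ℝ] EM, Q = mfderiv (𝓘(ℝ, EM).prod 𝓘(ℝ, Plane)) 𝓘(ℝ, EM)
    (π Plane V) p := ⟨_, rfl⟩
  -- The trivialization is a local diffeomorphism, so tangent vectors may be compared after applying
  -- `D`: the base component is then `Q`, and on the fibre the second component is the linear
  -- coordinate.
  have hinj : Function.Injective D := by
    intro a b hab
    have h (c : EM × Plane) : (mfderiv (𝓘(ℝ, EM).prod 𝓘(ℝ, Plane)) (𝓘(ℝ, EM).prod 𝓘(ℝ, Plane))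
      e.toOpenPartialHomeomorph.symm (e p) : EM × Plane →L[ℝ] EM × Plane) (D c) = c := by
      rw [hD]
      exact congrArg (fun A : EM × Plane →L[ℝ] EM × Plane => A c) hid
    rw [← h a, ← h b, hab]
  have hD1 (c : EM × Plane) : (D c).1 = Q c := by
    have h1 := hasMFDerivAt_unique ((hasMFDerivAt_fst (I := 𝓘(ℝ, EM)) (I' := 𝓘(ℝ, Plane)) (e p)).comp p he1.hasMFDerivAt)
      ((mdifferentiableAt_proj (IB := 𝓘(ℝ, EM)) V (p := p)).hasMFDerivAt.congr_of_eventuallyEq (by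
        filter_upwards [e.open_source.mem_nhds hps] with q hq
        exact e.coe_fst hq))
    rw [hD, hQ]
    exact congrArg (fun A : EM × Plane →L[ℝ] EM => A c) h1
  have hI1 (w : V x) : Q (I w) = 0 := by
    have h1 := hasMFDerivAt_unique ((mdifferentiableAt_proj (IB := 𝓘(ℝ, EM)) V
      (p := p)).hasMFDerivAt.comp v hm) (hasMFDerivAt_const x v)
    rw [hI, hQ]
    exact congrArg (fun A : V x →L[ℝ] EM => A w) h1
  have hI2 (w : V x) : (D (I w)).2 = e.continuousLinearMapAt ℝ x w := by
    have h1 := hasMFDerivAt_unique (((hasMFDerivAt_snd (I := 𝓘(ℝ, EM)) (I' := 𝓘(ℝ, Plane)) (e p)).comp p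
      he1.hasMFDerivAt).comp v hm) hlin.hasMFDerivAt
    rw [hI, hD]
    exact congrArg (fun A : V x →L[ℝ] Plane => A w) h1
  refine ⟨e.symmL ℝ x (D X).2, ?_⟩
  have key : I (e.symmL ℝ x (D X).2) = X := by
    apply hinj
    refine Prod.ext ?_ ?_
    · rw [hD1, hD1, hI1, hQ]
      exact hX.symm
    · rw [hI2]
      exact Trivialization.continuousLinearMapAt_symmL (R := ℝ) e hx _
  rw [hI] at key
  exact key

end ProjBundle

/-! ### Area form and oriented orthonormal frames. -/

section Frames

variable {EM : Type*} [NormedAddCommGroup EM] [NormedSpace ℝ EM]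
  {M : Type*} [TopologicalSpace M] [ChartedSpace EM M]
  {V : M → Type*} [TopologicalSpace (TotalSpace Plane V)]
  [∀ x, NormedAddCommGroup (V x)] [∀ x, InnerProductSpace ℝ (V x)]
  [FiberBundle Plane V] [VectorBundle ℝ Plane V]

theorem areaForm_self (o : ∀ x, Orientation ℝ (V x) (Fin 2)) (x : M) (v : V x) :
    areaForm o x v v = 0 := by
  have : Fact (finrank ℝ (V x) = 2) := ⟨finrank_fiber V x⟩
  exact (o x).areaForm_apply_self v

theorem areaForm_swap (o : ∀ x, Orientation ℝ (V x) (Fin 2)) (x : M) (v w : V x) :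
    areaForm o x v w = -areaForm o x w v := by
  have : Fact (finrank ℝ (V x) = 2) := ⟨finrank_fiber V x⟩
  exact (o x).areaForm_swap v w

theorem areaForm_add_right (o : ∀ x, Orientation ℝ (V x) (Fin 2)) (x : M) (v w w' : V x) :
    areaForm o x v (w + w') = areaForm o x v w + areaForm o x v w' :=
  haveI : Fact (finrank ℝ (V x) = 2) := ⟨finrank_fiber V x⟩
  map_add ((o x).areaForm v) w w'

theorem areaForm_smul_right (o : ∀ x, Orientation ℝ (V x) (Fin 2)) (x : M) (v w : V x) (c : ℝ) :
    areaForm o x v (c • w) = c * areaForm o x v w :=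
  haveI : Fact (finrank ℝ (V x) = 2) := ⟨finrank_fiber V x⟩
  map_smul ((o x).areaForm v) c w

theorem areaForm_smul_left (o : ∀ x, Orientation ℝ (V x) (Fin 2)) (x : M) (v w : V x) (c : ℝ) :
    areaForm o x (c • v) w = c * areaForm o x v w := by
  rw [areaForm_swap, areaForm_smul_right, areaForm_swap o x w v]
  ring

theorem areaForm_zero_right (o : ∀ x, Orientation ℝ (V x) (Fin 2)) (x : M) (v : V x) :
    areaForm o x v 0 = 0 :=
  haveI : Fact (finrank ℝ (V x) = 2) := ⟨finrank_fiber V x⟩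
  map_zero ((o x).areaForm v)

/-- With J the rotation by a right angle, θ(a, ·) = ⟨Ja, ·⟩, so this is the expansion of ⟨v, w⟩ in
the orthogonal pair a, Ja. The next identity is the same expansion of θ(v, w). -/
theorem inner_mul_inner_add_areaForm_mul_areaForm (o : ∀ x, Orientation ℝ (V x) (Fin 2)) (x : M)
    (a v w : V x) : (inner ℝ a v : ℝ) * inner ℝ a w + areaForm o x a v * areaForm o x a w =
      inner ℝ a a * inner ℝ v w := by
  have : Fact (finrank ℝ (V x) = 2) := ⟨finrank_fiber V x⟩
  rw [real_inner_self_eq_norm_sq]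
  exact (o x).inner_mul_inner_add_areaForm_mul_areaForm a v w

theorem inner_mul_areaForm_sub (o : ∀ x, Orientation ℝ (V x) (Fin 2)) (x : M)
    (a v w : V x) : inner ℝ a v * areaForm o x a w - areaForm o x a v * inner ℝ a w =
      inner ℝ a a * areaForm o x v w := by
  have : Fact (finrank ℝ (V x) = 2) := ⟨finrank_fiber V x⟩
  rw [real_inner_self_eq_norm_sq]
  exact (o x).inner_mul_areaForm_sub a v w

/-- The area form is the determinant with respect to a positively oriented orthonormal basis, and
the sign of that determinant compares orientations. -/
theorem areaForm_pos_of_orientation_eq {o : ∀ x, Orientation ℝ (V x) (Fin 2)} {x : M}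
    {b : Basis (Fin 2) ℝ (V x)} (h : b.orientation = o x) : 0 < areaForm o x (b 0) (b 1) := by
  have : Fact (finrank ℝ (V x) = 2) := ⟨finrank_fiber V x⟩
  let f := (o x).finOrthonormalBasis (by norm_num) (finrank_fiber V x)
  have hf : f.toBasis.orientation = o x :=
    (o x).finOrthonormalBasis_orientation (by norm_num) (finrank_fiber V x)
  have h1 := (Basis.orientation_eq_iff_det_pos f.toBasis b).1 (hf.trans h.symm)
  have h2 : areaForm o x (b 0) (b 1) = f.toBasis.det b := by
    rw [← (o x).volumeForm_robust f hf, areaForm, Orientation.areaForm_to_volumeForm]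
    congr 1
    ext i
    fin_cases i <;> rfl
  rwa [h2]

/-- A pair of sections which at `x` is a positively oriented orthonormal basis: the first is a unit
vector and the second its rotation by a right angle. -/
structure IsOrientedFrameAt (o : ∀ x, Orientation ℝ (V x) (Fin 2)) (E : Fin 2 → ∀ x, V x)
    (x : M) : Prop where
  inner_self : (inner ℝ (E 0 x) (E 0 x) : ℝ) = 1
  inner_one : ∀ v, (inner ℝ (E 1 x) v : ℝ) = areaForm o x (E 0 x) v

namespace IsOrientedFrameAt

variable {o : ∀ x, Orientation ℝ (V x) (Fin 2)} {E : Fin 2 → ∀ x, V x} {x : M}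

/-- The expansion at the unit vector `E 0 x`, since `E 1 x` represents θ(`E 0 x`, ·). Orthonormality
and the spanning property follow from this. -/
theorem inner_eq (h : IsOrientedFrameAt o E x) (v w : V x) :
    (inner ℝ v w : ℝ) = inner ℝ (E 0 x) v * inner ℝ (E 0 x) w +
      inner ℝ (E 1 x) v * inner ℝ (E 1 x) w := by
  rw [h.inner_one, h.inner_one, inner_mul_inner_add_areaForm_mul_areaForm, h.inner_self, one_mul]

theorem areaForm_eq (h : IsOrientedFrameAt o E x) (v w : V x) :
    areaForm o x v w = inner ℝ (E 0 x) v * inner ℝ (E 1 x) w -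
      inner ℝ (E 1 x) v * inner ℝ (E 0 x) w := by
  rw [h.inner_one, h.inner_one, inner_mul_areaForm_sub, h.inner_self, one_mul]

theorem sum_eq (h : IsOrientedFrameAt o E x) (v : V x) :
    v = (inner ℝ (E 0 x) v : ℝ) • E 0 x + (inner ℝ (E 1 x) v : ℝ) • E 1 x := by
  refine ext_inner_right ℝ fun w => ?_
  rw [h.inner_eq v w, inner_add_left, real_inner_smul_left, real_inner_smul_left]

theorem inner_zero_one (h : IsOrientedFrameAt o E x) : (inner ℝ (E 0 x) (E 1 x) : ℝ) = 0 := by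
  rw [real_inner_comm, h.inner_one, areaForm_self]

theorem inner_one_one (h : IsOrientedFrameAt o E x) : (inner ℝ (E 1 x) (E 1 x) : ℝ) = 1 := by
  have : Fact (finrank ℝ (V x) = 2) := ⟨finrank_fiber V x⟩
  have h1 : E 1 x = (o x).rightAngleRotation (E 0 x) := by
    refine ext_inner_right ℝ fun w => ?_
    rw [h.inner_one, Orientation.inner_rightAngleRotation_left]
    rfl
  rw [h1, Orientation.inner_comp_rightAngleRotation, h.inner_self]

theorem inner_one_zero (h : IsOrientedFrameAt o E x) : (inner ℝ (E 1 x) (E 0 x) : ℝ) = 0 := by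
  rw [h.inner_one, areaForm_self]

/-- A line orthogonal to `E 0` lies outside the affine chart of the frame; after this rotation it
lies inside. -/
theorem rotate (h : IsOrientedFrameAt o E x) : IsOrientedFrameAt o ![E 1, -E 0] x := by
  constructor
  · exact h.inner_one_one
  · intro v
    have h1 := h.areaForm_eq (E 1 x) v
    rw [h.inner_zero_one, h.inner_one_one] at h1
    simp [h1]

end IsOrientedFrameAt

variable [IsManifold 𝓘(ℝ, EM) ∞ M] [ContMDiffVectorBundle ∞ Plane V 𝓘(ℝ, EM)]
  [IsContMDiffRiemannianBundle 𝓘(ℝ, EM) ∞ Plane V]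

theorem ContMDiffOn.normalize_section {σ : ∀ x, V x} {U : Set M}
    (hσ : ContMDiffOn 𝓘(ℝ, EM) (𝓘(ℝ, EM).prod 𝓘(ℝ, Plane)) ∞
      (fun x => (⟨x, σ x⟩ : TotalSpace Plane V)) U) (h0 : ∀ x ∈ U, σ x ≠ 0) :
    ContMDiffOn 𝓘(ℝ, EM) (𝓘(ℝ, EM).prod 𝓘(ℝ, Plane)) ∞
      (fun x => (⟨x, (√(inner ℝ (σ x) (σ x)))⁻¹ • σ x⟩ : TotalSpace Plane V)) U := by
  have h1 : ContMDiffOn 𝓘(ℝ, EM) 𝓘(ℝ, ℝ) ∞ (fun x => (inner ℝ (σ x) (σ x) : ℝ)) U :=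
    hσ.inner_bundle hσ
  have h2 : ContMDiffOn 𝓘(ℝ, EM) 𝓘(ℝ, ℝ) ∞ (fun x => (√(inner ℝ (σ x) (σ x)))⁻¹) U := by
    intro x hx
    have hne : (inner ℝ (σ x) (σ x) : ℝ) ≠ 0 := inner_self_ne_zero.2 (h0 x hx)
    have h3 : ContDiffAt ℝ ∞ (fun r : ℝ => (√r)⁻¹) (inner ℝ (σ x) (σ x)) :=
      (Real.contDiffAt_sqrt hne).inv
        (Real.sqrt_ne_zero'.2 (real_inner_self_nonneg.lt_of_ne' hne))
    exact ContMDiffAt.comp_contMDiffWithinAt (g := fun r : ℝ => (√r)⁻¹) x h3.contMDiffAt (h1 x hx)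
  exact h2.smul_section hσ

/-- Gram-Schmidt: an oriented Riemannian bundle of rank two has local oriented orthonormal
frames. -/
theorem IsBundleOrientation.exists_frame_on {o : ∀ x, Orientation ℝ (V x) (Fin 2)}
    (ho : IsBundleOrientation EM o) (x₀ : M) :
    ∃ U : Set M, IsOpen U ∧ x₀ ∈ U ∧ ∃ E : Fin 2 → ∀ x, V x,
      (∀ i, ContMDiffOn 𝓘(ℝ, EM) (𝓘(ℝ, EM).prod 𝓘(ℝ, Plane)) ∞
        (fun x => (⟨x, E i x⟩ : TotalSpace Plane V)) U) ∧ ∀ x ∈ U, IsOrientedFrameAt o E x := by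
  obtain ⟨U', hU', b, hb, hbo⟩ := ho x₀
  obtain ⟨U, hUU', hU, hx₀⟩ := mem_nhds_iff.1 hU'
  have hpos : ∀ x ∈ U, 0 < areaForm o x (b x 0) (b x 1) := fun x hx =>
    areaForm_pos_of_orientation_eq (hbo x (hUU' hx))
  let F0 : ∀ x, V x := fun x => (√(inner ℝ (b x 0) (b x 0)))⁻¹ • b x 0
  let c : ∀ x, V x := fun x => b x 1 - (inner ℝ (F0 x) (b x 1) : ℝ) • F0 x
  let F1 : ∀ x, V x := fun x => (√(inner ℝ (c x) (c x)))⁻¹ • c x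
  have hsq : ∀ x, 0 < √(inner ℝ (b x 0) (b x 0)) := fun x =>
    Real.sqrt_pos.2 (real_inner_self_nonneg.lt_of_ne' (inner_self_ne_zero.2 ((b x).ne_zero 0)))
  have hF0 : ∀ x, (inner ℝ (F0 x) (F0 x) : ℝ) = 1 := by
    intro x
    simp only [F0]
    rw [real_inner_smul_left, real_inner_smul_right]
    have h1 := Real.mul_self_sqrt (real_inner_self_nonneg (x := b x 0))
    have h2 := (hsq x).ne'
    field_simp
    rw [sq, h1]
  have hpos' : ∀ x ∈ U, 0 < areaForm o x (F0 x) (b x 1) := by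
    intro x hx
    simp only [F0]
    rw [areaForm_smul_left]
    exact mul_pos (inv_pos.2 (hsq x)) (hpos x hx)
  -- Thus the Gram-Schmidt remainder is θ(F₀, b₁) times the rotation of F₀ by a right angle.
  have hc : ∀ x v, (inner ℝ (c x) v : ℝ) = areaForm o x (F0 x) (b x 1) * areaForm o x (F0 x) v := by
    intro x v
    have h1 := inner_mul_inner_add_areaForm_mul_areaForm o x (F0 x) (b x 1) v
    rw [hF0, one_mul] at h1
    simp only [c]
    rw [inner_sub_left, real_inner_smul_left]
    linarith
  have hcc : ∀ x, (inner ℝ (c x) (c x) : ℝ) = areaForm o x (F0 x) (b x 1) ^ 2 := by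
    intro x
    have h1 : areaForm o x (F0 x) (c x) = areaForm o x (F0 x) (b x 1) := by
      simp only [c]
      rw [sub_eq_add_neg, ← neg_smul, areaForm_add_right, areaForm_smul_right, areaForm_self]
      simp
    rw [hc, h1, sq]
  have hF0s := ContMDiffOn.normalize_section (EM := EM) ((hb 0).mono hUU') fun x _ => (b x).ne_zero 0
  have hcs : ContMDiffOn 𝓘(ℝ, EM) (𝓘(ℝ, EM).prod 𝓘(ℝ, Plane)) ∞
      (fun x => (⟨x, c x⟩ : TotalSpace Plane V)) U :=
    ((hb 1).mono hUU').sub_section ((hF0s.inner_bundle ((hb 1).mono hUU')).smul_section hF0s)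
  have hc0 : ∀ x ∈ U, c x ≠ 0 := by
    intro x hx h
    have h1 := hcc x
    rw [h, inner_zero_left] at h1
    exact (pow_pos (hpos' x hx) 2).ne h1
  refine ⟨U, hU, hx₀, ![F0, F1], ?_, ?_⟩
  · intro i
    fin_cases i
    · exact hF0s
    · exact ContMDiffOn.normalize_section hcs hc0
  · intro x hx
    refine ⟨hF0 x, fun v => ?_⟩
    change (inner ℝ (F1 x) v : ℝ) = areaForm o x (F0 x) v
    simp only [F1]
    -- Positivity of θ(F₀, b₁) decides the sign of the square root; this is where the orientation
    -- enters.
    rw [real_inner_smul_left, hcc, hc, Real.sqrt_sq (hpos' x hx).le]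
    have := (hpos' x hx).ne'
    field_simp

/-- Near every point there is an oriented orthonormal frame given by global smooth sections, which
moreover can be chosen with a nonzero first coordinate at a given nonzero vector. -/
theorem IsBundleOrientation.exists_frame [FiniteDimensional ℝ EM] [T2Space M]
    {o : ∀ x, Orientation ℝ (V x) (Fin 2)} (ho : IsBundleOrientation EM o)
    {x₀ : M} {v : V x₀} (hv : v ≠ 0) :
    ∃ E : Fin 2 → ∀ x, V x,
      (∀ i, ContMDiff 𝓘(ℝ, EM) (𝓘(ℝ, EM).prod 𝓘(ℝ, Plane)) ∞
        (fun x => (⟨x, E i x⟩ : TotalSpace Plane V))) ∧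
      (∀ᶠ x in 𝓝 x₀, IsOrientedFrameAt o E x) ∧ (inner ℝ (E 0 x₀) v : ℝ) ≠ 0 := by
  obtain ⟨U, hU, hx₀, E, hE, hEo⟩ := ho.exists_frame_on x₀
  -- A cut-off function equal to 1 near x₀ makes the sections global, so that their covariant
  -- derivatives give 1-forms on all of M. The frame is orthonormal only near x₀.
  obtain ⟨ψ, -, hψ⟩ := (SmoothBumpFunction.nhds_basis_tsupport (I := 𝓘(ℝ, EM)) x₀).mem_iff.1
    (hU.mem_nhds hx₀)
  let F : Fin 2 → ∀ x, V x := fun i => (ψ : M → ℝ) • E i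
  have hF : ∀ i, ContMDiff 𝓘(ℝ, EM) (𝓘(ℝ, EM).prod 𝓘(ℝ, Plane)) ∞
      (fun x => (⟨x, F i x⟩ : TotalSpace Plane V)) := fun i =>
    ContMDiffOn.smul_section_of_tsupport ψ.contMDiff.contMDiffOn hU hψ (hE i)
  have hFE : ∀ᶠ x in 𝓝 x₀, IsOrientedFrameAt o F x := by
    filter_upwards [ψ.eventuallyEq_one, hU.mem_nhds hx₀] with x hx hxU
    have h (i : Fin 2) : F i x = E i x := by
      change ψ x • E i x = E i x
      rw [hx]
      exact one_smul _ _
    have h2 := hEo x hxU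
    constructor
    · rw [h]
      exact h2.inner_self
    · rw [h, h]
      exact h2.inner_one
  by_cases h0 : (inner ℝ (F 0 x₀) v : ℝ) = 0
  · refine ⟨![F 1, -F 0], ?_, hFE.mono fun x hx => hx.rotate, ?_⟩
    · intro i
      fin_cases i
      · exact hF 1
      · exact (hF 0).neg_section
    · intro h1
      have h2 := hFE.self_of_nhds.sum_eq v
      rw [h0, zero_smul, zero_add] at h2
      rw [show (inner ℝ (F 1 x₀) v : ℝ) = 0 from h1, zero_smul] at h2
      exact hv h2
  · exact ⟨F, hF, hFE, h0⟩

end Frames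

/-! ### The connection form in an orthonormal frame. -/

section ConnectionCoefficients

variable {EM : Type*} [NormedAddCommGroup EM] [NormedSpace ℝ EM]
  {M : Type*} [TopologicalSpace M] [ChartedSpace EM M]
  {V : M → Type*} [TopologicalSpace (TotalSpace Plane V)]
  [∀ x, NormedAddCommGroup (V x)] [∀ x, InnerProductSpace ℝ (V x)]
  [FiberBundle Plane V] [VectorBundle ℝ Plane V]
  [IsManifold 𝓘(ℝ, EM) ∞ M] [ContMDiffVectorBundle ∞ Plane V 𝓘(ℝ, EM)]
  [IsContMDiffRiemannianBundle 𝓘(ℝ, EM) ∞ Plane V]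

theorem CovariantDerivative.contMDiff_apply (cov : CovariantDerivative 𝓘(ℝ, EM) Plane V)
    [h : CovariantDerivative.ContMDiffCovariantDerivative cov ∞] {σ : ∀ x, V x}
    (hσ : ContMDiff 𝓘(ℝ, EM) (𝓘(ℝ, EM).prod 𝓘(ℝ, Plane)) ∞
      (fun x => (⟨x, σ x⟩ : TotalSpace Plane V))) :
    ContMDiff 𝓘(ℝ, EM) (𝓘(ℝ, EM).prod 𝓘(ℝ, EM →L[ℝ] Plane)) ∞
      (fun x => TotalSpace.mk' (EM →L[ℝ] Plane)
        (E := fun x : M => TangentSpace 𝓘(ℝ, EM) x →L[ℝ] V x) x (cov σ x)) := by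
  rw [← contMDiffOn_univ]
  exact h.contMDiff.contMDiff (by simpa using hσ.contMDiffOn)

/-- The 1-form `⟨τ, ∇σ⟩`. -/
def connectionCoeff [FiniteDimensional ℝ EM] (cov : CovariantDerivative 𝓘(ℝ, EM) Plane V)
    [CovariantDerivative.ContMDiffCovariantDerivative cov ∞] {σ τ : ∀ x, V x}
    (hτ : ContMDiff 𝓘(ℝ, EM) (𝓘(ℝ, EM).prod 𝓘(ℝ, Plane)) ∞
      (fun x => (⟨x, τ x⟩ : TotalSpace Plane V)))
    (hσ : ContMDiff 𝓘(ℝ, EM) (𝓘(ℝ, EM).prod 𝓘(ℝ, Plane)) ∞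
      (fun x => (⟨x, σ x⟩ : TotalSpace Plane V))) : OneForm EM M :=
  OneForm.ofInChart (fun x => (innerSL ℝ (τ x)).comp (cov σ x)) fun q => by
    refine ContDiffOn.contDiffAt (s := (chartAt EM q).target) ?_
      ((chartAt EM q).open_target.mem_nhds (mem_chart_target EM q))
    rw [contDiffOn_clm_apply]
    intro w
    have hφ := contMDiffOn_chart_symm (I := 𝓘(ℝ, EM)) (n := ∞) (x := q)
    have ho := (chartAt EM q).open_target
    have h1 : ContMDiffOn 𝓘(ℝ, EM) (𝓘(ℝ, EM).prod 𝓘(ℝ, EM)) ∞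
        (fun y : EM => (⟨(chartAt EM q).symm y,
          mfderiv 𝓘(ℝ, EM) 𝓘(ℝ, EM) (chartAt EM q).symm y w⟩ :
          TangentBundle 𝓘(ℝ, EM) M)) (chartAt EM q).target := by
      have h := hφ.contMDiffOn_tangentMapWithin (m := ∞) (by simp) ho.uniqueMDiffOn
      have hw : ContMDiff 𝓘(ℝ, EM) 𝓘(ℝ, EM).tangent ∞
          (fun y : EM => (⟨y, w⟩ : TangentBundle 𝓘(ℝ, EM) EM)) :=
        contMDiff_vectorSpace_iff_contDiff.2 contDiff_const
      refine (h.comp hw.contMDiffOn fun y hy => hy).congr fun y hy => ?_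
      simp [tangentMapWithin, mfderivWithin_of_isOpen ho hy]
    have h2 := ((cov.contMDiff_apply hσ).comp_contMDiffOn hφ).clm_bundle_apply h1
    have h3 := (hτ.comp_contMDiffOn hφ).inner_bundle h2
    exact contMDiffOn_iff_contDiffOn.1 h3

/-- The function `v ↦ ⟨τ, v⟩` on the total space. -/
def fiberCoord (τ : ∀ x, V x) (v : TotalSpace Plane V) : ℝ := inner ℝ (τ v.proj) v.2

theorem contMDiff_fiberCoord {τ : ∀ x, V x}
    (hτ : ContMDiff 𝓘(ℝ, EM) (𝓘(ℝ, EM).prod 𝓘(ℝ, Plane)) ∞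
      (fun x => (⟨x, τ x⟩ : TotalSpace Plane V))) :
    ContMDiff (𝓘(ℝ, EM).prod 𝓘(ℝ, Plane)) 𝓘(ℝ, ℝ) ∞ (fiberCoord τ) := by
  have h1 : ContMDiff (𝓘(ℝ, EM).prod 𝓘(ℝ, Plane)) (𝓘(ℝ, EM).prod 𝓘(ℝ, Plane)) ∞
      (fun v : TotalSpace Plane V => (⟨v.proj, τ v.proj⟩ : TotalSpace Plane V)) :=
    hτ.comp (contMDiff_proj V)
  exact h1.inner_bundle contMDiff_id

theorem CovariantDerivative.apply_smul_add_smul (cov : CovariantDerivative 𝓘(ℝ, EM) Plane V)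
    {σ τ : ∀ x, V x} {x : M} {f g : M → ℝ}
    (hσ : MDifferentiableAt 𝓘(ℝ, EM) (𝓘(ℝ, EM).prod 𝓘(ℝ, Plane))
      (fun x => (⟨x, σ x⟩ : TotalSpace Plane V)) x)
    (hτ : MDifferentiableAt 𝓘(ℝ, EM) (𝓘(ℝ, EM).prod 𝓘(ℝ, Plane))
      (fun x => (⟨x, τ x⟩ : TotalSpace Plane V)) x)
    (hf : MDifferentiableAt 𝓘(ℝ, EM) 𝓘(ℝ, ℝ) f x) (hg : MDifferentiableAt 𝓘(ℝ, EM) 𝓘(ℝ, ℝ) g x)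
    (u : TangentSpace 𝓘(ℝ, EM) x) :
    cov (f • σ + g • τ) x u = f x • cov σ x u + mvfderiv 𝓘(ℝ, EM) f x u • σ x +
      (g x • cov τ x u + mvfderiv 𝓘(ℝ, EM) g x u • τ x) := by
  rw [cov.isCovariantDerivativeOnUniv.add (hf.smul_section hσ) (hg.smul_section hτ),
    cov.isCovariantDerivativeOnUniv.leibniz hσ hf, cov.isCovariantDerivativeOnUniv.leibniz hτ hg]
  rfl

/-- The components of the connection form in an oriented orthonormal frame. -/
theorem fiberCoord_connectionForm [FiniteDimensional ℝ EM]
    (cov : CovariantDerivative 𝓘(ℝ, EM) Plane V)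
    [CovariantDerivative.ContMDiffCovariantDerivative cov ∞]
    {o : ∀ x, Orientation ℝ (V x) (Fin 2)} {E : Fin 2 → ∀ x, V x}
    (hE : ∀ i, ContMDiff 𝓘(ℝ, EM) (𝓘(ℝ, EM).prod 𝓘(ℝ, Plane)) ∞
        (fun x => (⟨x, E i x⟩ : TotalSpace Plane V))) {x : M}
    (ho : ∀ᶠ y in 𝓝 x, IsOrientedFrameAt o E y) (v : V x) (X : EM × Plane) (k : Fin 2) :
    inner ℝ (E k x) (connectionForm cov ⟨x, v⟩ X) =
      (mvfderiv (𝓘(ℝ, EM).prod 𝓘(ℝ, Plane)) (fiberCoord (E k)) (⟨x, v⟩ : TotalSpace Plane V) :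
        EM × Plane →L[ℝ] ℝ) X +
      (inner ℝ (E 0 x) v * connectionCoeff cov (hE k) (hE 0) x
        (mfderiv (𝓘(ℝ, EM).prod 𝓘(ℝ, Plane)) 𝓘(ℝ, EM) (π Plane V) (⟨x, v⟩ : TotalSpace Plane V) X) +
      inner ℝ (E 1 x) v * connectionCoeff cov (hE k) (hE 1) x
        (mfderiv (𝓘(ℝ, EM).prod 𝓘(ℝ, Plane)) 𝓘(ℝ, EM) (π Plane V) (⟨x, v⟩ : TotalSpace Plane V) X)) := by
  set p : TotalSpace Plane V := ⟨x, v⟩ with hp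
  set a : ℝ := inner ℝ (E 0 x) v with ha
  set b : ℝ := inner ℝ (E 1 x) v with hb
  have hv : v = a • E 0 x + b • E 1 x := ho.self_of_nhds.sum_eq v
  obtain ⟨Q, hQ⟩ : ∃ Q : EM × Plane →L[ℝ] EM, Q = mfderiv (𝓘(ℝ, EM).prod 𝓘(ℝ, Plane)) 𝓘(ℝ, EM)
    (π Plane V) p := ⟨_, rfl⟩
  obtain ⟨C, hC⟩ : ∃ C : EM × Plane →L[ℝ] V x, C = connectionForm cov p := ⟨_, rfl⟩
  obtain ⟨Y, hY⟩ : ∃ Y : EM × Plane →L[ℝ] ℝ, Y = mvfderiv (𝓘(ℝ, EM).prod 𝓘(ℝ, Plane))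
    (fiberCoord (E k)) p := ⟨_, rfl⟩
  obtain ⟨I, hI⟩ : ∃ I : V x →L[ℝ] EM × Plane, I = mfderiv 𝓘(ℝ, V x) (𝓘(ℝ, EM).prod 𝓘(ℝ, Plane))
        (fun u : V x => (⟨x, u⟩ : TotalSpace Plane V)) v := ⟨_, rfl⟩
  -- the section through `v` with constant coefficients
  let σ : ∀ x, V x := (fun _ : M => a) • E 0 + (fun _ : M => b) • E 1
  have hE' (i : Fin 2) := ((hE i) x).mdifferentiableAt (by simp)
  have hca : MDifferentiableAt 𝓘(ℝ, EM) 𝓘(ℝ, ℝ) (fun _ : M => a) x := mdifferentiableAt_const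
  have hcb : MDifferentiableAt 𝓘(ℝ, EM) 𝓘(ℝ, ℝ) (fun _ : M => b) x := mdifferentiableAt_const
  have hσ : MDifferentiableAt 𝓘(ℝ, EM) (𝓘(ℝ, EM).prod 𝓘(ℝ, Plane))
      (fun x => (⟨x, σ x⟩ : TotalSpace Plane V)) x :=
    mdifferentiableAt_add_section (hca.smul_section (hE' 0)) (hcb.smul_section (hE' 1))
  have hσx : σ x = v := hv.symm
  have hσp : (⟨x, σ x⟩ : TotalSpace Plane V) = p := by rw [hσx]
  have hcovσ (u : EM) : (cov σ x : EM →L[ℝ] V x) u = a • (cov (E 0) x : EM →L[ℝ] V x) u +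
      b • (cov (E 1) x : EM →L[ℝ] V x) u := by
    have h := cov.apply_smul_add_smul (hE' 0) (hE' 1) hca hcb u
    rw [mvfderiv_const, mvfderiv_const] at h
    refine h.trans ?_
    change a • _ + (0 : ℝ) • _ + (b • _ + (0 : ℝ) • _) = _
    rw [zero_smul, zero_smul, add_zero, add_zero]
  obtain ⟨S, hS⟩ : ∃ S : EM →L[ℝ] EM × Plane, S = mfderiv 𝓘(ℝ, EM) (𝓘(ℝ, EM).prod 𝓘(ℝ, Plane))
        (fun y => (⟨y, σ y⟩ : TotalSpace Plane V)) x := ⟨_, rfl⟩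
  have hsm : HasMFDerivAt 𝓘(ℝ, EM) (𝓘(ℝ, EM).prod 𝓘(ℝ, Plane))
        (fun y => (⟨y, σ y⟩ : TotalSpace Plane V)) x S := by
    rw [hS]
    exact hσ.hasMFDerivAt
  have him := hasMFDerivAt_fiber_inclusion (EM := EM) v
  have hQS (u : EM) : Q (S u) = u := by
    have h1 := (mdifferentiableAt_proj (IB := 𝓘(ℝ, EM)) V (p := p)).hasMFDerivAt
    rw [← hσp] at h1
    have h2 := hasMFDerivAt_unique (h1.comp x hsm) (hasMFDerivAt_id x)
    rw [hσp, ← hQ] at h2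
    exact congrArg (fun A : EM →L[ℝ] EM => A u) h2
  have hQI (w : V x) : Q (I w) = 0 := by
    have h1 := hasMFDerivAt_unique ((mdifferentiableAt_proj (IB := 𝓘(ℝ, EM)) V
      (p := p)).hasMFDerivAt.comp v him) (hasMFDerivAt_const x v)
    rw [hI, hQ]
    exact congrArg (fun A : V x →L[ℝ] EM => A w) h1
  have hym : MDifferentiableAt (𝓘(ℝ, EM).prod 𝓘(ℝ, Plane)) 𝓘(ℝ, ℝ) (fiberCoord (E k)) p :=
    (contMDiff_fiberCoord (hE k) p).mdifferentiableAt (by simp)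
  -- The coefficients of σ are constant and the frame is orthonormal near `x`, so ⟨E_k, σ⟩ is
  -- locally constant.
  have hYS (u : EM) : Y (S u) = 0 := by
    have h1 := hym.hasMFDerivAt
    rw [← hσp] at h1
    have h3 : (fun y => fiberCoord (E k) ⟨y, σ y⟩) =ᶠ[𝓝 x] fun _ => ![a, b] k := by
      filter_upwards [ho] with y hy
      have h : fiberCoord (E k) ⟨y, σ y⟩ =
          a * inner ℝ (E k y) (E 0 y) + b * inner ℝ (E k y) (E 1 y) := by
        change inner ℝ (E k y) (a • E 0 y + b • E 1 y) = _
        rw [inner_add_right, real_inner_smul_right, real_inner_smul_right]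
      rw [h]
      obtain rfl | rfl : k = 0 ∨ k = 1 := by fin_cases k <;> simp
      · rw [hy.inner_self, hy.inner_zero_one]
        simp
      · rw [hy.inner_one_zero, hy.inner_one_one]
        simp
    have h2 := hasMFDerivAt_unique
      (HasMFDerivAt.comp (g := fiberCoord (E k)) (f := fun y => (⟨y, σ y⟩ : TotalSpace Plane V))
        x h1 hsm)
      ((hasMFDerivAt_const (![a, b] k) x).congr_of_eventuallyEq h3)
    rw [hσp] at h2
    rw [hY]
    exact congrArg (fun A : EM →L[ℝ] ℝ => A u) h2
  have hYI (w : V x) : Y (I w) = inner ℝ (E k x) w := by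
    have h1 := hasMFDerivAt_unique (hym.hasMFDerivAt.comp v him)
      (innerSL ℝ (E k x)).hasFDerivAt.hasMFDerivAt
    rw [hI, hY]
    exact congrArg (fun A : V x →L[ℝ] ℝ => A w) h1
  have hCI (w : V x) : C (I w) = w := by
    rw [hI, hC]
    exact connectionForm_vertical cov v w
  have hCS (u : EM) : C (S u) = a • (cov (E 0) x : EM →L[ℝ] V x) u +
      b • (cov (E 1) x : EM →L[ℝ] V x) u := by
    rw [← hcovσ]
    have h1 := connectionForm_section cov hσ u
    have h2 : ∀ v' : V x, v' = v → ∀ Z : EM × Plane,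
        (connectionForm cov (⟨x, v'⟩ : TotalSpace Plane V) : EM × Plane →L[ℝ] V x) Z =
        (connectionForm cov p : EM × Plane →L[ℝ] V x) Z := by
      rintro _ rfl Z
      rfl
    rw [hC, hS]
    exact (h2 _ hσx _).symm.trans h1
  -- Every tangent vector is a velocity of σ plus a vertical vector. On the first the connection
  -- form is ∇σ, on the second it is the identity.
  obtain ⟨w, hw⟩ := exists_mfderiv_fiber_eq (EM := EM) v (X - S (Q X)) (by
    have h : Q (X - S (Q X)) = 0 := by rw [map_sub, hQS, sub_self]
    rw [hQ] at h ⊢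
    exact h)
  have hw' : X = S (Q X) + I w := by
    have : I w = X - S (Q X) := by rw [hI]; exact hw
    rw [this]
    abel
  have key : inner ℝ (E k x) (C X) = Y X + (a * inner ℝ (E k x) ((cov (E 0) x : EM →L[ℝ] V x) (Q X)) +
      b * inner ℝ (E k x) ((cov (E 1) x : EM →L[ℝ] V x) (Q X))) := by
    have h1 : C X = a • (cov (E 0) x : EM →L[ℝ] V x) (Q X) +
      b • (cov (E 1) x : EM →L[ℝ] V x) (Q X) + w := by
      conv_lhs => rw [hw']
      rw [map_add, hCS, hCI]
    have h2 : Y X = inner ℝ (E k x) w := by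
      conv_lhs => rw [hw']
      rw [map_add, hYS, hYI, zero_add]
    rw [h1, h2, inner_add_right, inner_add_right, real_inner_smul_right, real_inner_smul_right]
    ring
  rw [hC, hY, hQ] at key
  exact key

end ConnectionCoefficients

/-! ### The local expression of α in the slope coordinate. -/

section InducedForm

variable {EM : Type*} [NormedAddCommGroup EM] [NormedSpace ℝ EM]
  {M : Type*} [TopologicalSpace M] [ChartedSpace EM M]
  {V : M → Type*} [TopologicalSpace (TotalSpace Plane V)]
  [∀ x, NormedAddCommGroup (V x)] [∀ x, InnerProductSpace ℝ (V x)]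
  [FiberBundle Plane V] [VectorBundle ℝ Plane V]

/-- The coordinates `w ↦ (⟨E₀, w⟩, ⟨E₁, w⟩)` of a pair of sections. -/
def frameMap (E : Fin 2 → ∀ x, V x) (x : M) : V x →ₗ[ℝ] Plane :=
  (WithLp.linearEquiv 2 ℝ (Fin 2 → ℝ)).symm.toLinearMap ∘ₗ
    LinearMap.pi fun i => (innerSL ℝ (E i x)).toLinearMap

/-- The affine coordinate `[w] ↦ ⟨E₁, w⟩ / ⟨E₀, w⟩` on `P(V)`. -/
def frameSlope (E : Fin 2 → ∀ x, V x) (q : ProjBundle V) : ℝ :=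
  lineCoord (frameMap E q.proj) 0 q.line

/-- The domain of the affine coordinate of a frame. -/
def frameDomain (E : Fin 2 → ∀ x, V x) : Set (ProjBundle V) :=
  {q | q.line ∈ lineDomain (frameMap E q.proj) 0}

theorem frameSlope_toProj (E : Fin 2 → ∀ x, V x) {v : TotalSpace Plane V} (hv : v.2 ≠ 0) :
    frameSlope E (toProj v) = fiberCoord (E 1) v / fiberCoord (E 0) v := by
  have := nontrivial_fiber V v.proj
  exact lineCoord_lineOf (frameMap E v.proj) 0 hv

theorem toProj_mem_frameDomain (E : Fin 2 → ∀ x, V x) {v : TotalSpace Plane V} (hv : v.2 ≠ 0) :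
    toProj v ∈ frameDomain E ↔ fiberCoord (E 0) v ≠ 0 := by
  have := nontrivial_fiber V v.proj
  exact lineOf_mem_lineDomain (frameMap E v.proj) 0 hv

theorem fiberCoord_eq_zero (τ : ∀ x, V x) {v : TotalSpace Plane V} (hv : v.2 = 0) :
    fiberCoord τ v = 0 := by
  rw [fiberCoord, hv, inner_zero_right]

variable [IsManifold 𝓘(ℝ, EM) ∞ M] [ContMDiffVectorBundle ∞ Plane V 𝓘(ℝ, EM)]

/-- The preferred charts of P(V) are fibred over those of M, so the bundle projection is the first
coordinate projection. -/
theorem ProjBundle.proj_chartAt_symm (q : ProjBundle V) {y : EM × ℝ}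
    (hy : y ∈ (chartAt (EM × ℝ) q).target) :
    ((chartAt (EM × ℝ) q).symm y).proj = (chartAt EM q.proj).symm y.1 ∧
      y.1 ∈ (chartAt EM q.proj).target := by
  obtain ⟨i, hi⟩ := ProjBundle.exists_chartAt_eq (EM := EM) q
  rw [hi] at hy ⊢
  exact ⟨(trivializationAt Plane V q.proj).proj_symm_apply' hy.2, hy.1⟩

theorem ProjBundle.chartAt_fst (q : ProjBundle V) :
    (chartAt (EM × ℝ) q q).1 = chartAt EM q.proj q.proj := by
  obtain ⟨i, hi⟩ := ProjBundle.exists_chartAt_eq (EM := EM) q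
  rw [hi]
  rfl

/-- The differential of the bundle projection `P(V) → M` in the preferred charts. -/
theorem ProjBundle.mfderiv_proj_comp_chartAt_symm (q : ProjBundle V) {y : EM × ℝ}
    (hy : y ∈ (chartAt (EM × ℝ) q).target) :
    (mfderiv 𝓘(ℝ, EM × ℝ) 𝓘(ℝ, EM) (ProjBundle.proj : ProjBundle V → M)
      ((chartAt (EM × ℝ) q).symm y) : EM × ℝ →L[ℝ] EM).comp
      (mfderiv 𝓘(ℝ, EM × ℝ) 𝓘(ℝ, EM × ℝ) (chartAt (EM × ℝ) q).symm y : EM × ℝ →L[ℝ] EM × ℝ) =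
    (mfderiv 𝓘(ℝ, EM) 𝓘(ℝ, EM) (chartAt EM q.proj).symm y.1 : EM →L[ℝ] EM).comp
      (ContinuousLinearMap.fst ℝ EM ℝ) := by
  have h1 := HasMFDerivAt.comp (g := (ProjBundle.proj : ProjBundle V → M))
    (f := (chartAt (EM × ℝ) q).symm) y
    ((contMDiff_projBundle_proj (EM := EM) _).mdifferentiableAt (by simp)).hasMFDerivAt
    (mdifferentiableAt_chartAt_symm q hy).hasMFDerivAt
  have h2 : HasMFDerivAt 𝓘(ℝ, EM × ℝ) 𝓘(ℝ, EM) (Prod.fst : EM × ℝ → EM) y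
      (ContinuousLinearMap.fst ℝ EM ℝ) := (ContinuousLinearMap.fst ℝ EM ℝ).hasFDerivAt.hasMFDerivAt
  have h3 := HasMFDerivAt.comp (g := (chartAt EM q.proj).symm) (f := (Prod.fst : EM × ℝ → EM)) y
    (mdifferentiableAt_chartAt_symm q.proj (ProjBundle.proj_chartAt_symm q hy).2).hasMFDerivAt h2
  refine hasMFDerivAt_unique h1 (h3.congr_of_eventuallyEq ?_)
  filter_upwards [(chartAt (EM × ℝ) q).open_target.mem_nhds hy] with y' hy'
  exact (ProjBundle.proj_chartAt_symm q hy').1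

/-- The differential of the bundle projection `P(V) → M` at the base point of the preferred
charts. -/
theorem ProjBundle.mfderiv_proj (q : ProjBundle V) :
    mfderiv 𝓘(ℝ, EM × ℝ) 𝓘(ℝ, EM) (ProjBundle.proj : ProjBundle V → M) q =
      ContinuousLinearMap.fst ℝ EM ℝ := by
  have h1 := ProjBundle.mfderiv_proj_comp_chartAt_symm q (mem_chart_target (EM × ℝ) q)
  rw [ProjBundle.chartAt_fst, mfderiv_chartAt_symm_self, mfderiv_chartAt_symm_self] at h1
  have h2 : ∀ q' : ProjBundle V, q' = q →
      (mfderiv 𝓘(ℝ, EM × ℝ) 𝓘(ℝ, EM) (ProjBundle.proj : ProjBundle V → M) q' :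
        EM × ℝ →L[ℝ] EM) =
      (mfderiv 𝓘(ℝ, EM × ℝ) 𝓘(ℝ, EM) (ProjBundle.proj : ProjBundle V → M) q :
        EM × ℝ →L[ℝ] EM) := by
    rintro _ rfl
    rfl
  exact (h2 _ ((chartAt (EM × ℝ) q).left_inv (mem_chart_source _ q))).symm.trans h1

/-- The pull-back of a 1-form under `P(V) → M`, as a field of covectors. -/
def projPullback (A : OneForm EM M) (q : ProjBundle V) : EM × ℝ →L[ℝ] ℝ :=
  (A q.proj : EM →L[ℝ] ℝ).comp
    (mfderiv 𝓘(ℝ, EM × ℝ) 𝓘(ℝ, EM) (ProjBundle.proj : ProjBundle V → M) q : EM × ℝ →L[ℝ] EM)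

/-- Since the bundle projection is the first coordinate projection in the preferred charts, a
pulled-back form has coefficients depending on the base coordinates alone. -/
theorem covectorInChart_projPullback (A : OneForm EM M) (q : ProjBundle V) {y : EM × ℝ}
    (hy : y ∈ (chartAt (EM × ℝ) q).target) :
    covectorInChart (E := EM × ℝ) (N := ProjBundle V) (fun p => projPullback A p) q y =
      (A.inChart q.proj y.1).comp (ContinuousLinearMap.fst ℝ EM ℝ) := by
  have h1 := ProjBundle.mfderiv_proj_comp_chartAt_symm q hy
  have h2 : ∀ x : M, x = (chartAt EM q.proj).symm y.1 → (A x : EM →L[ℝ] ℝ) =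
      (A ((chartAt EM q.proj).symm y.1) : EM →L[ℝ] ℝ) := by
    rintro _ rfl
    rfl
  have h3 := h2 _ (ProjBundle.proj_chartAt_symm q hy).1
  exact congrArg₂ (fun (a : EM →L[ℝ] ℝ) (b : EM × ℝ →L[ℝ] EM) => a.comp b) h3 h1

/-- Along a local lift to V ∖ 0 the slope is a quotient of two smooth fibre coordinates, and the
denominator stays nonzero nearby. -/
theorem contMDiffAt_frameSlope [IsContMDiffRiemannianBundle 𝓘(ℝ, EM) ∞ Plane V]
    {E : Fin 2 → ∀ x, V x}
    (hE : ∀ i, ContMDiff 𝓘(ℝ, EM) (𝓘(ℝ, EM).prod 𝓘(ℝ, Plane)) ∞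
        (fun x => (⟨x, E i x⟩ : TotalSpace Plane V))) {q : ProjBundle V} (hq : q ∈ frameDomain E) :
    ContMDiffAt 𝓘(ℝ, EM × ℝ) 𝓘(ℝ, ℝ) ∞ (frameSlope E) q ∧ frameDomain E ∈ 𝓝 q := by
  obtain ⟨v, hv, rfl⟩ := exists_toProj q
  have h0 := (toProj_mem_frameDomain E hv).1 hq
  obtain ⟨s, hs, hsv, hsq⟩ := exists_contMDiffAt_lift (EM := EM) hv
  have h1 (i : Fin 2) : ContMDiffAt 𝓘(ℝ, EM × ℝ) 𝓘(ℝ, ℝ) ∞ (fun q => fiberCoord (E i) (s q))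
      (toProj v) := (contMDiff_fiberCoord (hE i) (s (toProj v))).comp (toProj v) hs
  have h2 : fiberCoord (E 0) (s (toProj v)) ≠ 0 := by rwa [hsv]
  constructor
  · refine ((h1 1).div₀ (h1 0) h2).congr_of_eventuallyEq (hsq.mono fun q hq => ?_)
    conv_lhs => rw [← hq.2]
    exact frameSlope_toProj E hq.1
  · filter_upwards [hsq, (h1 0).continuousAt.eventually_ne h2] with q hq hq'
    rw [← hq.2]
    exact (toProj_mem_frameDomain E hq.1).2 hq'

variable [FiniteDimensional ℝ EM] [IsContMDiffRiemannianBundle 𝓘(ℝ, EM) ∞ Plane V]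
  (cov : CovariantDerivative 𝓘(ℝ, EM) Plane V)
  [CovariantDerivative.ContMDiffCovariantDerivative cov ∞] {E : Fin 2 → ∀ x, V x}
  (hE : ∀ i, ContMDiff 𝓘(ℝ, EM) (𝓘(ℝ, EM).prod 𝓘(ℝ, Plane)) ∞
    (fun x => (⟨x, E i x⟩ : TotalSpace Plane V)))

/-- The form induced on `P(V)` by the angular form, written in a frame, in terms of the slope `z`
and the components of the connection. -/
def inducedForm (q : ProjBundle V) : EM × ℝ →L[ℝ] ℝ :=
  let dz : EM × ℝ →L[ℝ] ℝ := mvfderiv 𝓘(ℝ, EM × ℝ) (frameSlope E) q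
  (1 / (2 * (1 + frameSlope E q ^ 2))) •
    (dz + (projPullback (connectionCoeff cov (hE 1) (hE 0)) q +
        frameSlope E q • projPullback (connectionCoeff cov (hE 1) (hE 1)) q -
        frameSlope E q • projPullback (connectionCoeff cov (hE 0) (hE 0)) q -
        frameSlope E q ^ 2 • projPullback (connectionCoeff cov (hE 0) (hE 1)) q))

theorem inducedForm_apply (q : ProjBundle V) (W : EM × ℝ) :
    inducedForm cov hE q W = 1 / (2 * (1 + frameSlope E q ^ 2)) *
    ((mvfderiv 𝓘(ℝ, EM × ℝ) (frameSlope E) q : EM × ℝ →L[ℝ] ℝ) W +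
      (projPullback (connectionCoeff cov (hE 1) (hE 0)) q W +
        frameSlope E q * projPullback (connectionCoeff cov (hE 1) (hE 1)) q W -
        frameSlope E q * projPullback (connectionCoeff cov (hE 0) (hE 0)) q W -
        frameSlope E q ^ 2 * projPullback (connectionCoeff cov (hE 0) (hE 1)) q W)) := rfl

/-- This replaces intrinsic differentials by ordinary derivatives in one chart, which makes
smoothness visible and allows the exterior derivative to be computed. It holds near the base point,
where the slope is smooth. -/
theorem covectorInChart_inducedForm {q : ProjBundle V} (hq : q ∈ frameDomain E) :
    ∀ᶠ y in 𝓝 (chartAt (EM × ℝ) q q),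
      covectorInChart (E := EM × ℝ) (N := ProjBundle V) (fun p => inducedForm cov hE p) q y =
      (1 / (2 * (1 + frameSlope E ((chartAt (EM × ℝ) q).symm y) ^ 2))) •
      (fderiv ℝ (frameSlope E ∘ (chartAt (EM × ℝ) q).symm) y +
      (((connectionCoeff cov (hE 1) (hE 0)).inChart q.proj y.1).comp
          (ContinuousLinearMap.fst ℝ EM ℝ) +
        frameSlope E ((chartAt (EM × ℝ) q).symm y) •
          ((connectionCoeff cov (hE 1) (hE 1)).inChart q.proj y.1).comp
            (ContinuousLinearMap.fst ℝ EM ℝ) -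
        frameSlope E ((chartAt (EM × ℝ) q).symm y) •
          ((connectionCoeff cov (hE 0) (hE 0)).inChart q.proj y.1).comp
            (ContinuousLinearMap.fst ℝ EM ℝ) -
        frameSlope E ((chartAt (EM × ℝ) q).symm y) ^ 2 •
          ((connectionCoeff cov (hE 0) (hE 1)).inChart q.proj y.1).comp
            (ContinuousLinearMap.fst ℝ EM ℝ))) := by
  set c := chartAt (EM × ℝ) q with hc
  have hcq : c.symm (c q) = q := c.left_inv (mem_chart_source _ q)
  have hcont : ContinuousAt c.symm (c q) :=
    c.continuousAt_symm (mem_chart_target _ q)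
  have hD : ∀ᶠ y in 𝓝 (c q), c.symm y ∈ frameDomain E :=
    hcont.eventually (by rw [hcq]; exact (contMDiffAt_frameSlope hE hq).2)
  filter_upwards [hD, c.open_target.mem_nhds (mem_chart_target _ q)] with y hy hyt
  obtain ⟨Z, hZ⟩ : ∃ Z : EM × ℝ →L[ℝ] ℝ,
    Z = mvfderiv 𝓘(ℝ, EM × ℝ) (frameSlope E) (c.symm y) := ⟨_, rfl⟩
  obtain ⟨T, hT⟩ : ∃ T : EM × ℝ →L[ℝ] EM × ℝ,
    T = mfderiv 𝓘(ℝ, EM × ℝ) 𝓘(ℝ, EM × ℝ) c.symm y := ⟨_, rfl⟩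
  have hZm : HasMFDerivAt 𝓘(ℝ, EM × ℝ) 𝓘(ℝ, ℝ) (frameSlope E) (c.symm y) Z := by
    rw [hZ]
    exact ((contMDiffAt_frameSlope hE hy).1.mdifferentiableAt (by simp)).hasMFDerivAt
  have hTm : HasMFDerivAt 𝓘(ℝ, EM × ℝ) 𝓘(ℝ, EM × ℝ) c.symm y T := by
    rw [hT]
    exact (mdifferentiableAt_chartAt_symm q hyt).hasMFDerivAt
  have h1 : HasFDerivAt (frameSlope E ∘ c.symm) (Z.comp T) y :=
    hasMFDerivAt_iff_hasFDerivAt.1 (HasMFDerivAt.comp (g := frameSlope E) (f := c.symm) y hZm hTm)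
  rw [← covectorInChart_projPullback _ q hyt, ← covectorInChart_projPullback _ q hyt,
    ← covectorInChart_projPullback _ q hyt, ← covectorInChart_projPullback _ q hyt, h1.fderiv, hZ, hT]
  rfl

theorem contDiffAt_inducedForm {q : ProjBundle V} (hq : q ∈ frameDomain E) :
    ContDiffAt ℝ ∞ (covectorInChart (E := EM × ℝ) (N := ProjBundle V)
      (fun p => inducedForm cov hE p) q) (chartAt (EM × ℝ) q q) := by
  have hcq : (chartAt (EM × ℝ) q).symm (chartAt (EM × ℝ) q q) = q :=
    (chartAt (EM × ℝ) q).left_inv (mem_chart_source _ q)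
  have hz : ContDiffAt ℝ ∞ (frameSlope E ∘ (chartAt (EM × ℝ) q).symm) (chartAt (EM × ℝ) q q) := by
    refine contMDiffAt_iff_contDiffAt.1 (ContMDiffAt.comp (I' := 𝓘(ℝ, EM × ℝ)) _ ?_
      ((contMDiffOn_chart_symm (I := 𝓘(ℝ, EM × ℝ)) (n := ∞) (x := q)).contMDiffAt
        ((chartAt (EM × ℝ) q).open_target.mem_nhds (mem_chart_target _ q))))
    rw [hcq]
    exact (contMDiffAt_frameSlope hE hq).1
  have hA (A : OneForm EM M) : ContDiffAt ℝ ∞ (fun y : EM × ℝ => (A.inChart q.proj y.1).comp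
      (ContinuousLinearMap.fst ℝ EM ℝ)) (chartAt (EM × ℝ) q q) := by
    have h1 : ContDiffAt ℝ ∞ (A.inChart q.proj) (chartAt (EM × ℝ) q q).1 := by
      rw [ProjBundle.chartAt_fst]
      exact (A.contDiffOn_inChart q.proj).contDiffAt
        ((chartAt EM q.proj).open_target.mem_nhds (mem_chart_target EM q.proj))
    exact (h1.comp _ contDiffAt_fst).clm_comp contDiffAt_const
  refine ContDiffAt.congr_of_eventuallyEq ?_ (covectorInChart_inducedForm cov hE hq)
  have hz' : ContDiffAt ℝ ∞ (fun y => frameSlope E ((chartAt (EM × ℝ) q).symm y))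
    (chartAt (EM × ℝ) q q) := hz
  have hc : ContDiffAt ℝ ∞
      (fun y => 1 / (2 * (1 + frameSlope E ((chartAt (EM × ℝ) q).symm y) ^ 2)))
      (chartAt (EM × ℝ) q q) :=
    contDiffAt_const.div (contDiffAt_const.mul (contDiffAt_const.add (hz'.pow 2))) (by positivity)
  exact hc.smul ((hz.fderiv_right (m := ∞) (by simp)).add
    ((((hA (connectionCoeff cov (hE 1) (hE 0))).add
      (hz'.smul (hA (connectionCoeff cov (hE 1) (hE 1))))).sub
      (hz'.smul (hA (connectionCoeff cov (hE 0) (hE 0))))).sub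
      ((hz'.pow 2).smul (hA (connectionCoeff cov (hE 0) (hE 1))))))

/-- The quotient rule for z = b/a, together with the components of ω in the frame; numerator and
denominator of α̂ are divided by a². -/
theorem inducedForm_mfderiv_toProj {o : ∀ x, Orientation ℝ (V x) (Fin 2)}
    {v : TotalSpace Plane V} (ho : ∀ᶠ x in 𝓝 v.proj, IsOrientedFrameAt o E x)
    (h0 : fiberCoord (E 0) v ≠ 0) (X : EM × Plane) :
    inducedForm cov hE (toProj v)
      ((mfderiv (𝓘(ℝ, EM).prod 𝓘(ℝ, Plane)) 𝓘(ℝ, EM × ℝ) (toProj : _ → ProjBundle V) v :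
        EM × Plane →L[ℝ] EM × ℝ) X) = alphaHat cov o v X := by
  have hv : v.2 ≠ 0 := fun h => h0 (fiberCoord_eq_zero _ h)
  obtain ⟨T, hT⟩ : ∃ T : EM × Plane →L[ℝ] EM × ℝ,
    T = mfderiv (𝓘(ℝ, EM).prod 𝓘(ℝ, Plane)) 𝓘(ℝ, EM × ℝ) (toProj : _ → ProjBundle V) v := ⟨_, rfl⟩
  have hTm : HasMFDerivAt (𝓘(ℝ, EM).prod 𝓘(ℝ, Plane)) 𝓘(ℝ, EM × ℝ)
      (toProj : _ → ProjBundle V) v T := by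
    rw [hT]
    exact (mdifferentiableAt_toProj hv).hasMFDerivAt
  obtain ⟨P, hP⟩ : ∃ P : EM × Plane →L[ℝ] EM,
    P = mfderiv (𝓘(ℝ, EM).prod 𝓘(ℝ, Plane)) 𝓘(ℝ, EM) (π Plane V) v := ⟨_, rfl⟩
  obtain ⟨Y, hY⟩ : ∃ Y : Fin 2 → (EM × Plane →L[ℝ] ℝ), ∀ k, Y k =
    mvfderiv (𝓘(ℝ, EM).prod 𝓘(ℝ, Plane)) (fiberCoord (E k)) v := ⟨_, fun _ => rfl⟩
  have hYm (k : Fin 2) : HasMFDerivAt (𝓘(ℝ, EM).prod 𝓘(ℝ, Plane)) 𝓘(ℝ, ℝ)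
      (fiberCoord (E k)) v (Y k) := by
    rw [hY]
    exact ((contMDiff_fiberCoord (hE k) v).mdifferentiableAt (by simp)).hasMFDerivAt
  have hPA (A : OneForm EM M) : projPullback A (toProj v) (T X) = (A v.proj : EM →L[ℝ] ℝ) (P X) := by
    have h1 := HasMFDerivAt.comp (g := (ProjBundle.proj : ProjBundle V → M)) (f := toProj) v
      ((contMDiff_projBundle_proj (EM := EM) _).mdifferentiableAt (by simp)).hasMFDerivAt hTm
    have h2 := hasMFDerivAt_unique h1 (mdifferentiableAt_proj (IB := 𝓘(ℝ, EM)) V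
      (p := v)).hasMFDerivAt
    rw [hP]
    exact congrArg (fun B : EM × Plane →L[ℝ] EM => (A v.proj : EM →L[ℝ] ℝ) (B X)) h2
  set a := fiberCoord (E 0) v with ha
  set b := fiberCoord (E 1) v with hb
  have hz : (mvfderiv 𝓘(ℝ, EM × ℝ) (frameSlope E) (toProj v) : EM × ℝ →L[ℝ] ℝ) (T X) =
      (a * Y 1 X - b * Y 0 X) / a ^ 2 := by
    have h1 := HasMFDerivAt.comp (g := frameSlope E) (f := toProj) v
      ((contMDiffAt_frameSlope hE ((toProj_mem_frameDomain E hv).2 h0)).1.mdifferentiableAt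
        (by simp)).hasMFDerivAt hTm
    have h2 : HasMFDerivAt (𝓘(ℝ, EM).prod 𝓘(ℝ, Plane)) 𝓘(ℝ, ℝ)
        (fun w => fiberCoord (E 1) w * (fiberCoord (E 0) w)⁻¹) v
        (b • (-(a ^ 2)⁻¹ • Y 0) + a⁻¹ • Y 1) := by
      have h3 : HasMFDerivAt (𝓘(ℝ, EM).prod 𝓘(ℝ, Plane)) 𝓘(ℝ, ℝ)
          (fun w => (fiberCoord (E 0) w)⁻¹) v (-(a ^ 2)⁻¹ • Y 0) := by
        have h4 := HasMFDerivAt.comp (g := fun r : ℝ => r⁻¹) (f := fiberCoord (E 0)) v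
          (hasDerivAt_inv h0).hasFDerivAt.hasMFDerivAt (hYm 0)
        refine h4.congr_mfderiv ?_
        refine ContinuousLinearMap.ext fun W => ?_
        exact mul_comm (Y 0 W) _
      exact (hYm 1).mul h3
    have h5 := hasMFDerivAt_unique h1 (h2.congr_of_eventuallyEq (by
      have hne := (contMDiff_fiberCoord (hE 0) v).continuousAt.eventually_ne h0
      filter_upwards [hne] with w hw
      have hw0 : w.2 ≠ 0 := fun h => hw (fiberCoord_eq_zero _ h)
      exact (frameSlope_toProj E hw0).trans (div_eq_mul_inv _ _)))
    refine (congrArg (fun B : EM × Plane →L[ℝ] ℝ => B X) h5).trans ?_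
    change b * (-(a ^ 2)⁻¹ * Y 0 X) + a⁻¹ * Y 1 X = _
    field_simp
    ring
  have hω (k : Fin 2) : inner ℝ (E k v.proj) (connectionForm cov v X) = Y k X +
      (a * connectionCoeff cov (hE k) (hE 0) v.proj (P X) +
      b * connectionCoeff cov (hE k) (hE 1) v.proj (P X)) := by
    have h := fiberCoord_connectionForm cov hE ho v.2 X k
    rw [hY, hP]
    exact h
  have hα : alphaHat cov o v X = 1 / (2 * inner ℝ v.2 v.2) *
    areaForm o v.proj v.2 (connectionForm cov v X) := rfl
  rw [← hT, hα, ho.self_of_nhds.areaForm_eq, ho.self_of_nhds.inner_eq, hω, hω]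
  -- In the frame, g(v, v) = a² + b² and θ(v, ω) = aω₁ − bω₀.
  change _ = 1 / (2 * (a * a + b * b)) * (a * _ - b * _)
  refine (inducedForm_apply cov hE (toProj v) (T X)).trans ?_
  rw [hz, hPA, hPA, hPA, hPA, frameSlope_toProj E hv, ← ha, ← hb]
  generalize (connectionCoeff cov (hE 1) (hE 0) v.proj : EM →L[ℝ] ℝ) (P X) = A10
  generalize (connectionCoeff cov (hE 0) (hE 0) v.proj : EM →L[ℝ] ℝ) (P X) = A00
  generalize (connectionCoeff cov (hE 1) (hE 1) v.proj : EM →L[ℝ] ℝ) (P X) = A11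
  generalize (connectionCoeff cov (hE 0) (hE 1) v.proj : EM →L[ℝ] ℝ) (P X) = A01
  have h1 : a ^ 2 + b ^ 2 ≠ 0 := by positivity
  rw [← sq, ← sq]
  field_simp
  ring

end InducedForm

/-! ### Gluing the local expressions. -/

section AngularForm

variable {EM : Type*} [NormedAddCommGroup EM] [NormedSpace ℝ EM]
  {M : Type*} [TopologicalSpace M] [ChartedSpace EM M]
  {V : M → Type*} [TopologicalSpace (TotalSpace Plane V)]
  [∀ x, NormedAddCommGroup (V x)] [∀ x, InnerProductSpace ℝ (V x)]
  [FiberBundle Plane V] [VectorBundle ℝ Plane V]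
  [IsManifold 𝓘(ℝ, EM) ∞ M] [ContMDiffVectorBundle ∞ Plane V 𝓘(ℝ, EM)]
  [FiniteDimensional ℝ EM] [IsContMDiffRiemannianBundle 𝓘(ℝ, EM) ∞ Plane V]
  {cov : CovariantDerivative 𝓘(ℝ, EM) Plane V}
  [CovariantDerivative.ContMDiffCovariantDerivative cov ∞]
  {o : ∀ x, Orientation ℝ (V x) (Fin 2)}

/-- A form on `P(V)` which pulls back to the angular form is given by the local expression in any
oriented orthonormal frame. -/
theorem eq_inducedForm {E : Fin 2 → ∀ x, V x}
    (hE : ∀ i, ContMDiff 𝓘(ℝ, EM) (𝓘(ℝ, EM).prod 𝓘(ℝ, Plane)) ∞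
      (fun x => (⟨x, E i x⟩ : TotalSpace Plane V))) {q : ProjBundle V} (hq : q ∈ frameDomain E)
    (hf : ∀ᶠ x in 𝓝 q.proj, IsOrientedFrameAt o E x) {L : EM × ℝ →L[ℝ] ℝ}
    (hL : ∀ v : TotalSpace Plane V, v.2 ≠ 0 → toProj v = q → ∀ X : EM × Plane,
      L ((mfderiv (𝓘(ℝ, EM).prod 𝓘(ℝ, Plane)) 𝓘(ℝ, EM × ℝ) (toProj : _ → ProjBundle V) v :
        EM × Plane →L[ℝ] EM × ℝ) X) = alphaHat cov o v X) :
    L = inducedForm cov hE q := by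
  obtain ⟨v, hv, rfl⟩ := exists_toProj q
  refine ContinuousLinearMap.ext fun W => ?_
  obtain ⟨X, hX⟩ := mfderiv_toProj_surjective (EM := EM) hv W
  have h1 := hL v hv rfl X
  have h2 := inducedForm_mfderiv_toProj cov hE hf ((toProj_mem_frameDomain E hv).1 hq) X
  have h3 := h1.trans h2.symm
  have h4 : (mfderiv (𝓘(ℝ, EM).prod 𝓘(ℝ, Plane)) 𝓘(ℝ, EM × ℝ) (toProj : _ → ProjBundle V) v :
        EM × Plane →L[ℝ] EM × ℝ) X = W := hX
  rwa [h4] at h3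

/-- The frame stays orthonormal, and its slope stays defined, at all points near `q`; uniqueness
then applies at each of them with this one frame. -/
theorem eventually_eq_inducedForm {E : Fin 2 → ∀ x, V x}
    (hE : ∀ i, ContMDiff 𝓘(ℝ, EM) (𝓘(ℝ, EM).prod 𝓘(ℝ, Plane)) ∞
      (fun x => (⟨x, E i x⟩ : TotalSpace Plane V))) {q : ProjBundle V} (hq : q ∈ frameDomain E)
    (hf : ∀ᶠ x in 𝓝 q.proj, IsOrientedFrameAt o E x) {L : ProjBundle V → EM × ℝ →L[ℝ] ℝ}
    (hL : ∀ v : TotalSpace Plane V, v.2 ≠ 0 → ∀ X : EM × Plane, L (toProj v)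
      ((mfderiv (𝓘(ℝ, EM).prod 𝓘(ℝ, Plane)) 𝓘(ℝ, EM × ℝ) (toProj : _ → ProjBundle V) v :
        EM × Plane →L[ℝ] EM × ℝ) X) = alphaHat cov o v X) :
    ∀ᶠ p in 𝓝 q, L p = inducedForm cov hE p := by
  have h1 : ∀ᶠ p in 𝓝 q, ∀ᶠ x in 𝓝 p.proj, IsOrientedFrameAt o E x :=
    ((contMDiff_projBundle_proj (EM := EM)).continuous.tendsto q).eventually hf.eventually_nhds
  filter_upwards [h1, (contMDiffAt_frameSlope hE hq).2] with p hp hp'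
  refine eq_inducedForm hE hp' hp fun v hv hvp X => ?_
  rw [← hvp]
  exact hL v hv X

theorem covectorInChart_congr {E : Type*} [NormedAddCommGroup E] [NormedSpace ℝ E]
    {N : Type*} [TopologicalSpace N] [ChartedSpace E N] [IsManifold 𝓘(ℝ, E) ∞ N]
    {L L' : N → E →L[ℝ] ℝ} {q : N} (h : ∀ᶠ p in 𝓝 q, L p = L' p) :
    covectorInChart (E := E) (N := N) (fun p => L p) q =ᶠ[𝓝 (chartAt E q q)]
      covectorInChart (E := E) (N := N) (fun p => L' p) q := by
  have h1 : ContinuousAt (chartAt E q).symm (chartAt E q q) :=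
    (chartAt E q).continuousAt_symm (mem_chart_target E q)
  have h2 : ∀ᶠ y in 𝓝 (chartAt E q q), L ((chartAt E q).symm y) = L' ((chartAt E q).symm y) :=
    h1.eventually (by rwa [(chartAt E q).left_inv (mem_chart_source E q)])
  filter_upwards [h2] with y hy
  exact congrArg (fun A : E →L[ℝ] ℝ =>
    A.comp (mfderiv 𝓘(ℝ, E) 𝓘(ℝ, E) (chartAt E q).symm y : E →L[ℝ] E)) hy

theorem exists_frame_at [T2Space M] (ho : IsBundleOrientation EM o) (q : ProjBundle V) :
    ∃ E : Fin 2 → ∀ x, V x,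
      (∀ i, ContMDiff 𝓘(ℝ, EM) (𝓘(ℝ, EM).prod 𝓘(ℝ, Plane)) ∞
        (fun x => (⟨x, E i x⟩ : TotalSpace Plane V))) ∧
      (∀ᶠ x in 𝓝 q.proj, IsOrientedFrameAt o E x) ∧ q ∈ frameDomain E := by
  obtain ⟨v, hv, rfl⟩ := exists_toProj q
  obtain ⟨E, hE, hf, h0⟩ := ho.exists_frame hv
  exact ⟨E, hE, hf, (toProj_mem_frameDomain E hv).2 h0⟩

variable (cov) in
/-- The angular form descends to `P(V)`. -/
theorem exists_oneForm_pullback_eq_alphaHat [T2Space M] (ho : IsBundleOrientation EM o) :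
    ∃ α : OneForm (EM × ℝ) (ProjBundle V), ∀ v : TotalSpace Plane V, v.2 ≠ 0 →
      ∀ X : TangentSpace (𝓘(ℝ, EM).prod 𝓘(ℝ, Plane)) v,
      α (toProj v) (mfderiv (𝓘(ℝ, EM).prod 𝓘(ℝ, Plane)) 𝓘(ℝ, EM × ℝ) toProj v X) =
        alphaHat cov o v X := by
  choose E hE hf hq using exists_frame_at (EM := EM) (V := V) ho
  -- Each point uses its own frame, so smoothness is not evident. By uniqueness `L` agrees near `q`
  -- with the expression in the single frame `E q`, which is smooth at `q`.
  let L : ProjBundle V → EM × ℝ →L[ℝ] ℝ := fun q => inducedForm cov (hE q) q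
  have hL : ∀ v : TotalSpace Plane V, v.2 ≠ 0 → ∀ X : EM × Plane, L (toProj v)
      ((mfderiv (𝓘(ℝ, EM).prod 𝓘(ℝ, Plane)) 𝓘(ℝ, EM × ℝ) (toProj : _ → ProjBundle V) v :
        EM × Plane →L[ℝ] EM × ℝ) X) = alphaHat cov o v X := fun v hv X =>
    inducedForm_mfderiv_toProj cov (hE (toProj v)) (hf (toProj v))
      ((toProj_mem_frameDomain _ hv).1 (hq (toProj v))) X
  refine ⟨OneForm.ofInChart (E := EM × ℝ) (N := ProjBundle V) (fun q => L q) fun q => ?_, hL⟩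
  exact (contDiffAt_inducedForm cov (hE q) (hq q)).congr_of_eventuallyEq
    (covectorInChart_congr (eventually_eq_inducedForm (hE q) (hq q) (hf q) hL))

end AngularForm

/-! ### The restriction to a fibre and its cohomology class. -/

section FiberRestriction

variable {EM : Type*} [NormedAddCommGroup EM] [NormedSpace ℝ EM]
  {M : Type*} [TopologicalSpace M] [ChartedSpace EM M]
  {V : M → Type*} [TopologicalSpace (TotalSpace Plane V)]
  [∀ x, NormedAddCommGroup (V x)] [∀ x, InnerProductSpace ℝ (V x)]
  [FiberBundle Plane V] [VectorBundle ℝ Plane V]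

theorem fiberParam_lineOf {x : M} (ψ : Plane ≃ₗ[ℝ] V x) {y : Plane} (hy : y ≠ 0) :
    fiberParam ψ (lineOf y) = toProj (⟨x, ψ y⟩ : TotalSpace Plane V) := by
  have := nontrivial_fiber V x
  have h : ψ y ≠ 0 := by simpa using hy
  simp only [fiberParam, toProj]
  rw [lineOf_of_ne hy, lineOf_of_ne h]
  rfl

/-- A linear isomorphism onto a fibre as a continuous linear map. -/
def planeMap {x : M} (ψ : Plane ≃ₗ[ℝ] V x) : Plane →L[ℝ] V x :=
  LinearMap.toContinuousLinearMap ψ.toLinearMap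

theorem Plane.eq_sum (y : Plane) :
    y = y 0 • EuclideanSpace.single 0 1 + y 1 • EuclideanSpace.single 1 1 := by
  ext i
  fin_cases i <;> simp

/-- An alternating bilinear form on the plane is a multiple of the determinant, with factor its
value on the standard basis. -/
theorem areaForm_map (o : ∀ x, Orientation ℝ (V x) (Fin 2)) {x : M} (ψ : Plane ≃ₗ[ℝ] V x)
    (y w : Plane) : areaForm o x (ψ y) (ψ w) =
      areaForm o x (ψ (EuclideanSpace.single 0 1)) (ψ (EuclideanSpace.single 1 1)) *
        (y 0 * w 1 - y 1 * w 0) := by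
  set u := ψ (EuclideanSpace.single 0 1)
  set u' := ψ (EuclideanSpace.single 1 1)
  have h (y : Plane) : ψ y = y 0 • u + y 1 • u' := by
    conv_lhs => rw [Plane.eq_sum y]
    rw [map_add, map_smul, map_smul]
  rw [h y, h w, areaForm_add_right, areaForm_smul_right, areaForm_smul_right, areaForm_swap o x _ u,
    areaForm_swap o x _ u', areaForm_add_right, areaForm_add_right, areaForm_smul_right,
    areaForm_smul_right, areaForm_smul_right, areaForm_smul_right, areaForm_self, areaForm_self,
    areaForm_swap o x u' u]
  ring

variable [IsManifold 𝓘(ℝ, EM) ∞ M] [ContMDiffVectorBundle ∞ Plane V 𝓘(ℝ, EM)]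

theorem hasMFDerivAt_toProj_comp {x : M} (ψ : Plane ≃ₗ[ℝ] V x) {y : Plane} (hy : y ≠ 0) :
    HasMFDerivAt 𝓘(ℝ, Plane) 𝓘(ℝ, EM × ℝ) (fun y => toProj (⟨x, ψ y⟩ : TotalSpace Plane V)) y
      ((mfderiv (𝓘(ℝ, EM).prod 𝓘(ℝ, Plane)) 𝓘(ℝ, EM × ℝ) toProj (⟨x, ψ y⟩ : TotalSpace Plane V) :
        EM × Plane →L[ℝ] EM × ℝ).comp
      ((mfderiv 𝓘(ℝ, V x) (𝓘(ℝ, EM).prod 𝓘(ℝ, Plane))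
        (fun u : V x => (⟨x, u⟩ : TotalSpace Plane V)) (ψ y) : V x →L[ℝ] EM × Plane).comp
        (planeMap ψ))) := by
  have h0 : ψ y ≠ 0 := by simpa using hy
  have h1 : HasMFDerivAt 𝓘(ℝ, Plane) 𝓘(ℝ, V x) ψ y
      (planeMap ψ) :=
    (planeMap ψ).hasFDerivAt.hasMFDerivAt
  have h2 := HasMFDerivAt.comp (g := fun u : V x => (⟨x, u⟩ : TotalSpace Plane V)) (f := ψ) y
    (hasMFDerivAt_fiber_inclusion (EM := EM) (ψ y)) h1
  exact HasMFDerivAt.comp (g := toProj) (f := fun y => (⟨x, ψ y⟩ : TotalSpace Plane V)) y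
    (mdifferentiableAt_toProj (v := (⟨x, ψ y⟩ : TotalSpace Plane V)) h0).hasMFDerivAt h2

/-- In an affine chart of ℝP¹ the parametrization lifts to V ∖ 0 as an affine line mapped by `ψ`. -/
theorem mdifferentiableAt_fiberParam {x : M} (ψ : Plane ≃ₗ[ℝ] V x) (L : RP1) :
    MDifferentiableAt 𝓘(ℝ, ℝ) 𝓘(ℝ, EM × ℝ) (fiberParam ψ) L := by
  obtain ⟨i, hi⟩ := RP1.exists_chartAt_eq L
  have h1 : MDifferentiableAt 𝓘(ℝ, ℝ) 𝓘(ℝ, EM × ℝ)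
      ((fun y => toProj (⟨x, ψ y⟩ : TotalSpace Plane V)) ∘ (affinePoint i ∘ chartAt ℝ L)) L :=
    MDifferentiableAt.comp (I' := 𝓘(ℝ, Plane)) L
      (hasMFDerivAt_toProj_comp ψ (affinePoint_ne_zero i _)).mdifferentiableAt
      (MDifferentiableAt.comp (I' := 𝓘(ℝ, ℝ)) L
        ((contDiff_affinePoint i).differentiable (by simp) _).mdifferentiableAt
        (mdifferentiableAt_chartAt L (mem_chart_source ℝ L)))
  refine h1.congr_of_eventuallyEq ?_
  filter_upwards [(chartAt ℝ L).open_source.mem_nhds (mem_chart_source ℝ L)] with p hp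
  have h2 := (chartAt ℝ L).left_inv hp
  rw [hi] at h2
  refine (congrArg (fiberParam ψ) h2.symm).trans ?_
  refine (fiberParam_lineOf ψ (affinePoint_ne_zero i _)).trans ?_
  rw [← hi]
  rfl

variable {cov : CovariantDerivative 𝓘(ℝ, EM) Plane V} {o : ∀ x, Orientation ℝ (V x) (Fin 2)}

/-- The pull-back of the angular form to `ℝP¹` under the parametrization of a fibre. -/
theorem fiberParam_pullback_apply {α : OneForm (EM × ℝ) (ProjBundle V)}
    (hα : ∀ v : TotalSpace Plane V, v.2 ≠ 0 →
      ∀ X : TangentSpace (𝓘(ℝ, EM).prod 𝓘(ℝ, Plane)) v,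
      α (toProj v) (mfderiv (𝓘(ℝ, EM).prod 𝓘(ℝ, Plane)) 𝓘(ℝ, EM × ℝ) toProj v X) =
        alphaHat cov o v X) {x : M} (ψ : Plane ≃ₗ[ℝ] V x) {y : Plane} (hy : y ≠ 0) (w : Plane) :
    α (fiberParam ψ (lineOf y)) (mfderiv 𝓘(ℝ, ℝ) 𝓘(ℝ, EM × ℝ) (fiberParam ψ) (lineOf y)
      (mfderiv 𝓘(ℝ, Plane) 𝓘(ℝ, ℝ) lineOf y w)) =
      areaForm o x (ψ (EuclideanSpace.single 0 1)) (ψ (EuclideanSpace.single 1 1)) /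
        (2 * inner ℝ (ψ y) (ψ y)) * (y 0 * w 1 - y 1 * w 0) := by
  have h0 : ψ y ≠ 0 := by simpa using hy
  have h1 := HasMFDerivAt.comp (g := fiberParam ψ) (f := lineOf) y
    (mdifferentiableAt_fiberParam (EM := EM) ψ (lineOf y)).hasMFDerivAt
    (mdifferentiableAt_lineOf_RP1 hy).hasMFDerivAt
  have h2 := hasMFDerivAt_unique h1 ((hasMFDerivAt_toProj_comp (EM := EM) ψ hy).congr_of_eventuallyEq
    ((isOpen_ne.eventually_mem hy).mono fun y' hy' => fiberParam_lineOf ψ hy'))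
  have h3 : ∀ q : ProjBundle V, q = toProj (⟨x, ψ y⟩ : TotalSpace Plane V) → ∀ X : EM × ℝ,
      (α q : EM × ℝ →L[ℝ] ℝ) X =
        (α (toProj (⟨x, ψ y⟩ : TotalSpace Plane V)) : EM × ℝ →L[ℝ] ℝ) X := by
    rintro _ rfl X
    rfl
  refine (h3 _ (fiberParam_lineOf ψ hy) _).trans ?_
  refine (congrArg (fun A : Plane →L[ℝ] EM × ℝ =>
    (α (toProj (⟨x, ψ y⟩ : TotalSpace Plane V)) : EM × ℝ →L[ℝ] ℝ) (A w)) h2).trans ?_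
  refine (hα (⟨x, ψ y⟩ : TotalSpace Plane V) h0 (mfderiv 𝓘(ℝ, V x) (𝓘(ℝ, EM).prod 𝓘(ℝ, Plane))
        (fun u : V x => (⟨x, u⟩ : TotalSpace Plane V)) (ψ y) (ψ w))).trans ?_
  -- The velocities involved are vertical, so the connection disappears from the formula.
  rw [alphaHat, connectionForm_vertical]
  change 1 / (2 * inner ℝ (ψ y) (ψ y)) * areaForm o x (ψ y) (ψ w) = _
  rw [areaForm_map]
  ring

/-- The restriction of the angular form to a fibre, identified with `ℝP¹` by an orientation
preserving isomorphism, represents the class of the standard form. -/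
theorem exists_fiberParam_pullback {α : OneForm (EM × ℝ) (ProjBundle V)}
    (hα : ∀ v : TotalSpace Plane V, v.2 ≠ 0 →
      ∀ X : TangentSpace (𝓘(ℝ, EM).prod 𝓘(ℝ, Plane)) v,
      α (toProj v) (mfderiv (𝓘(ℝ, EM).prod 𝓘(ℝ, Plane)) 𝓘(ℝ, EM × ℝ) toProj v X) =
        alphaHat cov o v X) {γ : OneForm ℝ RP1} (hγ : γ ∈ closedForms ℝ RP1)
    (hγ' : ∀ y : Plane, y ≠ 0 → ∀ w : Plane,
      γ (lineOf y) (mfderiv 𝓘(ℝ, Plane) 𝓘(ℝ, ℝ) lineOf y w) =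
        1 / 2 * (1 / (y 0 ^ 2 + y 1 ^ 2)) * (-y 1 * w 0 + y 0 * w 1))
    {x : M} (ψ : Plane ≃ₗ[ℝ] V x)
    (hψ : 0 < areaForm o x (ψ (EuclideanSpace.single 0 1)) (ψ (EuclideanSpace.single 1 1))) :
    ∃ (β : OneForm ℝ RP1) (hβ : β ∈ closedForms ℝ RP1),
      (∀ (L : RP1) (Y : TangentSpace 𝓘(ℝ, ℝ) L), β L Y = α (fiberParam ψ L)
        (mfderiv 𝓘(ℝ, ℝ) 𝓘(ℝ, EM × ℝ) (fiberParam ψ) L Y)) ∧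
      β.cohomClass hβ = γ.cohomClass hγ := by
  have hne (y : Plane) (hy : y ≠ 0) : ψ y ≠ 0 := by simpa using hy
  set k := areaForm o x (ψ (EuclideanSpace.single 0 1)) (ψ (EuclideanSpace.single 1 1)) with hk
  have hN : ContDiff ℝ ∞ fun y : Plane => (inner ℝ (ψ y) (ψ y) : ℝ) :=
    (planeMap ψ).contDiff.inner ℝ (planeMap ψ).contDiff
  obtain ⟨β, hβ⟩ := exists_oneForm_RP1_of_quadratic k hN
    (fun y hy => inner_self_ne_zero.2 (hne y hy))
    (fun c y => by rw [map_smul, real_inner_smul_left, real_inner_smul_right]; ring)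
  refine ⟨β, mem_closedForms_of_line β, ?_, ?_⟩
  · intro L Y
    obtain ⟨y, hy, rfl⟩ := exists_lineOf L
    obtain ⟨w, rfl⟩ := exists_mfderiv_lineOf_eq hy Y
    exact (hβ y hy w).trans (fiberParam_pullback_apply hα ψ hy w).symm
  · rw [OneForm.cohomClass_eq_iff]
    set u := ψ (EuclideanSpace.single 0 1) with hu
    set u' := ψ (EuclideanSpace.single 1 1) with hu'
    have hψy (y : Plane) : ψ y = y 0 • u + y 1 • u' := by
      conv_lhs => rw [Plane.eq_sum y]
      rw [map_add, map_smul, map_smul]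
    have hu0 : 0 < (inner ℝ u u : ℝ) :=
      real_inner_self_nonneg.lt_of_ne' (inner_self_ne_zero.2 (hne _ (by simp)))
    have ha : 0 < √(inner ℝ u u) := Real.sqrt_pos.2 hu0
    have haa : √(inner ℝ u u) ^ 2 = inner ℝ u u := Real.sq_sqrt hu0.le
    set a := √(inner ℝ u u) with ha_def
    have hcs := inner_mul_inner_add_areaForm_mul_areaForm o x u u' u'
    rw [← hk, ← haa] at hcs
    -- Cholesky factorization of the Gram matrix of u, u′: a = |u|, ab = ⟨u, u′⟩ and ad = k. That b²
    -- + d² = |u′|² is `hcs`, and d > 0 because `ψ` preserves orientation.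
    refine sub_mem_exactForms_of_triangular (a := a) (b := inner ℝ u u' / a) (d := k / a) ha
      (div_pos hψ ha) (fun y hy w => (hβ y hy w).trans ?_) (fun y hy w => (hγ' y hy w).trans ?_)
    · have h1 : (inner ℝ (ψ y) (ψ y) : ℝ) =
          (a * y 0 + inner ℝ u u' / a * y 1) ^ 2 + (k / a * y 1) ^ 2 := by
        rw [hψy, inner_add_left, inner_add_right, inner_add_right, real_inner_smul_left,
          real_inner_smul_left, real_inner_smul_left, real_inner_smul_left, real_inner_smul_right,
          real_inner_smul_right, real_inner_smul_right, real_inner_smul_right,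
          real_inner_comm u u', ← haa]
        field_simp
        linear_combination -(y 1) ^ 2 * hcs
      rw [h1, mul_div_cancel₀ _ ha.ne']
    · have h1 : y 0 ^ 2 + y 1 ^ 2 ≠ 0 := by
        have := Complex.normSq_pos.2 (triangularCoord_ne_zero (b := 0) one_pos one_pos hy)
        simp only [Complex.normSq_apply, triangularCoord] at this
        nlinarith
      field_simp
      ring

end FiberRestriction

/-! ### The exterior derivative of α for a metric connection. -/

section MetricConnection

variable {EM : Type*} [NormedAddCommGroup EM] [NormedSpace ℝ EM]
  {M : Type*} [TopologicalSpace M] [ChartedSpace EM M]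
  {V : M → Type*} [TopologicalSpace (TotalSpace Plane V)]
  [∀ x, NormedAddCommGroup (V x)] [∀ x, InnerProductSpace ℝ (V x)]
  [FiberBundle Plane V] [VectorBundle ℝ Plane V]
  [IsManifold 𝓘(ℝ, EM) ∞ M] [ContMDiffVectorBundle ∞ Plane V 𝓘(ℝ, EM)]
  [FiniteDimensional ℝ EM] [IsContMDiffRiemannianBundle 𝓘(ℝ, EM) ∞ Plane V]
  {cov : CovariantDerivative 𝓘(ℝ, EM) Plane V}
  [CovariantDerivative.ContMDiffCovariantDerivative cov ∞]
  {o : ∀ x, Orientation ℝ (V x) (Fin 2)} {E : Fin 2 → ∀ x, V x}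
  (hE : ∀ i, ContMDiff 𝓘(ℝ, EM) (𝓘(ℝ, EM).prod 𝓘(ℝ, Plane)) ∞
    (fun x => (⟨x, E i x⟩ : TotalSpace Plane V)))

/-- The connection matrix of a metric connection in an orthonormal frame is skew-symmetric. -/
theorem connectionCoeff_eq_neg (hcov : cov.IsMetricCompatible) {x : M}
    (ho : ∀ᶠ y in 𝓝 x, IsOrientedFrameAt o E y) (k l : Fin 2) :
    (connectionCoeff cov (hE k) (hE l) x : EM →L[ℝ] ℝ) =
      -(connectionCoeff cov (hE l) (hE k) x : EM →L[ℝ] ℝ) := by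
  refine ContinuousLinearMap.ext fun u => ?_
  let X : ∀ x : M, TangentSpace 𝓘(ℝ, EM) x := FiberBundle.extend EM (x := x) u
  have hX : X x = u := FiberBundle.extend_apply_self EM (x := x) u
  have hE' (i : Fin 2) := ((hE i) x).mdifferentiableAt (by simp)
  have h1 := hcov.mvfderiv_inner_eq X (hE' k) (hE' l)
  have h2 : (fun y => (inner ℝ (E k y) (E l y) : ℝ)) =ᶠ[𝓝 x]
      fun _ => ![![1, 0], ![0, 1]] k l := by
    filter_upwards [ho] with y hy
    obtain rfl | rfl : k = 0 ∨ k = 1 := by fin_cases k <;> simp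
    all_goals obtain rfl | rfl : l = 0 ∨ l = 1 := by fin_cases l <;> simp
    · exact hy.inner_self
    · exact hy.inner_zero_one
    · exact hy.inner_one_zero
    · exact hy.inner_one_one
  -- The inner products of the frame are locally constant, so compatibility with the metric gives 0
  -- = ⟨∇E_k, E_l⟩ + ⟨E_k, ∇E_l⟩.
  have h3 : mvfderiv 𝓘(ℝ, EM) (fun y => (inner ℝ (E k y) (E l y) : ℝ)) x = 0 := by
    rw [← mvfderiv_const (I := 𝓘(ℝ, EM)) (M := M) (x := x) (![![(1 : ℝ), 0], ![0, 1]] k l)]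
    simp only [mvfderiv]
    exact congrArg _ h2.mfderiv_eq
  have h4 : mvfderiv 𝓘(ℝ, EM) (fun y => (inner ℝ (E k y) (E l y) : ℝ)) x (X x) =
    inner ℝ (cov (E k) x (X x)) (E l x) + inner ℝ (E k x) (cov (E l) x (X x)) := h1
  rw [h3, hX] at h4
  replace h4 : (0 : ℝ) = inner ℝ (cov (E k) x u) (E l x) + inner ℝ (E k x) (cov (E l) x u) := h4
  rw [real_inner_comm] at h4
  exact eq_neg_of_add_eq_zero_right h4.symm

/-- Skew-symmetry holds at all nearby points and in one fixed chart, so it may be used inside an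
expression that is then differentiated. -/
theorem eventually_inChart_connectionCoeff (hcov : cov.IsMetricCompatible) {x : M}
    (ho : ∀ᶠ y in 𝓝 x, IsOrientedFrameAt o E y) (k l : Fin 2) :
    ∀ᶠ y in 𝓝 (chartAt EM x x), (connectionCoeff cov (hE k) (hE l)).inChart x y =
      -(connectionCoeff cov (hE l) (hE k)).inChart x y := by
  have h1 : ContinuousAt (chartAt EM x).symm (chartAt EM x x) :=
    (chartAt EM x).continuousAt_symm (mem_chart_target EM x)
  have h2 : ∀ᶠ y in 𝓝 (chartAt EM x x), ∀ᶠ p in 𝓝 ((chartAt EM x).symm y),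
      IsOrientedFrameAt o E p :=
    h1.eventually (by
      rw [(chartAt EM x).left_inv (mem_chart_source EM x)]
      exact ho.eventually_nhds)
  filter_upwards [h2] with y hy
  have h3 := connectionCoeff_eq_neg hE hcov hy k l
  exact (congrArg (fun A : EM →L[ℝ] ℝ =>
    A.comp (mfderiv 𝓘(ℝ, EM) 𝓘(ℝ, EM) (chartAt EM x).symm y : EM →L[ℝ] EM)) h3).trans
      (ContinuousLinearMap.neg_comp _ _)

/-- For a metric connection the differential of the angular form is half the differential of the
connection form in an orthonormal frame. -/
theorem d_eq_connectionCoeff_d (hcov : cov.IsMetricCompatible)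
    {α : OneForm (EM × ℝ) (ProjBundle V)}
    (hα : ∀ v : TotalSpace Plane V, v.2 ≠ 0 →
      ∀ X : TangentSpace (𝓘(ℝ, EM).prod 𝓘(ℝ, Plane)) v,
      α (toProj v) (mfderiv (𝓘(ℝ, EM).prod 𝓘(ℝ, Plane)) 𝓘(ℝ, EM × ℝ) toProj v X) =
        alphaHat cov o v X) {q : ProjBundle V} (hq : q ∈ frameDomain E)
    (ho : ∀ᶠ y in 𝓝 q.proj, IsOrientedFrameAt o E y) (X Y : EM × ℝ) :
    α.d q X Y = 1 / 2 * (connectionCoeff cov (hE 1) (hE 0)).d q.proj X.1 Y.1 := by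
  set c := chartAt (EM × ℝ) q with hc
  set A := connectionCoeff cov (hE 1) (hE 0) with hA
  have h1 : α.inChart q =ᶠ[𝓝 (c q)]
      covectorInChart (E := EM × ℝ) (N := ProjBundle V) (fun p => inducedForm cov hE p) q :=
    covectorInChart_congr (L := fun p => α p)
      (eventually_eq_inducedForm hE hq ho (L := fun p => α p) hα)
  have hz : ContDiffAt ℝ ∞ (frameSlope E ∘ c.symm) (c q) := by
    refine contMDiffAt_iff_contDiffAt.1 (ContMDiffAt.comp (I' := 𝓘(ℝ, EM × ℝ)) _ ?_
      ((contMDiffOn_chart_symm (I := 𝓘(ℝ, EM × ℝ)) (n := ∞) (x := q)).contMDiffAt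
        (c.open_target.mem_nhds (mem_chart_target _ q))))
    rw [c.left_inv (mem_chart_source _ q)]
    exact (contMDiffAt_frameSlope hE hq).1
  have hz1 : ∀ᶠ y in 𝓝 (c q), DifferentiableAt ℝ (frameSlope E ∘ c.symm) y := by
    filter_upwards [(hz.of_le (m := 1) (by simp)).eventually (by simp)] with y hy
    exact hy.differentiableAt (by simp)
  have hfst : Filter.Tendsto Prod.fst (𝓝 (c q)) (𝓝 (chartAt EM q.proj q.proj)) := by
    rw [← ProjBundle.chartAt_fst]
    exact continuous_fst.continuousAt
  have hself {B B' : EM →L[ℝ] ℝ} (h : B = -B) : B = 0 := by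
    refine ContinuousLinearMap.ext fun u => ?_
    have h' : B u = -B u := congrArg (fun C : EM →L[ℝ] ℝ => C u) h
    change B u = 0
    linarith
  -- With A skew, the numerator of the local expression is dz + (1 + z²)A₁₀. The quotient is
  -- therefore half of d arctan z plus the pull-back of A₁₀.
  let g : EM × ℝ → ℝ := Real.arctan ∘ (frameSlope E ∘ c.symm)
  have hg : ContDiffAt ℝ ∞ g (c q) :=
    ContDiffAt.comp (g := Real.arctan) (c q) Real.contDiff_arctan.contDiffAt hz
  have h2 : α.inChart q =ᶠ[𝓝 (c q)] fun y => (1 / 2 : ℝ) • (fderiv ℝ g y +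
      (A.inChart q.proj y.1).comp (ContinuousLinearMap.fst ℝ EM ℝ)) := by
    filter_upwards [h1, covectorInChart_inducedForm cov hE hq, hz1,
      hfst.eventually (eventually_inChart_connectionCoeff hE hcov ho 0 0),
      hfst.eventually (eventually_inChart_connectionCoeff hE hcov ho 1 1),
      hfst.eventually (eventually_inChart_connectionCoeff hE hcov ho 0 1)] with y h1 h2 h3 h4 h5 h6
    have hgy : fderiv ℝ g y = (1 / (1 + frameSlope E (c.symm y) ^ 2)) •
      fderiv ℝ (frameSlope E ∘ c.symm) y := h3.hasFDerivAt.arctan.fderiv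
    rw [h1, h2, hself (B' := 0) h4, hself (B' := 0) h5, h6, hgy]
    refine ContinuousLinearMap.ext fun W => ?_
    change 1 / (2 * (1 + frameSlope E (c.symm y) ^ 2)) * (_ + (A.inChart q.proj y.1 W.1 +
      frameSlope E (c.symm y) * 0 - frameSlope E (c.symm y) * 0 - frameSlope E (c.symm y) ^ 2 *
      -A.inChart q.proj y.1 W.1)) = 1 / 2 * (1 / (1 + frameSlope E (c.symm y) ^ 2) * _ +
      A.inChart q.proj y.1 W.1)
    have : 1 + frameSlope E (c.symm y) ^ 2 ≠ 0 := by positivity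
    field_simp
    ring
  have h3 : HasFDerivAt (fderiv ℝ g) (fderiv ℝ (fderiv ℝ g) (c q)) (c q) :=
    ((hg.fderiv_right (m := ∞) (by simp)).differentiableAt (by simp)).hasFDerivAt
  have h4 : HasFDerivAt (fun y : EM × ℝ => A.inChart q.proj y.1)
      ((fderiv ℝ (A.inChart q.proj) (chartAt EM q.proj q.proj)).comp
        (ContinuousLinearMap.fst ℝ EM ℝ)) (c q) := by
    refine HasFDerivAt.comp (g := A.inChart q.proj) (c q) ?_ hasFDerivAt_fst
    rw [ProjBundle.chartAt_fst]
    exact (A.differentiableAt_inChart q.proj).hasFDerivAt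
  have h5 := ((h3.add (h4.clm_comp (hasFDerivAt_const
    (ContinuousLinearMap.fst ℝ EM ℝ) (c q)))).const_smul (1 / 2 : ℝ)).congr_of_eventuallyEq h2
  -- The exact part d arctan z contributes nothing to dα.
  have hsymm : fderiv ℝ (fderiv ℝ g) (c q) X Y = fderiv ℝ (fderiv ℝ g) (c q) Y X :=
    (hg.isSymmSndFDerivAt (by
    rw [minSmoothness_of_isRCLikeNormedField]
    exact WithTop.coe_le_coe.2 (le_top : (2 : ℕ∞) ≤ ⊤))).eq X Y
  have h6 (X Y : EM × ℝ) : fderiv ℝ (α.inChart q) (c q) X Y =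
      1 / 2 * (fderiv ℝ (fderiv ℝ g) (c q) X Y +
      fderiv ℝ (A.inChart q.proj) (chartAt EM q.proj q.proj) X.1 Y.1) := by
    rw [h5.fderiv]
    simp [mul_add]
  change fderiv ℝ (α.inChart q) (c q) X Y - fderiv ℝ (α.inChart q) (c q) Y X =
    1 / 2 * (fderiv ℝ (A.inChart q.proj) (chartAt EM q.proj q.proj) X.1 Y.1 -
      fderiv ℝ (A.inChart q.proj) (chartAt EM q.proj q.proj) Y.1 X.1)
  rw [h6, h6, hsymm]
  ring

end MetricConnection

/-! ### Coordinate vector fields. -/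

section ConstantFields

variable {E : Type*} [NormedAddCommGroup E] [NormedSpace ℝ E]
  {N : Type*} [TopologicalSpace N] [ChartedSpace E N] [IsManifold 𝓘(ℝ, E) ∞ N]

/-- The extension of a tangent vector is the coordinate vector field of the preferred chart. -/
theorem extend_tangent_apply {x p : N} (X : E) (hp : p ∈ (chartAt E x).source) :
    (FiberBundle.extend E (E := TangentSpace 𝓘(ℝ, E)) (x := x) X p : E) =
      (mfderiv 𝓘(ℝ, E) 𝓘(ℝ, E) (chartAt E x).symm (chartAt E x p) : E →L[ℝ] E) X := by
  have : IsManifold 𝓘(ℝ, E) 1 N := IsManifold.of_le (n := ∞) (by simp)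
  have h1 := TangentBundle.symmL_trivializationAt (I := 𝓘(ℝ, E)) (x₀ := x) (x := p) hp
  have h2 : (trivializationAt E (TangentSpace 𝓘(ℝ, E)) x ⟨x, X⟩).2 = X := by
    have hb := FiberBundle.mem_baseSet_trivializationAt' (F := E) (E := TangentSpace 𝓘(ℝ, E)) x
    have h := TangentBundle.continuousLinearMapAt_trivializationAt (I := 𝓘(ℝ, E)) (x₀ := x) (x := x)
      (mem_chart_source E x)
    have h' : (trivializationAt E (TangentSpace 𝓘(ℝ, E)) x).continuousLinearMapAt ℝ x X =
        (trivializationAt E (TangentSpace 𝓘(ℝ, E)) x ⟨x, X⟩).2 := by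
      rw [Trivialization.continuousLinearMapAt_apply (R := ℝ), Trivialization.coe_linearMapAt_of_mem _ hb]
    rw [← h', h]
    simp only [mfld_simps]
    exact congrArg (fun A : E →L[ℝ] E => A X) (mfderiv_chartAt_self x)
  have h3 : FiberBundle.extend E (E := TangentSpace 𝓘(ℝ, E)) (x := x) X p =
      (trivializationAt E (TangentSpace 𝓘(ℝ, E)) x).symmL ℝ p X := by
    rw [Bundle.Trivialization.symmL_apply _ hp]
    exact congrArg _ h2
  refine h3.trans ?_
  rw [h1]
  simp only [mfld_simps]
  rfl

/-- The extended vector is a coordinate field, so deriving along it is a directional derivative in a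
fixed direction in the chart. -/
theorem mvfderiv_extend_tangent {x p : N} (X : E) (hp : p ∈ (chartAt E x).source) {f : N → ℝ}
    (hf : MDifferentiableAt 𝓘(ℝ, E) 𝓘(ℝ, ℝ) f p) :
    mvfderiv 𝓘(ℝ, E) f p (FiberBundle.extend E (E := TangentSpace 𝓘(ℝ, E)) (x := x) X p) =
      fderiv ℝ (f ∘ (chartAt E x).symm) (chartAt E x p) X := by
  set φ := chartAt E x
  have h1 : φ.symm (φ p) = p := φ.left_inv hp
  have hf' : MDifferentiableAt 𝓘(ℝ, E) 𝓘(ℝ, ℝ) f (φ.symm (φ p)) := by rwa [h1]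
  obtain ⟨Z, hZ⟩ : ∃ Z : E →L[ℝ] ℝ, Z = mvfderiv 𝓘(ℝ, E) f (φ.symm (φ p)) := ⟨_, rfl⟩
  obtain ⟨T, hT⟩ : ∃ T : E →L[ℝ] E, T = mfderiv 𝓘(ℝ, E) 𝓘(ℝ, E) φ.symm (φ p) := ⟨_, rfl⟩
  have hZm : HasMFDerivAt 𝓘(ℝ, E) 𝓘(ℝ, ℝ) f (φ.symm (φ p)) Z := by
    rw [hZ]
    exact hf'.hasMFDerivAt
  have hTm : HasMFDerivAt 𝓘(ℝ, E) 𝓘(ℝ, E) φ.symm (φ p) T := by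
    rw [hT]
    exact (mdifferentiableAt_chartAt_symm x (φ.map_source hp)).hasMFDerivAt
  have h2 : HasFDerivAt (f ∘ φ.symm) (Z.comp T) (φ p) :=
    hasMFDerivAt_iff_hasFDerivAt.1 (HasMFDerivAt.comp (g := f) (f := φ.symm) (φ p) hZm hTm)
  have h3 : ∀ p', p' = p → ∀ W : E, (mvfderiv 𝓘(ℝ, E) f p' : E →L[ℝ] ℝ) W =
      (mvfderiv 𝓘(ℝ, E) f p : E →L[ℝ] ℝ) W := by
    rintro _ rfl W
    rfl
  rw [h2.fderiv]
  refine (congrArg (fun W : E => (mvfderiv 𝓘(ℝ, E) f p : E →L[ℝ] ℝ) W)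
    (extend_tangent_apply X hp)).trans ?_
  rw [ContinuousLinearMap.comp_apply, hZ, hT]
  exact (h3 _ h1 _).symm

theorem OneForm.apply_extend_tangent (A : OneForm E N) {x p : N} (X : E)
    (hp : p ∈ (chartAt E x).source) :
    A p (FiberBundle.extend E (E := TangentSpace 𝓘(ℝ, E)) (x := x) X p) =
      A.inChart x (chartAt E x p) X := by
  have h3 : ∀ p', p' = p → ∀ W : E, (A p' : E →L[ℝ] ℝ) W = (A p : E →L[ℝ] ℝ) W := by
    rintro _ rfl W
    rfl
  refine (congrArg (fun W : E => (A p : E →L[ℝ] ℝ) W) (extend_tangent_apply X hp)).trans ?_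
  exact (h3 _ ((chartAt E x).left_inv hp) _).symm

/-- The preferred chart has identity differential at its base point. -/
theorem mvfderiv_comp_chartAt {x : N} {G : E → ℝ} (hG : DifferentiableAt ℝ G (chartAt E x x))
    (X : E) : (mvfderiv 𝓘(ℝ, E) (G ∘ chartAt E x) x : E →L[ℝ] ℝ) X =
      fderiv ℝ G (chartAt E x x) X := by
  have h1 := HasMFDerivAt.comp (g := G) (f := chartAt E x) x hG.hasFDerivAt.hasMFDerivAt
    (mdifferentiableAt_chartAt x (mem_chart_source E x)).hasMFDerivAt
  have h2 : mfderiv 𝓘(ℝ, E) 𝓘(ℝ, ℝ) (G ∘ chartAt E x) x = _ := h1.mfderiv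
  rw [mfderiv_chartAt_self] at h2
  exact congrArg (fun A : E →L[ℝ] ℝ => A X) h2

/-- Coordinate vector fields commute. -/
theorem mlieBracket_extend_tangent (x : N) (X Y : E) :
    VectorField.mlieBracket 𝓘(ℝ, E)
      (FiberBundle.extend E (E := TangentSpace 𝓘(ℝ, E)) (x := x) X)
      (FiberBundle.extend E (E := TangentSpace 𝓘(ℝ, E)) (x := x) Y) x = 0 := by
  have : IsManifold 𝓘(ℝ, E) 1 N := IsManifold.of_le (n := ∞) (by simp)
  -- Pulled back to the chart both fields are constant, so their bracket vanishes there.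
  have key (X : E) : (VectorField.mpullbackWithin 𝓘(ℝ, E) 𝓘(ℝ, E) (extChartAt 𝓘(ℝ, E) x).symm
      (FiberBundle.extend E (E := TangentSpace 𝓘(ℝ, E)) (x := x) X) (range 𝓘(ℝ, E)) : E → E)
      =ᶠ[𝓝 (chartAt E x x)] fun _ => X := by
    filter_upwards [(chartAt E x).open_target.mem_nhds (mem_chart_target E x)] with y hy
    have hy' : y ∈ (extChartAt 𝓘(ℝ, E) x).target := by simpa only [mfld_simps] using hy
    have h1 := isInvertible_mfderivWithin_extChartAt_symm (I := 𝓘(ℝ, E)) hy'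
    have h2 := extend_tangent_apply X ((chartAt E x).map_target hy)
    rw [(chartAt E x).right_inv hy] at h2
    have h3 : FiberBundle.extend E (E := TangentSpace 𝓘(ℝ, E)) (x := x) X
        ((extChartAt 𝓘(ℝ, E) x).symm y) =
        mfderivWithin 𝓘(ℝ, E) 𝓘(ℝ, E) (extChartAt 𝓘(ℝ, E) x).symm (range 𝓘(ℝ, E)) y X := by
      simp only [mfld_simps]
      exact h2
    rw [VectorField.mpullbackWithin_apply, h3]
    exact h1.inverse_apply_eq.2 rfl
  rw [VectorField.mlieBracket, VectorField.mlieBracketWithin_apply]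
  have h0 (F G : E → E) (hF : F =ᶠ[𝓝 (chartAt E x x)] fun _ => X)
      (hG : G =ᶠ[𝓝 (chartAt E x x)] fun _ => Y) :
      VectorField.lieBracketWithin ℝ F G univ (chartAt E x x) = 0 := by
    rw [VectorField.lieBracketWithin_univ, hF.lieBracket_vectorField_eq hG]
    simp [VectorField.lieBracket]
  have h1 : (extChartAt 𝓘(ℝ, E) x).symm ⁻¹' univ ∩ range 𝓘(ℝ, E) = univ := by simp
  rw [h1]
  refine Eq.trans (congrArg _ ?_) (map_zero _)
  exact h0 _ _ (key X) (key Y)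

end ConstantFields

/-! ### Curvature as the exterior derivative of the connection coefficient. -/

section Curvature

variable {EM : Type*} [NormedAddCommGroup EM] [NormedSpace ℝ EM]
  {M : Type*} [TopologicalSpace M] [ChartedSpace EM M]
  {V : M → Type*} [TopologicalSpace (TotalSpace Plane V)]
  [∀ x, NormedAddCommGroup (V x)] [∀ x, InnerProductSpace ℝ (V x)]
  [FiberBundle Plane V] [VectorBundle ℝ Plane V]

theorem areaForm_finOrthonormalBasis (o : ∀ x, Orientation ℝ (V x) (Fin 2)) (x : M) :
    areaForm o x ((o x).finOrthonormalBasis (by norm_num) (finrank_fiber V x) 0)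
      ((o x).finOrthonormalBasis (by norm_num) (finrank_fiber V x) 1) = 1 := by
  have : Fact (finrank ℝ (V x) = 2) := ⟨finrank_fiber V x⟩
  let f := (o x).finOrthonormalBasis (by norm_num) (finrank_fiber V x)
  have hf : f.toBasis.orientation = o x :=
    (o x).finOrthonormalBasis_orientation (by norm_num) (finrank_fiber V x)
  have h2 : areaForm o x (f 0) (f 1) = f.toBasis.det f.toBasis := by
    rw [← (o x).volumeForm_robust f hf, areaForm, Orientation.areaForm_to_volumeForm]
    congr 1
    ext i
    fin_cases i <;> simp
  exact h2.trans f.toBasis.det_self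

variable [IsManifold 𝓘(ℝ, EM) ∞ M] [ContMDiffVectorBundle ∞ Plane V 𝓘(ℝ, EM)]
  [FiniteDimensional ℝ EM] [IsContMDiffRiemannianBundle 𝓘(ℝ, EM) ∞ Plane V]
  {cov : CovariantDerivative 𝓘(ℝ, EM) Plane V}
  [CovariantDerivative.ContMDiffCovariantDerivative cov ∞]
  {o : ∀ x, Orientation ℝ (V x) (Fin 2)} {E : Fin 2 → ∀ x, V x}
  (hE : ∀ i, ContMDiff 𝓘(ℝ, EM) (𝓘(ℝ, EM).prod 𝓘(ℝ, Plane)) ∞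
    (fun x => (⟨x, E i x⟩ : TotalSpace Plane V)))

/-- A metric connection in an oriented orthonormal frame. -/
theorem cov_apply_of_eventuallyEq (hcov : cov.IsMetricCompatible) {x : M}
    (ho : ∀ᶠ y in 𝓝 x, IsOrientedFrameAt o E y) {τ : ∀ x, V x} {f g : M → ℝ}
    (hτ : ∀ᶠ y in 𝓝 x, τ y = f y • E 0 y + g y • E 1 y)
    (hf : MDifferentiableAt 𝓘(ℝ, EM) 𝓘(ℝ, ℝ) f x) (hg : MDifferentiableAt 𝓘(ℝ, EM) 𝓘(ℝ, ℝ) g x)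
    (u : EM) : (cov τ x : EM →L[ℝ] V x) u =
      ((mvfderiv 𝓘(ℝ, EM) f x : EM →L[ℝ] ℝ) u -
        g x * (connectionCoeff cov (hE 1) (hE 0) x : EM →L[ℝ] ℝ) u) • E 0 x +
      ((mvfderiv 𝓘(ℝ, EM) g x : EM →L[ℝ] ℝ) u +
        f x * (connectionCoeff cov (hE 1) (hE 0) x : EM →L[ℝ] ℝ) u) • E 1 x := by
  have hE' (i : Fin 2) := ((hE i) x).mdifferentiableAt (by simp)
  have h1 : MDifferentiableAt 𝓘(ℝ, EM) (𝓘(ℝ, EM).prod 𝓘(ℝ, Plane))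
      (fun x => (⟨x, (f • E 0 + g • E 1) x⟩ : TotalSpace Plane V)) x :=
    mdifferentiableAt_add_section (hf.smul_section (hE' 0)) (hg.smul_section (hE' 1))
  have h2 : MDifferentiableAt 𝓘(ℝ, EM) (𝓘(ℝ, EM).prod 𝓘(ℝ, Plane))
      (fun x => (⟨x, τ x⟩ : TotalSpace Plane V)) x := by
    refine h1.congr_of_eventuallyEq (hτ.mono fun y hy => ?_)
    exact congrArg (TotalSpace.mk y) hy
  have h3 : cov τ x = cov (f • E 0 + g • E 1) x :=
    cov.isCovariantDerivativeOnUniv.congr_of_eventuallyEq h2 h1 Filter.univ_mem hτ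
  have h4 := cov.apply_smul_add_smul (hE' 0) (hE' 1) hf hg u
  rw [← h3] at h4
  have hneg := connectionCoeff_eq_neg hE hcov ho
  have hself (k : Fin 2) : (connectionCoeff cov (hE k) (hE k) x : EM →L[ℝ] ℝ) u = 0 := by
    have h : (connectionCoeff cov (hE k) (hE k) x : EM →L[ℝ] ℝ) u =
        -(connectionCoeff cov (hE k) (hE k) x : EM →L[ℝ] ℝ) u :=
      congrArg (fun B : EM →L[ℝ] ℝ => B u) (hneg k k)
    linarith
  have h01 : (connectionCoeff cov (hE 0) (hE 1) x : EM →L[ℝ] ℝ) u =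
      -(connectionCoeff cov (hE 1) (hE 0) x : EM →L[ℝ] ℝ) u :=
    congrArg (fun B : EM →L[ℝ] ℝ => B u) (hneg 0 1)
  have hsum (l : Fin 2) : (cov (E l) x : EM →L[ℝ] V x) u =
      (connectionCoeff cov (hE 0) (hE l) x : EM →L[ℝ] ℝ) u • E 0 x +
      (connectionCoeff cov (hE 1) (hE l) x : EM →L[ℝ] ℝ) u • E 1 x :=
    ho.self_of_nhds.sum_eq _
  have h0 : (cov (E 0) x : EM →L[ℝ] V x) u =
      (connectionCoeff cov (hE 1) (hE 0) x : EM →L[ℝ] ℝ) u • E 1 x := by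
    rw [hsum, hself, zero_smul, zero_add]
  have h5 : (cov (E 1) x : EM →L[ℝ] V x) u =
      -(connectionCoeff cov (hE 1) (hE 0) x : EM →L[ℝ] ℝ) u • E 0 x := by
    rw [hsum, hself, h01, zero_smul, add_zero]
  refine h4.trans ?_
  have h6 : (cov (E 0) x) u = (cov (E 0) x : EM →L[ℝ] V x) u := rfl
  have h7 : (cov (E 1) x) u = (cov (E 1) x : EM →L[ℝ] V x) u := rfl
  rw [h6, h7, h0, h5]
  module

/-- The curvature form of a metric connection is the differential of its connection form in an
oriented orthonormal frame. -/
theorem curvatureForm_eq_connectionCoeff_d (hcov : cov.IsMetricCompatible) {x : M}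
    (ho : ∀ᶠ y in 𝓝 x, IsOrientedFrameAt o E y) (X Y : EM) :
    curvatureForm cov o x X Y = (connectionCoeff cov (hE 1) (hE 0)).d x X Y := by
  set φ := chartAt EM x with hφ
  set A := connectionCoeff cov (hE 1) (hE 0) with hA
  set e := (o x).finOrthonormalBasis (by norm_num) (finrank_fiber V x) with he
  -- The basis `e` used in the curvature form is unrelated to the frame `E`, so σ has two
  -- coefficient functions in `E`.
  let σ : ∀ x, V x := FiberBundle.extend Plane (e 0)
  let f : Fin 2 → M → ℝ := fun i p => inner ℝ (E i p) (σ p)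
  let a : EM → EM →L[ℝ] ℝ := A.inChart x
  have hxs : x ∈ φ.source := mem_chart_source EM x
  obtain ⟨s, hs, hσ⟩ := FiberBundle.exists_contMDiffOn_extend (k := ∞) 𝓘(ℝ, EM) Plane (e 0)
  have hf (i : Fin 2) : ∀ᶠ p in 𝓝 x, ContMDiffAt 𝓘(ℝ, EM) 𝓘(ℝ, ℝ) ∞ (f i) p := by
    filter_upwards [eventually_mem_nhds_iff.2 hs] with p hp
    exact ((hE i p).contMDiffWithinAt.inner_bundle (hσ p (mem_of_mem_nhds hp))).contMDiffAt hp
  let F : Fin 2 → EM → ℝ := fun i => f i ∘ φ.symm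
  have hF (i : Fin 2) : ContDiffAt ℝ ∞ (F i) (φ x) := by
    refine contMDiffAt_iff_contDiffAt.1 (ContMDiffAt.comp (I' := 𝓘(ℝ, EM)) _ ?_
      ((contMDiffOn_chart_symm (I := 𝓘(ℝ, EM)) (n := ∞) (x := x)).contMDiffAt
        (φ.open_target.mem_nhds (mem_chart_target _ x))))
    rw [φ.left_inv hxs]
    exact (hf i).self_of_nhds
  have hfF (i : Fin 2) {p : M} (hp : p ∈ φ.source) : f i p = F i (φ p) := by
    simp only [F, Function.comp_apply, φ.left_inv hp]
  -- The coordinates of ∇_Yσ = (dF₀ − F₁A)(Y) E₀ + (dF₁ + F₀A)(Y) E₁ in the chart, with A = A₁₀.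
  let G0 : EM → EM → ℝ := fun Y y => fderiv ℝ (F 0) y Y - F 1 y * a y Y
  let G1 : EM → EM → ℝ := fun Y y => fderiv ℝ (F 1) y Y + F 0 y * a y Y
  have hDF (i : Fin 2) : HasFDerivAt (F i) (fderiv ℝ (F i) (φ x)) (φ x) :=
    ((hF i).differentiableAt (by simp)).hasFDerivAt
  have hDDF (i : Fin 2) : HasFDerivAt (fderiv ℝ (F i)) (fderiv ℝ (fderiv ℝ (F i)) (φ x)) (φ x) :=
    (((hF i).fderiv_right (m := ∞) (by simp)).differentiableAt (by simp)).hasFDerivAt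
  have hDa : HasFDerivAt a (fderiv ℝ a (φ x)) (φ x) := (A.differentiableAt_inChart x).hasFDerivAt
  have hG0 (Y : EM) := ((hDDF 0).clm_apply (hasFDerivAt_const Y (φ x))).sub
    ((hDF 1).mul (hDa.clm_apply (hasFDerivAt_const Y (φ x))))
  have hG1 (Y : EM) := ((hDDF 1).clm_apply (hasFDerivAt_const Y (φ x))).add
    ((hDF 0).mul (hDa.clm_apply (hasFDerivAt_const Y (φ x))))
  have hG0' (Y X : EM) : fderiv ℝ (G0 Y) (φ x) X = fderiv ℝ (fderiv ℝ (F 0)) (φ x) X Y -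
      (F 1 (φ x) * fderiv ℝ a (φ x) X Y + a (φ x) Y * fderiv ℝ (F 1) (φ x) X) := by
    have h : fderiv ℝ (G0 Y) (φ x) = _ := (hG0 Y).fderiv
    rw [h]
    simp
  have hG1' (Y X : EM) : fderiv ℝ (G1 Y) (φ x) X = fderiv ℝ (fderiv ℝ (F 1)) (φ x) X Y +
      (F 0 (φ x) * fderiv ℝ a (φ x) X Y + a (φ x) Y * fderiv ℝ (F 0) (φ x) X) := by
    have h : fderiv ℝ (G1 Y) (φ x) = _ := (hG1 Y).fderiv
    rw [h]
    simp
  let ext (Y : EM) : ∀ p : M, TangentSpace 𝓘(ℝ, EM) p := FiberBundle.extend EM (x := x) Y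
  have hfirst (Y : EM) : ∀ᶠ p in 𝓝 x, cov σ p (ext Y p) =
      (G0 Y ∘ φ) p • E 0 p + (G1 Y ∘ φ) p • E 1 p := by
    filter_upwards [hf 0, hf 1, ho.eventually_nhds, φ.open_source.mem_nhds hxs]
      with p h0 h1 hop hp
    have hσp : ∀ᶠ y in 𝓝 p, σ y = f 0 y • E 0 y + f 1 y • E 1 y :=
      hop.mono fun y hy => hy.sum_eq (σ y)
    have h0' := h0.mdifferentiableAt (by simp)
    have h1' := h1.mdifferentiableAt (by simp)
    refine (cov_apply_of_eventuallyEq hE hcov hop hσp h0' h1' (ext Y p)).trans ?_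
    have e0 := mvfderiv_extend_tangent Y hp h0'
    have e1 := mvfderiv_extend_tangent Y hp h1'
    have e2 := A.apply_extend_tangent Y hp
    refine congrArg₂ (fun r s : ℝ => r • E 0 p + s • E 1 p) ?_ ?_
    · refine congrArg₂ (fun r s : ℝ => r - s) e0 (congrArg₂ (fun r s : ℝ => r * s) (hfF 1 hp) e2)
    · refine congrArg₂ (fun r s : ℝ => r + s) e1 (congrArg₂ (fun r s : ℝ => r * s) (hfF 0 hp) e2)
  have hext (X : EM) : ext X x = X := FiberBundle.extend_apply_self EM (E := TangentSpace 𝓘(ℝ, EM)) (x := x) X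
  have hAx (X : EM) : (A x : EM →L[ℝ] ℝ) X = a (φ x) X := by
    have h := A.apply_extend_tangent X hxs
    exact (congrArg (fun W : EM => (A x : EM →L[ℝ] ℝ) W) (hext X)).symm.trans h
  have hsecond (Y X : EM) : (cov (fun p => cov σ p (ext Y p)) x : EM →L[ℝ] V x) X =
      (fderiv ℝ (G0 Y) (φ x) X - G1 Y (φ x) * a (φ x) X) • E 0 x +
      (fderiv ℝ (G1 Y) (φ x) X + G0 Y (φ x) * a (φ x) X) • E 1 x := by
    have hd0 : DifferentiableAt ℝ (G0 Y) (φ x) := (hG0 Y).differentiableAt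
    have hd1 : DifferentiableAt ℝ (G1 Y) (φ x) := (hG1 Y).differentiableAt
    have hm (G : EM → ℝ) (hG : DifferentiableAt ℝ G (φ x)) :
        MDifferentiableAt 𝓘(ℝ, EM) 𝓘(ℝ, ℝ) (G ∘ φ) x :=
      MDifferentiableAt.comp (I' := 𝓘(ℝ, EM)) x hG.mdifferentiableAt (mdifferentiableAt_chartAt x hxs)
    refine (cov_apply_of_eventuallyEq hE hcov ho (hfirst Y) (hm _ hd0) (hm _ hd1) X).trans ?_
    rw [mvfderiv_comp_chartAt hd0, mvfderiv_comp_chartAt hd1, hAx]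
    rfl
  have hcurv : curvatureAt cov x X Y (e 0) =
      (cov (fun p => cov σ p (ext Y p)) x : EM →L[ℝ] V x) X -
      (cov (fun p => cov σ p (ext X p)) x : EM →L[ℝ] V x) Y := by
    have h1 : curvatureAt cov x X Y (e 0) =
        (cov (fun p => cov σ p (ext Y p)) x : EM →L[ℝ] V x) (ext X x) -
        (cov (fun p => cov σ p (ext X p)) x : EM →L[ℝ] V x) (ext Y x) -
        (cov σ x : EM →L[ℝ] V x) (VectorField.mlieBracket 𝓘(ℝ, EM) (ext X) (ext Y) x) := rfl
    have h2 : (VectorField.mlieBracket 𝓘(ℝ, EM) (ext X) (ext Y) x : EM) = 0 :=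
      mlieBracket_extend_tangent x X Y
    rw [h1, hext, hext, h2, map_zero, sub_zero]
  have hsym (i : Fin 2) : fderiv ℝ (fderiv ℝ (F i)) (φ x) X Y =
      fderiv ℝ (fderiv ℝ (F i)) (φ x) Y X :=
    ((hF i).isSymmSndFDerivAt (by
      rw [minSmoothness_of_isRCLikeNormedField]
      exact WithTop.coe_le_coe.2 (le_top : (2 : ℕ∞) ≤ ⊤))).eq X Y
  set d := A.d x X Y with hd
  have hd' : d = fderiv ℝ a (φ x) X Y - fderiv ℝ a (φ x) Y X := rfl
  -- Antisymmetrizing in X and Y removes the second derivatives of F₀, F₁, the mixed terms dF·A and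
  -- the products A(X)A(Y). What remains is dA times the rotation of σ by a right angle.
  have hR : curvatureAt cov x X Y (e 0) = (-(F 1 (φ x) * d)) • E 0 x + (F 0 (φ x) * d) • E 1 x := by
    rw [hcurv, hsecond, hsecond, hG0', hG0', hG1', hG1', hsym 0, hsym 1, hd']
    simp only [G0, G1]
    module
  have hσx : σ x = e 0 := FiberBundle.extend_apply_self Plane (e 0)
  have hF0 (i : Fin 2) : F i (φ x) = inner ℝ (E i x) (e 0) := by
    rw [← hfF i hxs, ← hσx]
  -- Pairing the rotated vector `e 0` with `e 1` gives θ(e₁, e₂) = 1 in the usual numbering. This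
  -- removes the dependence on the frame `E`.
  have harea : areaForm o x (e 0) (e 1) = 1 := areaForm_finOrthonormalBasis o x
  rw [ho.self_of_nhds.areaForm_eq, ← hF0, ← hF0] at harea
  change inner ℝ (curvatureAt cov x X Y (e 0)) (e 1) = d
  rw [hR, inner_add_left, real_inner_smul_left, real_inner_smul_left]
  linear_combination d * harea

end Curvature

end

/-! ### The theorem. -/

theorem theorem3 {EM : Type*} [NormedAddCommGroup EM] [NormedSpace ℝ EM] [FiniteDimensional ℝ EM]
    {M : Type*} [TopologicalSpace M] [T2Space M] [SecondCountableTopology M]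
    [ChartedSpace EM M] [IsManifold 𝓘(ℝ, EM) ∞ M]
    {V : M → Type*} [TopologicalSpace (TotalSpace Plane V)]
    [∀ x, NormedAddCommGroup (V x)] [∀ x, InnerProductSpace ℝ (V x)]
    [FiberBundle Plane V] [VectorBundle ℝ Plane V] [ContMDiffVectorBundle ∞ Plane V 𝓘(ℝ, EM)]
    [IsContMDiffRiemannianBundle 𝓘(ℝ, EM) ∞ Plane V]
    (o : ∀ x, Orientation ℝ (V x) (Fin 2)) (ho : IsBundleOrientation EM o)
    (cov : CovariantDerivative 𝓘(ℝ, EM) Plane V)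
    [CovariantDerivative.ContMDiffCovariantDerivative cov ∞] :
    -- the form `ᾱ` on `ℝP¹`, and its class as a generator of `H¹(ℝP¹)`
    ∃ (αbar : OneForm ℝ RP1) (hbar : αbar ∈ closedForms ℝ RP1),
      (∀ y : Plane, y ≠ 0 → ∀ w : Plane,
        αbar (lineOf y) (mfderiv 𝓘(ℝ, Plane) 𝓘(ℝ, ℝ) lineOf y w) =
          1 / 2 * (1 / (y 0 ^ 2 + y 1 ^ 2)) * (-y 1 * w 0 + y 0 * w 1)) ∧
      αbar.cohomClass hbar ≠ 0 ∧
      Submodule.span ℝ {αbar.cohomClass hbar} = ⊤ ∧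
      ∃ α : OneForm (EM × ℝ) (ProjBundle V),
        -- `α̂ = j^* α`
        (∀ v : TotalSpace Plane V, v.2 ≠ 0 →
          ∀ X : TangentSpace (𝓘(ℝ, EM).prod 𝓘(ℝ, Plane)) v,
          α (toProj v) (mfderiv (𝓘(ℝ, EM).prod 𝓘(ℝ, Plane)) 𝓘(ℝ, EM × ℝ) toProj v X) =
            alphaHat cov o v X) ∧
        -- `α` vanishes on the horizontal distribution
        (∀ Y ∈ projHorizontal cov, α Y.proj Y.2 = 0) ∧
        -- on each fibre, `α` is closed and represents the class of `ᾱ`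
        (∀ (x : M) (ψ : Plane ≃ₗ[ℝ] V x),
          0 < areaForm o x (ψ (EuclideanSpace.single 0 1)) (ψ (EuclideanSpace.single 1 1)) →
          ∃ (β : OneForm ℝ RP1) (hβ : β ∈ closedForms ℝ RP1),
            (∀ (L : RP1) (Y : TangentSpace 𝓘(ℝ, ℝ) L),
              β L Y = α (fiberParam ψ L)
                (mfderiv 𝓘(ℝ, ℝ) 𝓘(ℝ, EM × ℝ) (fiberParam ψ) L Y)) ∧
            β.cohomClass hβ = αbar.cohomClass hbar) ∧
        -- `dα = ½ π^* Ω` if the connection is metric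
        (cov.IsMetricCompatible →
          ∀ (q : ProjBundle V) (X Y : TangentSpace 𝓘(ℝ, EM × ℝ) q),
            α.d q X Y = 1 / 2 * curvatureForm cov o q.proj
              (mfderiv 𝓘(ℝ, EM × ℝ) 𝓘(ℝ, EM) ProjBundle.proj q X)
              (mfderiv 𝓘(ℝ, EM × ℝ) 𝓘(ℝ, EM) ProjBundle.proj q Y)) := by
  obtain ⟨γ, hγ, hform, hne, hspan⟩ := exists_generator_RP1
  obtain ⟨α, hα⟩ := exists_oneForm_pullback_eq_alphaHat cov ho
  refine ⟨γ, hγ, hform, hne, hspan, α, hα, ?_, ?_, ?_⟩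
  · rintro _ ⟨v, hv, X, hX, rfl⟩
    refine (hα v hv X).trans ?_
    have hX' : connectionForm cov v X = 0 := hX
    rw [alphaHat, hX', areaForm_zero_right, mul_zero]
  · exact fun x ψ hψ => exists_fiberParam_pullback hα hγ hform ψ hψ
  · intro hcov q X Y
    obtain ⟨E, hE, hf, hq⟩ := exists_frame_at ho q
    have hd := d_eq_connectionCoeff_d hE hcov hα hq hf X Y
    rw [← curvatureForm_eq_connectionCoeff_d hE hcov hf] at hd
    -- At the base point of the preferred charts dπ is the first projection, so the vectors in `hd`
    -- are the images of X and Y.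
    rw [ProjBundle.mfderiv_proj]
    exact hd
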